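/- Let $n\ge 2$, $k\ge 1$ and $\mathfrak g=D_{n+k}=\mathfrak{so}(2(n+k),\mathbb C)$, realized as the $2(n+k)\times 2(n+k)$ matrices that are antisymmetric with respect to the anti-diagonal. Let $\mathfrak p$ be the parabolic subalgebra determined by $\Sigma=\{\alpha_k\}$, i.e. the block upper triangular matrices in $\mathfrak g$ with diagonal blocks of sizes $k,2n,k$. Positive root spaces are those in the strictly upper triangular matrices, weights are written in the basis $\varepsilon_1,\dots,\varepsilon_{n+k}$ of coordinates on the diagonal Cartan subalgebra, and $\delta=[n+k-1,\dots,1,0]$ is the half sum of the positive roots. For $a>b$ let $y_{a,b}$ and $Y_{a,b}$ denote the matrix $E_{a,b}-E_{2(n+k)+1-b,\,2(n+k)+1-a}$ (written $Y_{a,b}$ if it lies in $\mathfrak p$ and $y_{a,b}$ otherwise). For a $\mathfrak p$-dominant and $\mathfrak p$-integral weight $\nu$ let $V_\nu$ be the irreducible (finite-dimensional) $\mathfrak p$-module with highest weight $\nu$ and highest weight vector $v_\nu$, and $M_{\mathfrak p}(\nu)=\mathcal U(\mathfrak g)\otimes_{\mathcal U(\mathfrak p)}V_\nu$. Let $$\lambda+\delta=\tfrac12[2k-1,\dots,3,1\,|\,2n-1,\dots,3,1],\qquad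 \mu+\delta=\tfrac12[2k-1,\dots,3,-1\,|\,2n-1,\dots,3,-1],$$ with $k$ entries before the bar and $n$ entries after it. Then the vector $$w=y_{k+n+1,k}\otimes v_\lambda-\sum_{j=1}^{n-1}y_{k+j,k}\otimes Y_{k+n+1,k+j}v_\lambda\in M_{\mathfrak p}(\lambda)$$ is nonzero, has weight $\mu$ and is annihilated by all positive root spaces of $\mathfrak g$, and every vector of $M_{\mathfrak p}(\lambda)$ with the last two properties is a multiple of $w$. There is a homomorphism of $\mathfrak g$-modules $\varphi:M_{\mathfrak p}(\mu)\to M_{\mathfrak p}(\lambda)$ with $\varphi(1\otimes v_\mu)=w$, and every homomorphism $M_{\mathfrak p}(\mu)\to M_{\mathfrak p}(\lambda)$ is a scalar multiple of $\varphi$. Similarly, for $$\lambda'+\delta=\tfrac12[2k-1,\dots,3,1\,|\,2n-1,\dots,3,-1],\qquad \mu'+\delta=\tfrac12[2k-1,\dots,3,-1\,|\,2n-1,\dots,3,1],$$ the same statements hold for $\lambda',\mu'$ in place of $\lambda,\mu$ with the vector $$w'=y_{k+n,k}\otimes v_{\lambda'}-\sum_{j=1}^{n-1}y_{k+j,k}\otimes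 Y_{k+n,k+j}v_{\lambda'}\in M_{\mathfrak p}(\lambda').$$ -/

import Mathlib

open scoped TensorProduct

noncomputable section

namespace GenVerma

attribute [local instance] LieRing.ofAssociativeRing

/-! ### The orthogonal Lie algebra and its parabolic subalgebra -/

/-- The matrix of the symmetric bilinear form `β(x, y) = ∑ j, x_j y_{2m+1-j}` on `ℂ^{2m}`. -/
def antidiag (m : ℕ) : Matrix (Fin (2 * m)) (Fin (2 * m)) ℂ :=
  Matrix.of fun i j => if j = i.rev then 1 else 0

/-- `D_m = so(2m, ℂ)`, as the matrices that are antisymmetric with respect to the antidiagonal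
(see `mem_so_iff`). -/
abbrev so (m : ℕ) : LieSubalgebra ℂ (Matrix (Fin (2 * m)) (Fin (2 * m)) ℂ) :=
  skewAdjointMatricesLieSubalgebra (antidiag m)

theorem mem_so_iff {m : ℕ} (A : Matrix (Fin (2 * m)) (Fin (2 * m)) ℂ) :
    A ∈ so m ↔ ∀ i j, A i j = - A j.rev i.rev := by
  have h1 : ∀ i j, (A.transpose * antidiag m) i j = A j.rev i := by
    intro i j
    rw [Matrix.mul_apply, Finset.sum_eq_single j.rev]
    · simp [antidiag]
    · intro l _ hl
      have : j ≠ l.rev := fun h => hl (by rw [h, Fin.rev_rev])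
      simp [antidiag, this]
    · simp
  have h2 : ∀ i j, (antidiag m * -A) i j = - A i.rev j := by
    intro i j
    rw [Matrix.mul_apply, Finset.sum_eq_single i.rev]
    · simp [antidiag]
    · intro l _ hl
      simp [antidiag, hl]
    · simp
  rw [mem_skewAdjointMatricesLieSubalgebra, mem_skewAdjointMatricesSubmodule]
  unfold Matrix.IsSkewAdjoint Matrix.IsAdjointPair
  rw [← Matrix.ext_iff]
  simp only [h1, h2]
  constructor
  · intro h i j
    have := h j i.rev
    rwa [Fin.rev_rev] at this
  · intro h i j
    have := h j.rev i
    rwa [Fin.rev_rev] at this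

/-- The matrix unit `E_{a,b}` of size `2m`, where rows and columns are numbered from `1` to `2m`
(it is `0` if `a` or `b` is out of this range). -/
def matE (m a b : ℕ) : Matrix (Fin (2 * m)) (Fin (2 * m)) ℂ :=
  Matrix.of fun i j => if (i : ℕ) + 1 = a ∧ (j : ℕ) + 1 = b then 1 else 0

/-- The element `E_{a,b} - E_{2m+1-b,2m+1-a}` of `so(2m, ℂ)`. These are the elements called
`h_a` (for `a = b ≤ m`), `x_{a,b}` or `X_{a,b}` (for `a < b`), `y_{a,b}` or `Y_{a,b}`
(for `b < a`). -/
def gen (m a b : ℕ) : so m :=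
  ⟨matE m a b - matE m (2 * m + 1 - b) (2 * m + 1 - a), by
    rw [mem_so_iff]
    intro i j
    have hi := i.isLt
    have hj := j.isLt
    simp only [matE, Matrix.sub_apply, Matrix.of_apply, Fin.val_rev, neg_sub]
    congr 1 <;> refine if_congr ?_ rfl rfl <;> omega⟩

/-- The index (`0`, `1` or `2`) of the block of the row or column `i` with respect to the
partition `2(n+k) = k + 2n + k`. -/
def blk (n k : ℕ) (i : Fin (2 * (n + k))) : ℕ :=
  if (i : ℕ) < k then 0 else if (i : ℕ) < k + 2 * n then 1 else 2

/-- The parabolic subalgebra `𝔭 = 𝔤₀ ⊕ 𝔤₊` of `𝔤 = so(2(n+k), ℂ)` of block upper triangular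
matrices with respect to the partition `k + 2n + k`. For `n ≥ 2` and `k ≥ 1` it is the standard
parabolic subalgebra given by `Σ = {α_k}`, that is, the sum of the Cartan subalgebra and of the
root spaces of the roots in which `α_k` has a nonnegative coefficient. -/
def par (n k : ℕ) : LieSubalgebra ℂ (so (n + k)) where
  carrier := {A | ∀ i j, blk n k j < blk n k i → A.1 i j = 0}
  add_mem' := by
    intro A B hA hB i j h
    simp [hA i j h, hB i j h]
  zero_mem' := by
    intro i j _
    simp
  smul_mem' := by
    intro c A hA i j h
    simp [hA i j h]
  lie_mem' := by
    intro A B hA hB i j h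
    have key : ∀ C D : so (n + k),
        (∀ i j, blk n k j < blk n k i → C.1 i j = 0) →
        (∀ i j, blk n k j < blk n k i → D.1 i j = 0) → (C.1 * D.1) i j = 0 := by
      intro C D hC hD
      rw [Matrix.mul_apply]
      refine Finset.sum_eq_zero fun l _ => ?_
      rcases lt_or_ge (blk n k l) (blk n k i) with hl | hl
      · rw [hC i l hl, zero_mul]
      · rw [hD l j (lt_of_lt_of_le h hl), mul_zero]
    rw [LieSubalgebra.coe_bracket, Ring.lie_def, Matrix.sub_apply, key A B hA hB,
      key B A hB hA, sub_zero]

/-- The element `E_{a,b} - E_{2m+1-b,2m+1-a}`, `m = n + k`, of `𝔤₀ ⊆ 𝔭`, where `a` and `b` belong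
to the middle block. -/
def genP (n k a b : ℕ) (ha : k < a ∧ a ≤ k + 2 * n) (hb : k < b ∧ b ≤ k + 2 * n) : par n k :=
  ⟨gen (n + k) a b, by
    intro i j hij
    have hi := i.isLt
    have hj := j.isLt
    have hblk : ∀ l : Fin (2 * (n + k)), k < (l : ℕ) + 1 → (l : ℕ) + 1 ≤ k + 2 * n →
        blk n k l = 1 := by
      intro l h1 h2
      rw [blk, if_neg (by omega), if_pos (by omega)]
    simp only [gen, matE, Matrix.sub_apply, Matrix.of_apply]
    rw [if_neg, if_neg, sub_zero]
    · rintro ⟨h1, h2⟩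
      rw [hblk i (by omega) (by omega), hblk j (by omega) (by omega)] at hij
      omega
    · rintro ⟨h1, h2⟩
      rw [hblk i (by omega) (by omega), hblk j (by omega) (by omega)] at hij
      omega⟩

/-- The universal enveloping algebra of `𝔤 = so(2(n+k), ℂ)`. -/
abbrev Ug (n k : ℕ) : Type := UniversalEnvelopingAlgebra ℂ (so (n + k))

/-- The universal enveloping algebra of `𝔭`. -/
abbrev Up (n k : ℕ) : Type := UniversalEnvelopingAlgebra ℂ (par n k)

/-- The map `𝔤 → U(𝔤)`. -/
def ιg (n k : ℕ) : so (n + k) →ₗ⁅ℂ⁆ Ug n k := UniversalEnvelopingAlgebra.ι ℂ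

/-- The map `𝔭 → U(𝔭)`. -/
def ιp (n k : ℕ) : par n k →ₗ⁅ℂ⁆ Up n k := UniversalEnvelopingAlgebra.ι ℂ

/-- The algebra homomorphism `U(𝔭) → U(𝔤)` induced by the inclusion. -/
def incl (n k : ℕ) : Up n k →ₐ[ℂ] Ug n k :=
  UniversalEnvelopingAlgebra.lift ℂ ((ιg n k).comp (par n k).incl)

/-! ### Weights -/

/-- Strictly upper triangular elements of `so(2m, ℂ)`: the sum of all positive root spaces. -/
def IsPos {m : ℕ} (A : so m) : Prop := ∀ i j, j ≤ i → A.1 i j = 0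

/-- Diagonal elements of `so(2m, ℂ)`: the Cartan subalgebra. -/
def IsCartan {m : ℕ} (A : so m) : Prop := ∀ i j, i ≠ j → A.1 i j = 0

/-- The value `∑ i, λ_i A_{i,i}` at a diagonal element `A = diag(a_1, …, a_m, -a_m, …, -a_1)` of
the weight `[λ_1, …, λ_m] = ∑ i, λ_i ε_i`, where `ε_i(A) = a_i`. -/
def wtEval {m : ℕ} (lam : Fin m → ℂ) (A : so m) : ℂ :=
  ∑ i : Fin m, lam i * A.1 (Fin.castLE (by omega) i) (Fin.castLE (by omega) i)

/-- The half sum `δ = [m-1, m-2, …, 1, 0]` of the positive roots of `D_m`. -/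
def delta (m : ℕ) (i : Fin m) : ℂ := (m : ℂ) - 1 - (i : ℕ)

/-- The weight `½[2k-1, …, 5, 3, s | 2n-1, …, 5, 3, t]` of `D_{n+k}`, with `k` entries before the
bar and `n` entries after it. -/
def oddWt (n k : ℕ) (s t : ℂ) (i : Fin (n + k)) : ℂ :=
  (1 / 2) *
    (if (i : ℕ) + 1 = k then s
     else if (i : ℕ) + 1 = n + k then t
     else if (i : ℕ) < k then 2 * ((k : ℂ) - (i : ℕ)) - 1
     else 2 * ((n : ℂ) + k - (i : ℕ)) - 1)

/-! ### The simple `𝔭`-module with highest weight `λ` -/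

/-- The left ideal of `U(𝔭)` generated by all `X` in the positive root spaces and all
`H - λ(H)`, `H` in the Cartan subalgebra. The quotient of `U(𝔭)` by it is the universal
`𝔭`-module with highest weight `λ`. -/
def hwIdeal (n k : ℕ) (lam : Fin (n + k) → ℂ) : Ideal (Up n k) :=
  Ideal.span
    ({u | ∃ X : par n k, IsPos X.1 ∧ u = ιp n k X} ∪
     {u | ∃ H : par n k, IsCartan H.1 ∧ u = ιp n k H - algebraMap ℂ (Up n k) (wtEval lam H.1)})

/-- The largest proper left ideal of `U(𝔭)` that contains `hwIdeal n k lam`: the sum of all of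
them. -/
def maxIdeal (n k : ℕ) (lam : Fin (n + k) → ℂ) : Ideal (Up n k) :=
  sSup {J : Ideal (Up n k) | hwIdeal n k lam ≤ J ∧ J ≠ ⊤}

/-- The irreducible `𝔭`-module `V_λ` with highest weight `λ`, as the irreducible quotient of the
universal `𝔭`-module with highest weight `λ`. It is finite-dimensional if (and only if) `λ` is
`𝔭`-dominant and `𝔭`-integral. -/
abbrev VV (n k : ℕ) (lam : Fin (n + k) → ℂ) : Type := Up n k ⧸ maxIdeal n k lam

/-- The highest weight vector `v_λ` of `V_λ`. -/
def hwVec (n k : ℕ) (lam : Fin (n + k) → ℂ) : VV n k lam :=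
  Submodule.Quotient.mk (1 : Up n k)

/-! ### Generalized Verma modules -/

/-- The `U(𝔤)`-submodule of `U(𝔤) ⊗_ℂ V_λ` generated by the elements `ua ⊗ v - u ⊗ av` with
`a ∈ U(𝔭)`. -/
def balanced (n k : ℕ) (lam : Fin (n + k) → ℂ) : Submodule (Ug n k) (Ug n k ⊗[ℂ] VV n k lam) :=
  Submodule.span (Ug n k)
    {z | ∃ (u : Ug n k) (a : Up n k) (v : VV n k lam),
      z = (u * incl n k a) ⊗ₜ[ℂ] v - u ⊗ₜ[ℂ] (a • v)}

/-- The generalized Verma module `M_𝔭(λ) = U(𝔤) ⊗_{U(𝔭)} V_λ`, a left `U(𝔤)`-module. -/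
abbrev MM (n k : ℕ) (lam : Fin (n + k) → ℂ) : Type :=
  (Ug n k ⊗[ℂ] VV n k lam) ⧸ balanced n k lam

/-- The element `u ⊗ v` of `M_𝔭(λ)`. -/
def tens (n k : ℕ) (lam : Fin (n + k) → ℂ) (u : Ug n k) (v : VV n k lam) : MM n k lam :=
  Submodule.Quotient.mk (u ⊗ₜ[ℂ] v)

/-- The element `y_{p,k} ⊗ v_λ - ∑_{j=1}^{n-1} y_{k+j,k} ⊗ Y_{p,k+j} v_λ` of `M_𝔭(λ)`, where the
row `p` belongs to the middle block. The summation variable below is `j - 1`. -/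
def extVec (n k : ℕ) (lam : Fin (n + k) → ℂ) (p : ℕ) (hp : k < p ∧ p ≤ k + 2 * n) : MM n k lam :=
  tens n k lam (ιg n k (gen (n + k) p k)) (hwVec n k lam) -
    ∑ j : Fin (n - 1),
      tens n k lam (ιg n k (gen (n + k) (k + (j + 1)) k))
        (ιp n k (genP n k p (k + (j + 1)) hp (by have := j.isLt; omega)) • hwVec n k lam)

/-- `w ∈ M_𝔭(λ)` has weight `μ` and is annihilated by all positive root spaces of `𝔤`. -/
def IsExtremal (n k : ℕ) (lam mu : Fin (n + k) → ℂ) (w : MM n k lam) : Prop :=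
  (∀ X : so (n + k), IsPos X → ιg n k X • w = 0) ∧
  (∀ H : so (n + k), IsCartan H → ιg n k H • w = wtEval mu H • w)

end GenVerma

end

open scoped TensorProduct

noncomputable section

namespace GenVerma

attribute [local instance] LieRing.ofAssociativeRing

/-! ### Modules over universal enveloping algebras -/

section Enveloping

variable {L : Type*} [LieRing L] [LieAlgebra ℂ L]

/-! Put `m = n + k` and write `a'` for `a.rev`; indices in the proof start from 0, so `k - 1` is row
`k`. Subtracting `δ` gives `λ = [1/2-n, …, 1/2-n | 1/2, …, 1/2, ±1/2]` and `μ = λ - ε_k ∓ ε_{n+k}`.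
Thus `V_λ` is a half spin module of the middle `so(2n)` twisted by a character of `gl(k)`, and `V_μ`
is the opposite half spin module tensored with `(ℂ^k)^*` and the same twist. Both are found inside
one explicit `𝔤`-module, where `w` can be computed.

That module consists of polynomials in `2m × n` variables tensored with the spinors of `so(2m)`. It
carries bosons `q_{a,l}`, `p_{a,l}` and Clifford generators `γ_a`, and a matrix `X` acts by `∑
X_{ab} (∑_l q_{a,l} p_{b,l} + ½ γ_a γ_{b'})`. For `a` in the first block `q` is minus a derivation
and `p` a multiplication. Hence `𝔭` acts on the polynomial `1` by the character `-n tr_k`, and the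
vectors `1 ⊗ s`, with `s` a half spinor of the middle block, form a copy of `V_λ`.

The Dirac operators `D_l = ∑_a q_{a,l} γ_{a'}` commute with `𝔤` (`Oscillators.rho_mul_dirac`).
Therefore the vectors `∑_l D_l p_{b,l} (1 ⊗ s)`, `b` in the first block, form a copy of `V_μ` when
`s` has the opposite parity. The same vectors equal `∑_a G(a,b) (1 ⊗ γ_{a'} s)`, summed over the
middle block (`wv_eq_dirac`); this needs exactly `n` copies of the bosons, because `∑ γ_a γ_{a'} =
n` over the middle block. So they come from degree `-1` of `M_𝔭(λ)`, and the highest weight vector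
among them is the image of `w` (`wvM_vac_not`).

The `𝔤`-map from `M_𝔭(λ)` to the oscillator module is injective in degrees `0` and `-1`
(`OscRealization.eq_zero_of_mem_lowDeg`), since the coefficients in front of the `G(a,b)` can be
read off from quadratic monomials. Consequently `w` is nonzero and extremal, and it satisfies the
defining relations of `V_μ`, which yields `φ`.

For uniqueness, the grading element forces an extremal vector of weight `μ` into degree `-1`. Its
annihilation by the root vectors joining the first and middle blocks forces its coefficients to be
`γ_{a'} q_b` for some spinors `q_b` (`cliff_of_extremal`), and the weight leaves only `b = k` and a
multiple of one spinor. Homomorphisms are determined by the image of `1 ⊗ v_μ`, which is extremal.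

The PBW theorem is avoided: `smul_mem_of_span` supplies the needed spanning statements, and
`IsHW.mem_maxIdeal_iff` identifies `V_ν` with any irreducible cyclic model. -/

theorem ι_mul (x y : L) :
    UniversalEnvelopingAlgebra.ι ℂ x * UniversalEnvelopingAlgebra.ι ℂ y =
      UniversalEnvelopingAlgebra.ι ℂ y * UniversalEnvelopingAlgebra.ι ℂ x +
        UniversalEnvelopingAlgebra.ι ℂ ⁅x, y⁆ := by
  rw [LieHom.map_lie, LieRing.of_associative_ring_bracket]
  abel

/-- The universal property, applied to the subalgebra generated by the image of `L`, yields a map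
into it whose composite with the inclusion is the identity. -/
theorem adjoin_range_ι :
    Algebra.adjoin ℂ (Set.range (UniversalEnvelopingAlgebra.ι ℂ : L → _)) = ⊤ := by
  set S := Algebra.adjoin ℂ (Set.range (UniversalEnvelopingAlgebra.ι ℂ : L → _)) with hS
  let f : L →ₗ⁅ℂ⁆ S :=
    { toFun := fun x => ⟨UniversalEnvelopingAlgebra.ι ℂ x, Algebra.subset_adjoin ⟨x, rfl⟩⟩
      map_add' := fun x y => Subtype.ext (map_add _ x y)
      map_smul' := fun c x => Subtype.ext (map_smul _ c x)
      map_lie' := fun {x y} => Subtype.ext (LieHom.map_lie _ x y) }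
  have h : S.val.comp (UniversalEnvelopingAlgebra.lift ℂ f) = AlgHom.id ℂ _ := by
    ext x
    change ((UniversalEnvelopingAlgebra.lift ℂ f (UniversalEnvelopingAlgebra.ι ℂ x) : S) : _) =
      UniversalEnvelopingAlgebra.ι ℂ x
    rw [UniversalEnvelopingAlgebra.lift_ι_apply]
    rfl
  refine eq_top_iff.2 fun u _ => ?_
  have := (UniversalEnvelopingAlgebra.lift ℂ f u).2
  have h2 := DFunLike.congr_fun h u
  simp only [AlgHom.comp_apply, AlgHom.id_apply] at h2
  rw [← h2]
  exact this

variable {M : Type*} [AddCommGroup M] [Module ℂ M] [Module (UniversalEnvelopingAlgebra ℂ L) M]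
  [IsScalarTower ℂ (UniversalEnvelopingAlgebra ℂ L) M]

theorem smul_mem_of_ι {C : Submodule ℂ M}
    (h : ∀ (x : L), ∀ z ∈ C, UniversalEnvelopingAlgebra.ι ℂ x • z ∈ C)
    (u : UniversalEnvelopingAlgebra ℂ L) {z : M} (hz : z ∈ C) : u • z ∈ C := by
  have hu : u ∈ Algebra.adjoin ℂ (Set.range (UniversalEnvelopingAlgebra.ι ℂ : L → _)) := by
    rw [adjoin_range_ι]; trivial
  induction hu using Algebra.adjoin_induction generalizing z with
  | mem x hx =>
    obtain ⟨x, rfl⟩ := hx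
    exact h x z hz
  | algebraMap c => rw [algebraMap_smul]; exact C.smul_mem c hz
  | add x y _ _ hx hy => rw [add_smul]; exact C.add_mem (hx hz) (hy hz)
  | mul x y _ _ hx hy => rw [mul_smul]; exact hx (hy hz)

/-- A substitute for the PBW factorization. Let `W` be the smallest `A`-stable subspace containing
`V`. The vectors `z` of `W` with `L z ⊆ W` again contain `V` and are `A`-stable, because `x a z = a
x z + [x, a] z`; by minimality `W` is stable under all of `L`. Neither `A` nor `B` has to be closed
under the bracket. -/
theorem smul_mem_of_span (A B : Set L) (hAB : Submodule.span ℂ (A ∪ B) = ⊤)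
    (V C : Submodule ℂ M) (hVC : V ≤ C)
    (hA : ∀ a ∈ A, ∀ z ∈ C, UniversalEnvelopingAlgebra.ι ℂ a • z ∈ C)
    (hB : ∀ b ∈ B, ∀ z ∈ V, UniversalEnvelopingAlgebra.ι ℂ b • z ∈ V)
    (u : UniversalEnvelopingAlgebra ℂ L) {v : M} (hv : v ∈ V) : u • v ∈ C := by
  let P : Submodule ℂ M → Prop := fun W =>
    V ≤ W ∧ ∀ a ∈ A, ∀ z ∈ W, UniversalEnvelopingAlgebra.ι ℂ a • z ∈ W
  let W : Submodule ℂ M := sInf {W | P W}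
  have hW : P W := by
    refine ⟨le_sInf fun W h => h.1, fun a ha z hz => ?_⟩
    rw [Submodule.mem_sInf] at hz ⊢
    exact fun W' h => h.2 a ha z (hz W' h)
  have hle : ∀ W', P W' → W ≤ W' := fun W' h => sInf_le h
  let W' : Submodule ℂ M :=
    { carrier := {z | z ∈ W ∧ ∀ x : L, UniversalEnvelopingAlgebra.ι ℂ x • z ∈ W}
      add_mem' := fun {y z} hy hz => ⟨W.add_mem hy.1 hz.1, fun x => by
        rw [smul_add]; exact W.add_mem (hy.2 x) (hz.2 x)⟩
      zero_mem' := ⟨W.zero_mem, fun x => by rw [smul_zero]; exact W.zero_mem⟩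
      smul_mem' := fun c z hz => ⟨W.smul_mem c hz.1, fun x => by
        rw [smul_algebra_smul_comm]; exact W.smul_mem c (hz.2 x)⟩ }
  have hP : P W' := by
    refine ⟨fun v hv => ⟨hW.1 hv, fun x => ?_⟩, fun a ha z hz => ⟨hz.2 a, fun x => ?_⟩⟩
    · have hx : x ∈ Submodule.span ℂ (A ∪ B) := by rw [hAB]; trivial
      induction hx using Submodule.span_induction with
      | mem x h =>
        rcases h with h | h
        · exact hW.2 x h v (hW.1 hv)
        · exact hW.1 (hB x h v hv)
      | zero => rw [map_zero, zero_smul]; exact W.zero_mem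
      | add x y _ _ hx hy => rw [map_add, add_smul]; exact W.add_mem hx hy
      | smul c x _ hx => rw [map_smul, smul_assoc]; exact W.smul_mem c hx
    · rw [← mul_smul, ι_mul, add_smul, mul_smul]
      exact W.add_mem (hW.2 a ha _ (hz.2 x)) (hz.2 _)
  have hst : ∀ (x : L), ∀ z ∈ W, UniversalEnvelopingAlgebra.ι ℂ x • z ∈ W :=
    fun x z hz => (hle W' hP hz).2 x
  exact hle C ⟨hVC, hA⟩ (smul_mem_of_ι hst u (hW.1 hv))

/-- The eigenspace for the eigenvalue `c` of the action of `h`. -/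
def wtSpace (M : Type*) [AddCommGroup M] [Module ℂ M]
    [Module (UniversalEnvelopingAlgebra ℂ L) M]
    [IsScalarTower ℂ (UniversalEnvelopingAlgebra ℂ L) M] (h : L) (c : ℂ) : Submodule ℂ M where
  carrier := {z | UniversalEnvelopingAlgebra.ι ℂ h • z = c • z}
  add_mem' := fun {y z} hy hz => by
    change _ • (y + z) = c • (y + z)
    rw [smul_add, smul_add, hy, hz]
  zero_mem' := by simp
  smul_mem' := fun a z hz => by
    change _ • a • z = c • a • z
    rw [smul_algebra_smul_comm, hz, smul_comm]

theorem mem_wtSpace {h : L} {c : ℂ} {z : M} :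
    z ∈ wtSpace M h c ↔ UniversalEnvelopingAlgebra.ι ℂ h • z = c • z := Iff.rfl

theorem ι_smul_mem_wtSpace {h y : L} {c d : ℂ} (hy : ⁅h, y⁆ = d • y) {z : M}
    (hz : z ∈ wtSpace M h c) : UniversalEnvelopingAlgebra.ι ℂ y • z ∈ wtSpace M h (c + d) := by
  rw [mem_wtSpace] at *
  rw [← mul_smul, ι_mul, add_smul, mul_smul, hz, hy, map_smul, smul_assoc, add_smul,
    smul_algebra_smul_comm]

theorem eq_zero_of_mem_wtSpace {ι' : Type*} {h : L} {c : ℂ} (d : ι' → ℂ) (hd : ∀ i, d i ≠ c)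
    {z : M} (hz : z ∈ wtSpace M h c) (hz' : z ∈ ⨆ i, wtSpace M h (d i)) : z = 0 := by
  let f : Module.End ℂ M := Algebra.lsmul ℂ ℂ M (UniversalEnvelopingAlgebra.ι ℂ h)
  have key : ∀ c, wtSpace M h c = f.eigenspace c := by
    intro c
    ext z
    rw [mem_wtSpace, Module.End.mem_eigenspace_iff]
    rfl
  have h1 := f.eigenspaces_iSupIndep c
  refine Submodule.disjoint_def.1 h1 z (key c ▸ hz) ?_
  refine (iSup_le fun i => ?_ : ⨆ i, wtSpace M h (d i) ≤ _) hz'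
  rw [key]
  exact le_iSup₂_of_le (d i) (hd i) le_rfl

end Enveloping

/-! ### Elements of the orthogonal Lie algebra -/

/-- The element `E_{a,b} - E_{b',a'}` of `so(2m, ℂ)`, where rows and columns are numbered
from `0` and `a' = a.rev`. -/
def G {m : ℕ} (a b : Fin (2 * m)) : so m := gen m (a + 1) (b + 1)

theorem G_apply {m : ℕ} (a b i j : Fin (2 * m)) :
    (G a b).1 i j = (if i = a ∧ j = b then 1 else 0) - if i = b.rev ∧ j = a.rev then 1 else 0 := by
  have ha := a.isLt
  have hb := b.isLt
  simp only [G, gen, matE, Matrix.sub_apply, Matrix.of_apply]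
  congr 1 <;> refine if_congr ?_ rfl rfl <;>
    simp only [Fin.ext_iff, Fin.val_rev] <;> omega

theorem gen_eq_G {m : ℕ} (a b : Fin (2 * m)) (p q : ℕ) (hp : p = a + 1) (hq : q = b + 1) :
    gen m p q = G a b := by
  subst hp hq; rfl

theorem so_apply_rev {m : ℕ} (X : so m) (i j : Fin (2 * m)) : X.1 j.rev i.rev = - X.1 i j := by
  rw [(mem_so_iff X.1).1 X.2 i j, neg_neg]

theorem so_apply_rev_self {m : ℕ} (X : so m) (i : Fin (2 * m)) : X.1 i i.rev = 0 := by
  have := so_apply_rev X i i.rev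
  rw [Fin.rev_rev] at this
  linear_combination this / 2

/-- The factor `1/2` appears because `G a b = - G b' a'`, so that every root vector is met twice. -/
theorem so_eq_sum {m : ℕ} (X : so m) : X = (1 / 2 : ℂ) • ∑ a, ∑ b, X.1 a b • G a b := by
  apply Subtype.ext
  ext i j
  have h : ((∑ a, ∑ b, X.1 a b • G a b : so m) : Matrix _ _ ℂ) i j =
      ∑ a, ∑ b, X.1 a b * (G a b).1 i j := by
    have h1 : ((∑ a, ∑ b, X.1 a b • G a b : so m) : Matrix _ _ ℂ) =
        ∑ a, ∑ b, X.1 a b • (G a b).1 := by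
      rw [AddSubmonoidClass.coe_finsetSum]
      exact Finset.sum_congr rfl fun a _ => by
        rw [AddSubmonoidClass.coe_finsetSum]; rfl
    rw [h1, Matrix.sum_apply]
    exact Finset.sum_congr rfl fun a _ => by
      rw [Matrix.sum_apply]; rfl
  change _ = (1 / 2 : ℂ) * _
  rw [h]
  simp only [G_apply, mul_sub, Finset.sum_sub_distrib]
  have h1 : ∑ a, ∑ b, X.1 a b * (if i = a ∧ j = b then 1 else 0) = X.1 i j := by
    rw [Finset.sum_eq_single i, Finset.sum_eq_single j] <;> simp +contextual [eq_comm]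
  have h2 : ∑ a, ∑ b, X.1 a b * (if i = b.rev ∧ j = a.rev then 1 else 0) = X.1 j.rev i.rev := by
    rw [Finset.sum_eq_single j.rev, Finset.sum_eq_single i.rev]
    · simp
    · intro b _ hb
      rw [if_neg, mul_zero]
      rintro ⟨h, _⟩
      exact hb (by rw [h, Fin.rev_rev])
    · simp
    · intro b _ hb
      refine Finset.sum_eq_zero fun c _ => ?_
      rw [if_neg, mul_zero]
      rintro ⟨_, h⟩
      exact hb (by rw [h, Fin.rev_rev])
    · simp
  rw [h1, h2, so_apply_rev]
  ring

/-- The diagonal matrix with entries `d`. -/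
def dg {m : ℕ} (d : Fin (2 * m) → ℂ) (hd : ∀ i, d i.rev = - d i) : so m :=
  ⟨Matrix.diagonal d, by
    rw [mem_so_iff]
    intro i j
    by_cases h : i = j
    · subst h; simp [hd]
    · rw [Matrix.diagonal_apply_ne _ h, Matrix.diagonal_apply_ne, neg_zero]
      exact fun h' => h (Fin.rev_injective h').symm⟩

theorem dg_lie_apply {m : ℕ} (d : Fin (2 * m) → ℂ) (hd : ∀ i, d i.rev = - d i) (X : so m)
    (i j : Fin (2 * m)) : (⁅dg d hd, X⁆ : so m).1 i j = (d i - d j) * X.1 i j := by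
  rw [LieSubalgebra.coe_bracket, Ring.lie_def, Matrix.sub_apply]
  simp only [dg, Matrix.diagonal_mul, Matrix.mul_diagonal]
  ring

theorem dg_lie_G {m : ℕ} (d : Fin (2 * m) → ℂ) (hd : ∀ i, d i.rev = - d i)
    (a b : Fin (2 * m)) : ⁅dg d hd, G a b⁆ = (d a - d b) • G a b := by
  apply Subtype.ext
  ext i j
  rw [dg_lie_apply]
  change _ = (d a - d b) * (G a b).1 i j
  rw [G_apply]
  by_cases h1 : i = a ∧ j = b
  · rw [h1.1, h1.2]
  · by_cases h2 : i = b.rev ∧ j = a.rev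
    · rw [h2.1, h2.2, hd, hd]; ring
    · simp [h1, h2]

theorem isCartan_dg {m : ℕ} (d : Fin (2 * m) → ℂ) (hd : ∀ i, d i.rev = - d i) :
    IsCartan (dg d hd) := fun _ _ h => Matrix.diagonal_apply_ne _ h

theorem blk_mono {n k : ℕ} {i j : Fin (2 * (n + k))} (h : i ≤ j) : blk n k i ≤ blk n k j := by
  have : (i : ℕ) ≤ j := h
  unfold blk
  split_ifs <;> omega

theorem blk_rev {n k : ℕ} (i : Fin (2 * (n + k))) : blk n k i.rev = 2 - blk n k i := by
  have := i.isLt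
  unfold blk
  rw [Fin.val_rev]
  split_ifs <;> omega

theorem blk_le_two {n k : ℕ} (i : Fin (2 * (n + k))) : blk n k i ≤ 2 := by
  unfold blk; split_ifs <;> omega

theorem G_mem_par {n k : ℕ} {a b : Fin (2 * (n + k))} (h : blk n k a ≤ blk n k b) :
    G a b ∈ par n k := by
  intro i j hij
  have := blk_le_two (n := n) b
  rw [G_apply, if_neg, if_neg, sub_zero]
  · rintro ⟨rfl, rfl⟩
    rw [blk_rev, blk_rev] at hij
    omega
  · rintro ⟨rfl, rfl⟩
    omega

theorem mem_par_of_upper {n k : ℕ} {X : so (n + k)} (h : ∀ i j, j < i → X.1 i j = 0) :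
    X ∈ par n k := by
  intro i j hij
  refine h i j (lt_of_not_ge fun h' => ?_)
  have := blk_mono (n := n) (k := k) h'
  omega

theorem mem_par_of_isPos {n k : ℕ} {X : so (n + k)} (h : IsPos X) : X ∈ par n k :=
  mem_par_of_upper fun i j hij => h i j hij.le

theorem mem_par_of_isCartan {n k : ℕ} {X : so (n + k)} (h : IsCartan X) : X ∈ par n k :=
  mem_par_of_upper fun i j hij => h i j hij.ne'

/-! ### Highest weight modules over the parabolic subalgebra -/

section HighestWeight

variable {n k : ℕ} {M : Type*} [AddCommGroup M] [Module ℂ M] [Module (Up n k) M]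

/-- `v` is annihilated by the positive root spaces and has weight `lam`. -/
def IsHW (lam : Fin (n + k) → ℂ) (v : M) : Prop :=
  (∀ X : par n k, IsPos X.1 → ιp n k X • v = 0) ∧
  (∀ H : par n k, IsCartan H.1 → ιp n k H • v = wtEval lam H.1 • v)

theorem IsHW.smul_eq_zero [IsScalarTower ℂ (Up n k) M] {lam : Fin (n + k) → ℂ} {v : M}
    (hv : IsHW lam v) {u : Up n k} (hu : u ∈ hwIdeal n k lam) : u • v = 0 := by
  have : hwIdeal n k lam ≤ LinearMap.ker (LinearMap.toSpanSingleton (Up n k) M v) := by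
    refine Submodule.span_le.2 ?_
    rintro u (⟨X, hX, rfl⟩ | ⟨H, hH, rfl⟩)
    · exact hv.1 X hX
    · change (ιp n k H - algebraMap ℂ (Up n k) _) • v = 0
      rw [sub_smul, hv.2 H hH, algebraMap_smul, sub_self]
  exact this hu

theorem isHW_mk {lam : Fin (n + k) → ℂ} {J : Ideal (Up n k)} (hJ : hwIdeal n k lam ≤ J) :
    IsHW lam (Submodule.Quotient.mk (1 : Up n k) : Up n k ⧸ J) := by
  refine ⟨fun X hX => ?_, fun H hH => ?_⟩
  · rw [← Submodule.Quotient.mk_smul, Submodule.Quotient.mk_eq_zero, smul_eq_mul, mul_one]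
    exact hJ (Submodule.subset_span (Or.inl ⟨X, hX, rfl⟩))
  · rw [← Submodule.Quotient.mk_smul, ← Submodule.Quotient.mk_smul, Submodule.Quotient.eq,
      smul_eq_mul, mul_one, Algebra.smul_def, mul_one]
    exact hJ (Submodule.subset_span (Or.inr ⟨H, hH, rfl⟩))

theorem regH_aux (i : Fin (2 * (n + k))) :
    (2 * ((n : ℂ) + k) - 1 - 2 * ((i.rev : ℕ) : ℂ)) =
      -(2 * ((n : ℂ) + k) - 1 - 2 * ((i : ℕ) : ℂ)) := by
  rw [Fin.val_rev, Nat.cast_sub (by omega)]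
  push_cast
  ring

/-- A regular element of the Cartan subalgebra. -/
def regH (n k : ℕ) : par n k :=
  ⟨dg (fun i => 2 * ((n : ℂ) + k) - 1 - 2 * ((i : ℕ) : ℂ)) regH_aux,
    mem_par_of_isCartan (isCartan_dg _ regH_aux)⟩

theorem isCartan_regH : IsCartan (regH n k).1 := isCartan_dg _ regH_aux

theorem regH_lie_G (a b : Fin (2 * (n + k))) :
    ⁅(regH n k).1, G a b⁆ = (-2 * ((a : ℕ) - (b : ℕ)) : ℂ) • G a b := by
  rw [regH, dg_lie_G]
  congr 1
  ring

theorem span_lower_upper :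
    Submodule.span ℂ ({X : par n k | ∃ a b : Fin (2 * (n + k)), b < a ∧ X.1 = G a b} ∪
      {X : par n k | ∀ i j, j < i → X.1.1 i j = 0}) = ⊤ := by
  rw [eq_top_iff]
  intro X _
  set S := Submodule.span ℂ ({X : par n k | ∃ a b : Fin (2 * (n + k)), b < a ∧ X.1 = G a b} ∪
      {X : par n k | ∀ i j, j < i → X.1.1 i j = 0}) with hS
  have h : X.1 ∈ S.map ((par n k).incl : par n k →ₗ[ℂ] so (n + k)) := by
    rw [so_eq_sum X.1]
    refine Submodule.smul_mem _ _ (Submodule.sum_mem _ fun a _ => Submodule.sum_mem _ fun b _ => ?_)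
    by_cases hab : blk n k a ≤ blk n k b
    · refine Submodule.smul_mem _ _ ⟨⟨G a b, G_mem_par hab⟩, Submodule.subset_span ?_, rfl⟩
      rcases lt_or_ge b a with h | h
      · exact Or.inl ⟨a, b, h, rfl⟩
      · refine Or.inr fun i j hij => ?_
        rw [G_apply, if_neg, if_neg, sub_zero]
        · rintro ⟨rfl, rfl⟩
          exact absurd (Fin.rev_lt_rev.1 hij) (not_lt.2 h)
        · rintro ⟨rfl, rfl⟩
          exact absurd hij (not_lt.2 h)
    · rw [X.2 a b (not_le.1 hab), zero_smul]
      exact Submodule.zero_mem _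
  obtain ⟨Y, hY, hYX⟩ := h
  rwa [← Subtype.ext hYX]

/-- Upper triangular elements of `𝔭` preserve the line of `v`, and strictly lower ones strictly
lower the eigenvalue of `regH`. By `smul_mem_of_span`, `U(𝔭) v` has nothing but the line of `v` in
the top eigenvalue. -/
theorem IsHW.exists_sub_mem [IsScalarTower ℂ (Up n k) M] {lam : Fin (n + k) → ℂ} {v : M}
    (hv : IsHW lam v) (u : Up n k) : ∃ c : ℂ, u • v - c • v ∈
      ⨆ j : ℕ, wtSpace M (regH n k) (wtEval lam (regH n k).1 - (j + 1)) := by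
  set T : Submodule ℂ M := ⨆ j : ℕ, wtSpace M (regH n k) (wtEval lam (regH n k).1 - (j + 1))
    with hT
  have key : u • v ∈ Submodule.span ℂ {v} ⊔ T := by
    refine smul_mem_of_span (L := par n k) _ _ span_lower_upper (Submodule.span ℂ {v})
      (Submodule.span ℂ {v} ⊔ T) le_sup_left ?_ ?_ u (Submodule.mem_span_singleton_self v)
    · rintro X ⟨a, b, hab, hX⟩ z hz
      have hlie : ⁅regH n k, X⁆ = (-2 * ((a : ℕ) - (b : ℕ)) : ℂ) • X := by
        apply Subtype.ext
        rw [LieSubalgebra.coe_bracket]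
        change _ = (-2 * ((a : ℕ) - (b : ℕ)) : ℂ) • X.1
        rw [hX, regH_lie_G]
      have hmem : ∀ j : ℕ, ∀ y ∈ wtSpace M (regH n k) (wtEval lam (regH n k).1 - j),
          UniversalEnvelopingAlgebra.ι ℂ X • y ∈ T := by
        intro j y hy
        have h1 := ι_smul_mem_wtSpace hlie hy
        have hab' : (b : ℕ) < a := hab
        -- `G a b` lowers the eigenvalue by `2 (a - b)`; the final `- 1` offsets the shift `j + 1`
        -- in the definition of `T`.
        refine (le_iSup (fun j : ℕ => wtSpace M (regH n k)
          (wtEval lam (regH n k).1 - (j + 1))) (j + 2 * (a - b) - 1)) ?_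
        convert h1 using 1
        have h2 : ((j + 2 * ((a : ℕ) - b) - 1 : ℕ) : ℂ) + 1 = j + 2 * ((a : ℕ) - (b : ℕ)) := by
          rw [Nat.cast_sub (by omega)]
          push_cast [Nat.cast_sub hab'.le]
          ring
        rw [h2]
        congr 1
        ring
      obtain ⟨y, hy, w, hw, rfl⟩ := Submodule.mem_sup.1 hz
      refine Submodule.mem_sup_right ?_
      rw [smul_add]
      refine T.add_mem ?_ ?_
      · obtain ⟨c, rfl⟩ := Submodule.mem_span_singleton.1 hy
        rw [smul_algebra_smul_comm]
        refine T.smul_mem c (hmem 0 v ?_)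
        rw [mem_wtSpace, Nat.cast_zero, sub_zero]
        exact hv.2 (regH n k) isCartan_regH
      · rw [hT] at hw
        clear hz
        induction hw using Submodule.iSup_induction' with
        | mem j y hy => exact hmem (j + 1) y (by push_cast; exact hy)
        | zero => rw [smul_zero]; exact T.zero_mem
        | add x y _ _ hx hy => rw [smul_add]; exact T.add_mem hx hy
    · intro X hX z hz
      obtain ⟨c, rfl⟩ := Submodule.mem_span_singleton.1 hz
      let H : so (n + k) := dg (fun i => X.1.1 i i) fun i => so_apply_rev _ _ _
      have hH : IsCartan H := isCartan_dg _ _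
      have hP : IsPos (X.1 - H) := by
        intro i j hij
        change X.1.1 i j - Matrix.diagonal _ i j = 0
        rcases hij.lt_or_eq with h | h
        · rw [hX i j h, Matrix.diagonal_apply_ne _ h.ne', sub_zero]
        · rw [h, Matrix.diagonal_apply_eq, sub_self]
      have hXH : X = (⟨X.1 - H, mem_par_of_isPos hP⟩ : par n k) + ⟨H, mem_par_of_isCartan hH⟩ :=
        Subtype.ext (sub_add_cancel _ _).symm
      rw [smul_algebra_smul_comm, hXH, map_add, add_smul]
      have h1 := hv.1 ⟨X.1 - H, mem_par_of_isPos hP⟩ hP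
      have h2 := hv.2 ⟨H, mem_par_of_isCartan hH⟩ hH
      rw [ιp] at h1 h2
      rw [h1, h2, zero_add]
      exact Submodule.smul_mem _ _ (Submodule.smul_mem _ _ (Submodule.mem_span_singleton_self v))
  obtain ⟨y, hy, z, hz, h⟩ := Submodule.mem_sup.1 key
  obtain ⟨c, rfl⟩ := Submodule.mem_span_singleton.1 hy
  exact ⟨c, by rwa [← h, add_sub_cancel_left]⟩

/-- Two highest weight modules are compared through the pair `(v₁, v)`, itself a highest weight
vector. Since `u (v₁, v) = (0, v)` still has the top weight, `IsHW.exists_sub_mem` makes it a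
multiple `c (v₁, v)`. The second component gives `c = 1`, and then the first gives `v₁ = 0`. -/
theorem IsHW.one_mem [IsScalarTower ℂ (Up n k) M] {lam : Fin (n + k) → ℂ} {v : M}
    (hv : IsHW lam v) (hv0 : v ≠ 0) {J : Ideal (Up n k)} (hJ : hwIdeal n k lam ≤ J) {u : Up n k}
    (hu : u ∈ J) (huv : u • v = v) : (1 : Up n k) ∈ J := by
  let v₁ : Up n k ⧸ J := Submodule.Quotient.mk 1
  have hv₁ : IsHW lam v₁ := isHW_mk hJ
  have huv₁ : u • v₁ = 0 := by
    rw [← Submodule.Quotient.mk_smul, Submodule.Quotient.mk_eq_zero, smul_eq_mul, mul_one]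
    exact hu
  have hp : IsHW lam ((v₁, v) : (Up n k ⧸ J) × M) :=
    ⟨fun X hX => Prod.ext (hv₁.1 X hX) (hv.1 X hX),
      fun H hH => Prod.ext (hv₁.2 H hH) (hv.2 H hH)⟩
  obtain ⟨c, hc⟩ := hp.exists_sub_mem u
  have h0 : u • ((v₁, v) : (Up n k ⧸ J) × M) - c • (v₁, v) = 0 := by
    refine eq_zero_of_mem_wtSpace (h := regH n k) (c := wtEval lam (regH n k).1) _ ?_ ?_ hc
    · intro j hj
      have : ((j + 1 : ℕ) : ℂ) = 0 := by push_cast; linear_combination -hj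
      exact absurd (Nat.cast_eq_zero.1 this) (by omega)
    · refine Submodule.sub_mem _ ?_ (Submodule.smul_mem _ c (hp.2 _ isCartan_regH))
      have : u • ((v₁, v) : (Up n k ⧸ J) × M) = (0, v) := Prod.ext huv₁ huv
      rw [this]
      exact Prod.ext (by change _ • (0 : Up n k ⧸ J) = _ • (0 : Up n k ⧸ J); simp)
        (hv.2 _ isCartan_regH)
  have h1 : u • v₁ - c • v₁ = 0 := congrArg Prod.fst h0
  have h2 : u • v - c • v = 0 := congrArg Prod.snd h0
  have hc1 : c = 1 := by
    rw [huv] at h2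
    have : (1 - c) • v = 0 := by rw [sub_smul, one_smul, h2]
    rcases _root_.smul_eq_zero.1 this with h | h
    · linear_combination -h
    · exact absurd h hv0
  rw [huv₁, hc1, one_smul, zero_sub, neg_eq_zero] at h1
  exact (Submodule.Quotient.mk_eq_zero _).1 h1

/-- The annihilator of `v` is one of the ideals whose sum is `maxIdeal`. Conversely, if one of these
ideals contained some `x` with `x v ≠ 0`, irreducibility would produce an element of it fixing `v`,
and `IsHW.one_mem` would make the ideal improper. -/
theorem IsHW.mem_maxIdeal_iff [IsScalarTower ℂ (Up n k) M] {lam : Fin (n + k) → ℂ} {v : M}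
    (hv : IsHW lam v) (hv0 : v ≠ 0)
    (hirr : ∀ a : Up n k, a • v ≠ 0 → ∃ b : Up n k, b • a • v = v) {a : Up n k} :
    a ∈ maxIdeal n k lam ↔ a • v = 0 := by
  constructor
  · have : maxIdeal n k lam ≤ LinearMap.ker (LinearMap.toSpanSingleton (Up n k) M v) := by
      refine sSup_le ?_
      rintro J ⟨hJ, hJtop⟩ x hx
      change x • v = 0
      by_contra hxv
      obtain ⟨b, hb⟩ := hirr x hxv
      rw [← mul_smul] at hb
      exact hJtop ((Ideal.eq_top_iff_one J).2 (hv.one_mem hv0 hJ (J.mul_mem_left b hx) hb))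
    exact fun ha => this ha
  · intro ha
    have : LinearMap.ker (LinearMap.toSpanSingleton (Up n k) M v) ≤ maxIdeal n k lam := by
      refine le_sSup ⟨fun u hu => hv.smul_eq_zero hu, fun htop => hv0 ?_⟩
      have h1 : (1 : Up n k) ∈ LinearMap.ker (LinearMap.toSpanSingleton (Up n k) M v) := by
        rw [htop]; trivial
      have h2 : (1 : Up n k) • v = 0 := h1
      rwa [one_smul] at h2
    exact this ha

end HighestWeight

/-! ### Representations of `so(2m, ℂ)` by bosons and fermions -/

/-- Elements of an algebra that satisfy the canonical commutation relations (`q`, `p`) and the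
Clifford relations (`γ`). -/
structure Oscillators (m : ℕ) (Λ A : Type*) [DecidableEq Λ] [Ring A] [Algebra ℂ A] where
  q : Fin (2 * m) → Λ → A
  p : Fin (2 * m) → Λ → A
  γ : Fin (2 * m) → A
  q_mul_q : ∀ a b l l', q a l * q b l' = q b l' * q a l
  p_mul_p : ∀ a b l l', p a l * p b l' = p b l' * p a l
  p_mul_q : ∀ a b l l', p a l * q b l' = q b l' * p a l + if a = b ∧ l = l' then 1 else 0
  γ_mul_q : ∀ a b l, γ a * q b l = q b l * γ a
  γ_mul_p : ∀ a b l, γ a * p b l = p b l * γ a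
  γ_mul_γ : ∀ a b, γ a * γ b = - (γ b * γ a) + if b = a.rev then 1 else 0

namespace Oscillators

variable {m : ℕ} {Λ A : Type*} [DecidableEq Λ] [Fintype Λ] [Ring A] [Algebra ℂ A]
  (O : Oscillators m Λ A)

/-- The quadratic elements of the oscillator algebra. -/
def T (a b : Fin (2 * m)) : A := ∑ l, O.q a l * O.p b l + (1 / 2 : ℂ) • (O.γ a * O.γ b.rev)

/-- The image of a matrix in the oscillator algebra. -/
def rho (X : so m) : A := ∑ a, ∑ b, X.1 a b • O.T a b

theorem T_lie_q (a b c : Fin (2 * m)) (l : Λ) :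
    O.T a b * O.q c l - O.q c l * O.T a b = if b = c then O.q a l else 0 := by
  have h1 : ∀ l', O.q a l' * O.p b l' * O.q c l - O.q c l * (O.q a l' * O.p b l') =
      if b = c ∧ l' = l then O.q a l' else 0 := by
    intro l'
    rw [mul_assoc, O.p_mul_q, ← mul_assoc (O.q c l), O.q_mul_q c a, mul_add, mul_assoc,
      add_sub_cancel_left]
    split_ifs <;> simp
  have h2 : O.γ a * O.γ b.rev * O.q c l - O.q c l * (O.γ a * O.γ b.rev) = 0 := by
    rw [mul_assoc, O.γ_mul_q, ← mul_assoc, O.γ_mul_q, mul_assoc, sub_self]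
  calc O.T a b * O.q c l - O.q c l * O.T a b
      = ∑ l', (O.q a l' * O.p b l' * O.q c l - O.q c l * (O.q a l' * O.p b l')) +
        (1 / 2 : ℂ) • (O.γ a * O.γ b.rev * O.q c l - O.q c l * (O.γ a * O.γ b.rev)) := by
        simp only [T, add_mul, mul_add, Finset.sum_mul, Finset.mul_sum, smul_mul_assoc,
          mul_smul_comm, Finset.sum_sub_distrib, smul_sub]
        abel
    _ = _ := by
        rw [h2, smul_zero, add_zero, Finset.sum_congr rfl fun l' _ => h1 l']
        by_cases hb : b = c <;> simp [hb]

theorem T_lie_p (a b c : Fin (2 * m)) (l : Λ) :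
    O.T a b * O.p c l - O.p c l * O.T a b = - if a = c then O.p b l else 0 := by
  have h1 : ∀ l', O.q a l' * O.p b l' * O.p c l - O.p c l * (O.q a l' * O.p b l') =
      - if a = c ∧ l' = l then O.p b l' else 0 := by
    intro l'
    rw [mul_assoc, O.p_mul_p b c, ← mul_assoc (O.p c l), O.p_mul_q c a, add_mul, mul_assoc,
      sub_add_cancel_left]
    congr 1
    by_cases h : c = a ∧ l = l'
    · rw [if_pos h, if_pos ⟨h.1.symm, h.2.symm⟩, one_mul]
    · rw [if_neg h, if_neg fun h' => h ⟨h'.1.symm, h'.2.symm⟩, zero_mul]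
  have h2 : O.γ a * O.γ b.rev * O.p c l - O.p c l * (O.γ a * O.γ b.rev) = 0 := by
    rw [mul_assoc, O.γ_mul_p, ← mul_assoc, O.γ_mul_p, mul_assoc, sub_self]
  calc O.T a b * O.p c l - O.p c l * O.T a b
      = ∑ l', (O.q a l' * O.p b l' * O.p c l - O.p c l * (O.q a l' * O.p b l')) +
        (1 / 2 : ℂ) • (O.γ a * O.γ b.rev * O.p c l - O.p c l * (O.γ a * O.γ b.rev)) := by
        simp only [T, add_mul, mul_add, Finset.sum_mul, Finset.mul_sum, smul_mul_assoc,
          mul_smul_comm, Finset.sum_sub_distrib, smul_sub]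
        abel
    _ = _ := by
        rw [h2, smul_zero, add_zero, Finset.sum_congr rfl fun l' _ => h1 l']
        by_cases hb : a = c <;> simp [hb]

theorem T_lie_γ (a b c : Fin (2 * m)) :
    O.T a b * O.γ c - O.γ c * O.T a b =
      (1 / 2 : ℂ) • ((if b = c then O.γ a else 0) - if a = c.rev then O.γ b.rev else 0) := by
  have h1 : ∀ l', O.q a l' * O.p b l' * O.γ c - O.γ c * (O.q a l' * O.p b l') = 0 := by
    intro l'
    rw [mul_assoc, ← O.γ_mul_p, ← mul_assoc (O.γ c), O.γ_mul_q, mul_assoc, sub_self]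
  have h2 : O.γ a * O.γ b.rev * O.γ c - O.γ c * (O.γ a * O.γ b.rev) =
      (if b = c then O.γ a else 0) - if a = c.rev then O.γ b.rev else 0 := by
    rw [mul_assoc, O.γ_mul_γ b.rev c, ← mul_assoc (O.γ c), O.γ_mul_γ c a, Fin.rev_rev]
    simp only [eq_comm (a := c) (b := b)]
    split_ifs <;> noncomm_ring
  calc O.T a b * O.γ c - O.γ c * O.T a b
      = ∑ l', (O.q a l' * O.p b l' * O.γ c - O.γ c * (O.q a l' * O.p b l')) +
        (1 / 2 : ℂ) • (O.γ a * O.γ b.rev * O.γ c - O.γ c * (O.γ a * O.γ b.rev)) := by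
        simp only [T, add_mul, mul_add, Finset.sum_mul, Finset.mul_sum, smul_mul_assoc,
          mul_smul_comm, Finset.sum_sub_distrib, smul_sub]
        abel
    _ = _ := by
        rw [h2, Finset.sum_congr rfl fun l' _ => h1 l', Finset.sum_const_zero, zero_add]

theorem rho_lie (X : so m) (y : A) :
    O.rho X * y - y * O.rho X = ∑ a, ∑ b, X.1 a b • (O.T a b * y - y * O.T a b) := by
  simp only [rho, Finset.sum_mul, Finset.mul_sum, smul_mul_assoc, mul_smul_comm,
    Finset.sum_sub_distrib, smul_sub]

theorem rho_lie_q (X : so m) (c : Fin (2 * m)) (l : Λ) :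
    O.rho X * O.q c l - O.q c l * O.rho X = ∑ a, X.1 a c • O.q a l := by
  rw [rho_lie]
  refine Finset.sum_congr rfl fun a _ => ?_
  simp [T_lie_q]

theorem rho_lie_p (X : so m) (c : Fin (2 * m)) (l : Λ) :
    O.rho X * O.p c l - O.p c l * O.rho X = - ∑ b, X.1 c b • O.p b l := by
  rw [rho_lie, Finset.sum_comm, ← Finset.sum_neg_distrib]
  refine Finset.sum_congr rfl fun a _ => ?_
  simp [T_lie_p]

/-- The two terms of `T_lie_γ` each carry a factor `1/2`. After reindexing by `a ↦ a'` the
antisymmetry of `X` makes them equal, so `γ` transforms as a vector with coefficient `1`. -/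
theorem rho_lie_γ (X : so m) (c : Fin (2 * m)) :
    O.rho X * O.γ c - O.γ c * O.rho X = ∑ a, X.1 a c • O.γ a := by
  have h1 : ∑ a, ∑ b, X.1 a b • (1 / 2 : ℂ) • (if b = c then O.γ a else 0) =
      (1 / 2 : ℂ) • ∑ a, X.1 a c • O.γ a := by
    rw [Finset.smul_sum]
    refine Finset.sum_congr rfl fun a _ => ?_
    rw [Finset.sum_eq_single c]
    · rw [if_pos rfl, smul_comm]
    · intro b _ hb
      rw [if_neg hb, smul_zero, smul_zero]
    · simp
  have h2 : ∑ a, ∑ b, X.1 a b • (1 / 2 : ℂ) • (if a = c.rev then O.γ b.rev else 0) =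
      - ((1 / 2 : ℂ) • ∑ a, X.1 a c • O.γ a) := by
    rw [Finset.sum_comm, Finset.smul_sum, ← Finset.sum_neg_distrib,
      ← Equiv.sum_comp Fin.revPerm]
    refine Finset.sum_congr rfl fun a _ => ?_
    rw [Finset.sum_eq_single c.rev]
    · rw [if_pos rfl, smul_comm, Fin.revPerm_apply, Fin.rev_rev, so_apply_rev, neg_smul, smul_neg]
    · intro b _ hb
      rw [if_neg hb, smul_zero, smul_zero]
    · simp
  rw [rho_lie]
  simp only [T_lie_γ, smul_sub, Finset.sum_sub_distrib]
  rw [h1, h2, sub_neg_eq_add, ← add_smul]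
  norm_num

theorem rho_lie_mul (X : so m) (y z : A) : O.rho X * (y * z) - y * z * O.rho X =
    (O.rho X * y - y * O.rho X) * z + y * (O.rho X * z - z * O.rho X) := by
  noncomm_ring

/-- `q_c` and `γ_c` transform as vectors, `p_d` and `γ_{d'}` as covectors; hence `T_{cd}` transforms
as a matrix unit, which makes `rho` a Lie homomorphism. -/
theorem rho_lie_T (X : so m) (c d : Fin (2 * m)) :
    O.rho X * O.T c d - O.T c d * O.rho X =
      ∑ a, X.1 a c • O.T a d - ∑ b, X.1 d b • O.T c b := by
  have h1 : ∀ l, O.rho X * (O.q c l * O.p d l) - O.q c l * O.p d l * O.rho X =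
      ∑ a, X.1 a c • (O.q a l * O.p d l) - ∑ b, X.1 d b • (O.q c l * O.p b l) := by
    intro l
    rw [rho_lie_mul, rho_lie_q, rho_lie_p]
    simp only [Finset.sum_mul, Finset.mul_sum, mul_neg, smul_mul_assoc, mul_smul_comm,
      sub_eq_add_neg]
  have h2 : O.rho X * (O.γ c * O.γ d.rev) - O.γ c * O.γ d.rev * O.rho X =
      ∑ a, X.1 a c • (O.γ a * O.γ d.rev) - ∑ b, X.1 d b • (O.γ c * O.γ b.rev) := by
    rw [rho_lie_mul, rho_lie_γ, rho_lie_γ, ← Equiv.sum_comp Fin.revPerm (fun a => X.1 a d.rev • _)]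
    simp only [Fin.revPerm_apply, so_apply_rev, Finset.sum_mul, Finset.mul_sum, mul_neg,
      smul_mul_assoc, mul_smul_comm, neg_smul, Finset.sum_neg_distrib, sub_eq_add_neg]
  calc O.rho X * O.T c d - O.T c d * O.rho X
      = ∑ l, (O.rho X * (O.q c l * O.p d l) - O.q c l * O.p d l * O.rho X) +
        (1 / 2 : ℂ) • (O.rho X * (O.γ c * O.γ d.rev) - O.γ c * O.γ d.rev * O.rho X) := by
        simp only [T, add_mul, mul_add, Finset.sum_mul, Finset.mul_sum, smul_mul_assoc,
          mul_smul_comm, Finset.sum_sub_distrib, smul_sub]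
        abel
    _ = _ := by
        rw [h2, Finset.sum_congr rfl fun l _ => h1 l]
        simp only [T, smul_add, Finset.sum_add_distrib, Finset.smul_sum, Finset.sum_sub_distrib,
          smul_sub]
        rw [Finset.sum_comm, Finset.sum_comm (f := fun l b => X.1 d b • (O.q c l * O.p b l))]
        simp only [smul_comm (1 / 2 : ℂ)]
        abel

theorem rho_map_lie (X Y : so m) :
    O.rho ⁅X, Y⁆ = O.rho X * O.rho Y - O.rho Y * O.rho X := by
  have h1 : O.rho X * O.rho Y - O.rho Y * O.rho X =
      ∑ c, ∑ d, Y.1 c d • (O.rho X * O.T c d - O.T c d * O.rho X) := by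
    conv_lhs => rw [show O.rho Y = ∑ c, ∑ d, Y.1 c d • O.T c d from rfl]
    simp only [Finset.sum_mul, Finset.mul_sum, smul_mul_assoc, mul_smul_comm,
      Finset.sum_sub_distrib, smul_sub]
  rw [h1]
  simp only [rho_lie_T, smul_sub, Finset.smul_sum, Finset.sum_sub_distrib, smul_smul]
  rw [rho]
  simp only [LieSubalgebra.coe_bracket, Ring.lie_def, Matrix.sub_apply, Matrix.mul_apply,
    sub_smul, Finset.sum_smul, Finset.sum_sub_distrib]
  congr 1
  · rw [Finset.sum_comm, Finset.sum_comm (f := fun c d => ∑ a, (Y.1 c d * X.1 a c) • O.T a d)]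
    refine Finset.sum_congr rfl fun d _ => ?_
    rw [Finset.sum_comm]
    simp only [mul_comm]
  · refine Finset.sum_congr rfl fun c _ => ?_
    rw [Finset.sum_comm]

/-- The representation of `so(2m, ℂ)` defined by the oscillators. -/
def rep : so m →ₗ⁅ℂ⁆ A where
  toFun := O.rho
  map_add' X Y := by
    simp only [rho, ← Finset.sum_add_distrib, ← add_smul]
    rfl
  map_smul' c X := by
    simp only [rho, Finset.smul_sum, smul_smul]
    rfl
  map_lie' {X Y} := by rw [rho_map_lie, LieRing.of_associative_ring_bracket]

theorem rep_apply (X : so m) : O.rep X = O.rho X := rfl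

/-- The Dirac operators. -/
def dirac (l : Λ) : A := ∑ a, O.q a l * O.γ a.rev

/-- The Dirac operator contracts the vector `q` with the covector `γ_{a'}`, so it is invariant. -/
theorem rho_mul_dirac (X : so m) (l : Λ) : O.rho X * O.dirac l = O.dirac l * O.rho X := by
  rw [← sub_eq_zero]
  calc O.rho X * O.dirac l - O.dirac l * O.rho X
      = ∑ c, (O.rho X * (O.q c l * O.γ c.rev) - O.q c l * O.γ c.rev * O.rho X) := by
        simp only [dirac, Finset.sum_mul, Finset.mul_sum, Finset.sum_sub_distrib]
    _ = ∑ c, ∑ a, (X.1 a c • (O.q a l * O.γ c.rev) - X.1 c a • (O.q c l * O.γ a.rev)) := by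
        refine Finset.sum_congr rfl fun c _ => ?_
        rw [rho_lie_mul, rho_lie_q, rho_lie_γ,
          ← Equiv.sum_comp Fin.revPerm (fun a => X.1 a c.rev • _)]
        simp only [Fin.revPerm_apply, so_apply_rev, Finset.sum_mul, Finset.mul_sum,
          smul_mul_assoc, mul_smul_comm, neg_smul, mul_neg, Finset.sum_neg_distrib,
          ← sub_eq_add_neg, Finset.sum_sub_distrib]
    _ = 0 := by
        simp only [Finset.sum_sub_distrib]
        rw [Finset.sum_comm, sub_self]

theorem rho_G (a b : Fin (2 * m)) : O.rho (G a b) = O.T a b - O.T b.rev a.rev := by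
  simp only [rho, G_apply, sub_smul, Finset.sum_sub_distrib]
  congr 1
  · rw [Finset.sum_eq_single a, Finset.sum_eq_single b] <;> simp +contextual
  · rw [Finset.sum_eq_single b.rev, Finset.sum_eq_single a.rev] <;> simp +contextual

end Oscillators

/-! ### Fermions on the Fock space -/

section Fock

variable {m : ℕ}

/-- Change of the `i`-th occupation number. -/
def tog (i : Fin m) (I : Fin m → Bool) : Fin m → Bool := Function.update I i (!I i)

theorem tog_self (i : Fin m) (I : Fin m → Bool) : tog i I i = !I i := by simp [tog]

theorem tog_of_ne {i j : Fin m} (h : i ≠ j) (I : Fin m → Bool) : tog j I i = I i := by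
  simp [tog, h]

theorem tog_tog (i : Fin m) (I : Fin m → Bool) : tog i (tog i I) = I := by simp [tog]

theorem tog_comm (i j : Fin m) (I : Fin m → Bool) : tog i (tog j I) = tog j (tog i I) := by
  rcases eq_or_ne i j with rfl | h
  · rfl
  · simp only [tog, Function.update_of_ne h, Function.update_of_ne h.symm]
    rw [Function.update_comm h]

/-- The sign `(-1)^{#{j < i, j ∈ I}}`. -/
def sgn (i : Fin m) (I : Fin m → Bool) : ℂ := ∏ j, if j < i ∧ I j = true then -1 else 1

theorem sgn_mul_self (i : Fin m) (I : Fin m → Bool) : sgn i I * sgn i I = 1 := by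
  rw [sgn, ← Finset.prod_mul_distrib]
  refine Finset.prod_eq_one fun j _ => ?_
  split_ifs <;> norm_num

theorem sgn_tog (i j : Fin m) (I : Fin m → Bool) :
    sgn i (tog j I) = (if j < i then -1 else 1) * sgn i I := by
  have h : (if j < i then -1 else 1 : ℂ) = ∏ l, if l = j then (if j < i then -1 else 1) else 1 := by
    simp
  rw [sgn, sgn, h, ← Finset.prod_mul_distrib]
  refine Finset.prod_congr rfl fun l _ => ?_
  rcases eq_or_ne l j with rfl | hl
  · rw [tog_self]
    by_cases h1 : l < i <;> cases h2 : I l <;> simp [h1]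
  · simp [tog_of_ne hl, hl]

variable (R : Type*) [AddCommGroup R] [Module ℂ R]

/-- The creation (`x = true`) and annihilation (`x = false`) operators. -/
def fer (i : Fin m) (x : Bool) : Module.End ℂ ((Fin m → Bool) → R) where
  toFun ψ I := if I i = x then sgn i I • ψ (tog i I) else 0
  map_add' ψ χ := by
    ext I
    simp only [Pi.add_apply]
    split_ifs <;> simp
  map_smul' c ψ := by
    ext I
    simp only [Pi.smul_apply, RingHom.id_apply]
    split_ifs
    · rw [smul_comm]
    · simp

variable {R}

theorem fer_apply (i : Fin m) (x : Bool) (ψ : (Fin m → Bool) → R) (I : Fin m → Bool) :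
    fer R i x ψ I = if I i = x then sgn i I • ψ (tog i I) else 0 := rfl

theorem fer_mul_self (i : Fin m) (x : Bool) : fer R i x * fer R i x = 0 := by
  refine LinearMap.ext fun ψ => funext fun I => ?_
  rw [Module.End.mul_apply, fer_apply, fer_apply, tog_self]
  cases x <;> cases h : I i <;> simp

theorem fer_mul_not (i : Fin m) (x : Bool) :
    fer R i x * fer R i (!x) + fer R i (!x) * fer R i x = 1 := by
  refine LinearMap.ext fun ψ => funext fun I => ?_
  rw [LinearMap.add_apply, Module.End.mul_apply, Module.End.mul_apply, Pi.add_apply,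
    fer_apply, fer_apply, fer_apply, fer_apply, tog_self, tog_tog, sgn_tog, if_neg (lt_irrefl i),
    one_mul, Module.End.one_apply]
  cases x <;> cases h : I i <;> simp [smul_smul, sgn_mul_self]

/-- Toggling place `j` changes the sign `sgn i` only if `j < i`, and exactly one of `j < i`, `i < j`
holds. -/
theorem fer_anticomm {i j : Fin m} (h : i ≠ j) (x y : Bool) :
    fer R i x * fer R j y = - (fer R j y * fer R i x) := by
  refine LinearMap.ext fun ψ => funext fun I => ?_
  rw [LinearMap.neg_apply, Module.End.mul_apply, Module.End.mul_apply, Pi.neg_apply,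
    fer_apply, fer_apply, fer_apply, fer_apply, tog_of_ne h, tog_of_ne h.symm, sgn_tog, sgn_tog,
    tog_comm]
  by_cases h1 : I i = x <;> by_cases h2 : I j = y <;> simp only [h1, h2, if_true, if_false,
    smul_zero, neg_zero, smul_smul]
  rw [← neg_smul]
  congr 1
  rcases lt_or_gt_of_ne h with h | h
  · rw [if_pos h, if_neg h.asymm]; ring
  · rw [if_neg h.asymm, if_pos h]; ring

/-- The index of the pair `{a, a'}`. -/
def pairIdx (a : Fin (2 * m)) : Fin m :=
  ⟨if (a : ℕ) < m then a else 2 * m - 1 - a, by have := a.isLt; split_ifs <;> omega⟩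

theorem pairIdx_rev (a : Fin (2 * m)) : pairIdx a.rev = pairIdx a := by
  have := a.isLt
  simp only [pairIdx, Fin.ext_iff, Fin.val_rev]
  split_ifs <;> omega

theorem eq_of_pairIdx_eq {a b : Fin (2 * m)} (h : pairIdx a = pairIdx b)
    (h' : ((a : ℕ) < m ↔ (b : ℕ) < m)) : a = b := by
  have := a.isLt
  have := b.isLt
  simp only [pairIdx, Fin.ext_iff] at *
  split_ifs at h <;> omega

variable (R) in
/-- The generators of the Clifford algebra as operators on the Fock space. -/
def cliff (a : Fin (2 * m)) : Module.End ℂ ((Fin m → Bool) → R) :=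
  fer R (pairIdx a) (decide (m ≤ (a : ℕ)))

theorem cliff_mul (a b : Fin (2 * m)) :
    cliff R a * cliff R b = - (cliff R b * cliff R a) + if b = a.rev then 1 else 0 := by
  have ha := a.isLt
  have hb := b.isLt
  by_cases h : pairIdx a = pairIdx b
  · by_cases h' : ((a : ℕ) < m ↔ (b : ℕ) < m)
    · obtain rfl := eq_of_pairIdx_eq h h'
      rw [if_neg, cliff, fer_mul_self, neg_zero, add_zero]
      intro h
      rw [Fin.ext_iff, Fin.val_rev] at h
      omega
    · have hab : b = a.rev := eq_of_pairIdx_eq (by rw [pairIdx_rev, h]) (by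
        rw [Fin.val_rev]; omega)
      have hd : decide (m ≤ (b : ℕ)) = !decide (m ≤ (a : ℕ)) := by
        rw [← decide_not]
        exact decide_eq_decide.2 (by omega)
      rw [if_pos hab, cliff, cliff, ← h, hd, ← fer_mul_not (R := R) (pairIdx a)
        (decide (m ≤ (a : ℕ)))]
      abel
  · rw [if_neg, cliff, cliff, fer_anticomm h, add_zero]
    rintro rfl
    exact h (pairIdx_rev a).symm

theorem cliff_compLeft {R' : Type*} [AddCommGroup R'] [Module ℂ R'] (g : R →ₗ[ℂ] R')
    (a : Fin (2 * m)) (ψ : (Fin m → Bool) → R) :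
    cliff R' a (g.compLeft (Fin m → Bool) ψ) = g.compLeft (Fin m → Bool) (cliff R a ψ) := by
  ext I
  simp only [cliff, fer_apply, LinearMap.compLeft_apply, Function.comp_apply]
  split_ifs <;> simp

end Fock

/-! ### Bosons on the polynomial ring -/

section Bosons

variable {σ : Type*} [DecidableEq σ]

theorem pderiv_comm (i j : σ) (f : MvPolynomial σ ℂ) :
    MvPolynomial.pderiv i (MvPolynomial.pderiv j f) =
      MvPolynomial.pderiv j (MvPolynomial.pderiv i f) := by
  have : ⁅MvPolynomial.pderiv (R := ℂ) i, MvPolynomial.pderiv (R := ℂ) j⁆ = 0 := by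
    apply MvPolynomial.derivation_ext
    intro l
    rw [Derivation.commutator_apply]
    simp only [MvPolynomial.pderiv_X, Derivation.zero_apply]
    simp only [Pi.single_apply]
    split_ifs <;> simp
  have h := DFunLike.congr_fun this f
  rw [Derivation.commutator_apply] at h
  exact sub_eq_zero.1 h

variable {m n : ℕ} (k : ℕ)

/-- The operators `q` on polynomials: derivations for the first `k` indices, multiplications for the
others. -/
def bosQ (a : Fin (2 * m)) (l : Fin n) :
    Module.End ℂ (MvPolynomial (Fin (2 * m) × Fin n) ℂ) :=
  if (a : ℕ) < k then - (MvPolynomial.pderiv (a, l)).toLinearMap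
  else LinearMap.mulLeft ℂ (MvPolynomial.X (a, l))

/-- The operators `p` on polynomials: multiplications for the first `k` indices, derivations for the
others. -/
def bosP (a : Fin (2 * m)) (l : Fin n) :
    Module.End ℂ (MvPolynomial (Fin (2 * m) × Fin n) ℂ) :=
  if (a : ℕ) < k then LinearMap.mulLeft ℂ (MvPolynomial.X (a, l))
  else (MvPolynomial.pderiv (a, l)).toLinearMap

theorem bosQ_comm (a b : Fin (2 * m)) (l l' : Fin n) :
    bosQ k a l * bosQ k b l' = bosQ k b l' * bosQ k a l := by
  refine LinearMap.ext fun f => ?_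
  unfold bosQ
  by_cases ha : (a : ℕ) < k <;> by_cases hb : (b : ℕ) < k <;>
    simp only [ha, hb, if_true, if_false, Module.End.mul_apply, LinearMap.neg_apply, map_neg,
      Derivation.coeFn_coe, LinearMap.mulLeft_apply, neg_neg, Derivation.leibniz,
      smul_eq_mul]
  · exact pderiv_comm _ _ _
  · rw [MvPolynomial.pderiv_X_of_ne, mul_zero, add_zero]
    intro h
    exact hb ((Prod.mk.inj h).1 ▸ ha)
  · rw [MvPolynomial.pderiv_X_of_ne, mul_zero, add_zero]
    intro h
    exact ha ((Prod.mk.inj h).1 ▸ hb)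
  · ring

theorem bosP_comm (a b : Fin (2 * m)) (l l' : Fin n) :
    bosP k a l * bosP k b l' = bosP k b l' * bosP k a l := by
  refine LinearMap.ext fun f => ?_
  unfold bosP
  by_cases ha : (a : ℕ) < k <;> by_cases hb : (b : ℕ) < k <;>
    simp only [ha, hb, if_true, if_false, Module.End.mul_apply,
      Derivation.coeFn_coe, LinearMap.mulLeft_apply, Derivation.leibniz, smul_eq_mul]
  · ring
  · rw [MvPolynomial.pderiv_X_of_ne, mul_zero, add_zero]
    intro h
    exact hb ((Prod.mk.inj h).1 ▸ ha)
  · rw [MvPolynomial.pderiv_X_of_ne, mul_zero, add_zero]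
    intro h
    exact ha ((Prod.mk.inj h).1 ▸ hb)
  · exact pderiv_comm _ _ _

/-- The minus sign in `bosQ` for the first `k` indices is forced here: `[X, -∂] = 1 = [∂, X]`. -/
theorem bosP_mul_bosQ (a b : Fin (2 * m)) (l l' : Fin n) :
    bosP k a l * bosQ k b l' = bosQ k b l' * bosP k a l + if a = b ∧ l = l' then 1 else 0 := by
  refine LinearMap.ext fun f => ?_
  have hX : MvPolynomial.pderiv (R := ℂ) (a, l) (MvPolynomial.X (b, l')) =
      if a = b ∧ l = l' then 1 else 0 := by
    rw [MvPolynomial.pderiv_X, Pi.single_apply]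
    exact if_congr (by rw [Prod.mk.injEq]; tauto) rfl rfl
  have hX' : MvPolynomial.pderiv (R := ℂ) (b, l') (MvPolynomial.X (a, l)) =
      if a = b ∧ l = l' then 1 else 0 := by
    rw [MvPolynomial.pderiv_X, Pi.single_apply]
    exact if_congr (by rw [Prod.mk.injEq]) rfl rfl
  unfold bosP bosQ
  by_cases ha : (a : ℕ) < k <;> by_cases hb : (b : ℕ) < k <;>
    simp only [ha, hb, if_true, if_false, Module.End.mul_apply, LinearMap.neg_apply, map_neg,
      Derivation.coeFn_coe, LinearMap.mulLeft_apply, Derivation.leibniz, LinearMap.add_apply,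
      smul_eq_mul, hX, hX']
  · split_ifs <;> simp
  · have hab : ¬ (a = b ∧ l = l') := fun h => hb (h.1 ▸ ha)
    simp only [hab, if_false, LinearMap.zero_apply]
    ring
  · have hab : ¬ (a = b ∧ l = l') := fun h => ha (h.1 ▸ hb)
    simp only [hab, if_false, LinearMap.zero_apply, add_zero]
    exact congrArg Neg.neg (pderiv_comm _ _ _)
  · split_ifs <;> simp

end Bosons

/-! ### The oscillator representation -/

/-- The space of the oscillator representation. -/
abbrev Osc (n k : ℕ) : Type :=
  (Fin (n + k) → Bool) → MvPolynomial (Fin (2 * (n + k)) × Fin n) ℂ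

/-- The space of spinors. -/
abbrev Spinor (m : ℕ) : Type := (Fin m → Bool) → ℂ

/-- Bosons and fermions on the oscillator space. -/
def osc (n k : ℕ) : Oscillators (n + k) (Fin n) (Module.End ℂ (Osc n k)) where
  q a l := (bosQ k a l).compLeft _
  p a l := (bosP k a l).compLeft _
  γ a := cliff _ a
  q_mul_q a b l l' := by
    refine LinearMap.ext fun ψ => funext fun I => ?_
    exact LinearMap.congr_fun (bosQ_comm k a b l l') (ψ I)
  p_mul_p a b l l' := by
    refine LinearMap.ext fun ψ => funext fun I => ?_
    exact LinearMap.congr_fun (bosP_comm k a b l l') (ψ I)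
  p_mul_q a b l l' := by
    refine LinearMap.ext fun ψ => funext fun I => ?_
    have := LinearMap.congr_fun (bosP_mul_bosQ k a b l l') (ψ I)
    split_ifs at this ⊢ <;> exact this
  γ_mul_q a b l := LinearMap.ext fun ψ => cliff_compLeft _ _ _
  γ_mul_p a b l := LinearMap.ext fun ψ => cliff_compLeft _ _ _
  γ_mul_γ a b := cliff_mul a b

/-- The vector `x ⊗ s` of the oscillator space. -/
def emb (n k : ℕ) (x : MvPolynomial (Fin (2 * (n + k)) × Fin n) ℂ) :
    Spinor (n + k) →ₗ[ℂ] Osc n k :=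
  (LinearMap.toSpanSingleton ℂ _ x).compLeft _

theorem emb_apply {n k : ℕ} (x : MvPolynomial (Fin (2 * (n + k)) × Fin n) ℂ)
    (s : Spinor (n + k)) (I : Fin (n + k) → Bool) : emb n k x s I = s I • x := rfl

theorem osc_γ_emb {n k : ℕ} (a : Fin (2 * (n + k)))
    (x : MvPolynomial (Fin (2 * (n + k)) × Fin n) ℂ) (s : Spinor (n + k)) :
    (osc n k).γ a (emb n k x s) = emb n k x (cliff ℂ a s) := cliff_compLeft _ _ _

theorem osc_q_emb {n k : ℕ} (a : Fin (2 * (n + k))) (l : Fin n)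
    (x : MvPolynomial (Fin (2 * (n + k)) × Fin n) ℂ) (s : Spinor (n + k)) :
    (osc n k).q a l (emb n k x s) = emb n k (bosQ k a l x) s :=
  funext fun I => map_smul (bosQ k a l) (s I) x

theorem osc_p_emb {n k : ℕ} (a : Fin (2 * (n + k))) (l : Fin n)
    (x : MvPolynomial (Fin (2 * (n + k)) × Fin n) ℂ) (s : Spinor (n + k)) :
    (osc n k).p a l (emb n k x s) = emb n k (bosP k a l x) s :=
  funext fun I => map_smul (bosP k a l) (s I) x

/-! ### Spinors -/

section Spinors

variable {m : ℕ}

/-- The middle index `m` (for `false`) or `m - 1` (for `true`). -/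
def pI (hm : 1 ≤ m) (ε : Bool) : Fin (2 * m) := ⟨if ε then m - 1 else m, by split_ifs <;> omega⟩

theorem pI_rev (hm : 1 ≤ m) (ε : Bool) : (pI hm ε).rev = pI hm (!ε) := by
  rw [Fin.ext_iff, Fin.val_rev]
  cases ε <;> simp [pI] <;> omega

/-- The occupation numbers of a highest weight vector. -/
def vacI (m : ℕ) (ε : Bool) : Fin m → Bool := fun i => ε && decide ((i : ℕ) + 1 = m)

/-- The highest weight vectors of the two half spin representations. -/
def vac (m : ℕ) (ε : Bool) : Spinor m := Pi.single (vacI m ε) 1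

/-- `cliff a` flips the occupation number of the pair `{a, a'}` to the value `decide (m ≤ a)`, hence
kills a basis vector that already has this value. -/
theorem cliff_vac_eq_zero {a : Fin (2 * m)} {ε : Bool}
    (h : vacI m ε (pairIdx a) = decide (m ≤ (a : ℕ))) : cliff ℂ a (vac m ε) = 0 := by
  funext I
  rw [cliff, fer_apply, Pi.zero_apply]
  split_ifs with h1
  · rw [vac, Pi.single_eq_of_ne, smul_zero]
    intro h2
    rw [← h2, tog_self, h1] at h
    exact absurd h (by simp)
  · rfl

theorem vacI_pairIdx_of_lt {a : Fin (2 * m)} (h : (a : ℕ) + 1 < m) (ε : Bool) :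
    vacI m ε (pairIdx a) = decide (m ≤ (a : ℕ)) := by
  have h1 : decide (m ≤ (a : ℕ)) = false := decide_eq_false (by omega)
  have h2 : ((pairIdx a : Fin m) : ℕ) = a := if_pos (by omega)
  have h3 : decide (((pairIdx a : Fin m) : ℕ) + 1 = m) = false := decide_eq_false (by omega)
  rw [vacI, h1, h3, Bool.and_false]

theorem pairIdx_pI (hm : 1 ≤ m) (ε : Bool) : ((pairIdx (pI hm ε) : Fin m) : ℕ) + 1 = m := by
  have h : (pI hm ε : ℕ) = m - 1 ∨ (pI hm ε : ℕ) = m := by cases ε <;> simp [pI]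
  simp only [pairIdx]
  split_ifs <;> omega

theorem decide_le_pI (hm : 1 ≤ m) (ε : Bool) : decide (m ≤ (pI hm ε : ℕ)) = !ε := by
  cases ε <;> simp [pI]; omega

theorem vacI_pI (hm : 1 ≤ m) (ε δ : Bool) : vacI m ε (pairIdx (pI hm δ)) = ε := by
  rw [vacI, decide_eq_true (pairIdx_pI hm δ), Bool.and_true]

theorem cliff_vac_of_lt {a : Fin (2 * m)} (h : (a : ℕ) + 1 < m) (ε : Bool) :
    cliff ℂ a (vac m ε) = 0 := cliff_vac_eq_zero (vacI_pairIdx_of_lt h ε)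

theorem cliff_pI_not_vac (hm : 1 ≤ m) (ε : Bool) : cliff ℂ (pI hm (!ε)) (vac m ε) = 0 :=
  cliff_vac_eq_zero (by rw [vacI_pI, decide_le_pI, Bool.not_not])

theorem tog_vacI (hm : 1 ≤ m) (ε δ : Bool) : tog (pairIdx (pI hm δ)) (vacI m ε) = vacI m (!ε) := by
  funext j
  rcases eq_or_ne j (pairIdx (pI hm δ)) with rfl | h
  · rw [tog_self, vacI_pI, vacI_pI]
  · have : ¬ (j : ℕ) + 1 = m := fun h' => h (Fin.ext (by have := pairIdx_pI hm δ; omega))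
    rw [tog_of_ne h, vacI, vacI, decide_eq_false this, Bool.and_false, Bool.and_false]

theorem cliff_pI_vac (hm : 1 ≤ m) (ε : Bool) : cliff ℂ (pI hm ε) (vac m ε) = vac m (!ε) := by
  funext I
  rw [cliff, fer_apply, decide_le_pI]
  by_cases h : I = vacI m (!ε)
  · have hs : sgn (pairIdx (pI hm ε)) (vacI m (!ε)) = 1 := by
      refine Finset.prod_eq_one fun j _ => if_neg ?_
      rintro ⟨h1, h2⟩
      have h3 : (j : ℕ) < (pairIdx (pI hm ε) : Fin m) := h1
      have h4 := pairIdx_pI hm ε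
      rw [vacI, decide_eq_false (by omega), Bool.and_false] at h2
      exact absurd h2 (by simp)
    rw [h, if_pos (vacI_pI hm _ _), hs, tog_vacI, Bool.not_not, vac, vac, Pi.single_eq_same,
      Pi.single_eq_same, one_smul]
  · rw [vac, vac, Pi.single_eq_of_ne h]
    split_ifs
    · rw [Pi.single_eq_of_ne, smul_zero]
      intro h'
      exact h (by rw [← tog_tog (pairIdx (pI hm ε)) I, h', tog_vacI])
    · rfl

theorem vac_ne_zero (ε : Bool) : vac m ε ≠ 0 := fun h => by
  have := congrFun h (vacI m ε)
  rw [vac, Pi.single_eq_same] at this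
  exact one_ne_zero this

theorem apply_eq_zero_of_cliff {a : Fin (2 * m)} {s : Spinor m} (h : cliff ℂ a s = 0)
    {I : Fin m → Bool} (hI : I (pairIdx a) ≠ decide (m ≤ (a : ℕ))) : s I = 0 := by
  have h1 := congrFun h (tog (pairIdx a) I)
  rw [cliff, fer_apply, tog_self, tog_tog, Pi.zero_apply, if_pos] at h1
  · rcases smul_eq_zero.1 h1 with h2 | h2
    · have := sgn_mul_self (pairIdx a) (tog (pairIdx a) I)
      rw [h2, zero_mul] at this
      exact absurd this zero_ne_one
    · exact h2
  · exact Bool.not_eq.2 hI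

theorem eq_smul_vac (hm : 1 ≤ m) (ε : Bool) {s : Spinor m}
    (h : ∀ a : Fin (2 * m), (a : ℕ) + 1 < m → cliff ℂ a s = 0)
    (h' : cliff ℂ (pI hm (!ε)) s = 0) : s = s (vacI m ε) • vac m ε := by
  funext I
  rw [Pi.smul_apply]
  by_cases hI : I = vacI m ε
  · rw [hI, vac, Pi.single_eq_same, smul_eq_mul, mul_one]
  · rw [vac, Pi.single_eq_of_ne hI, smul_zero]
    obtain ⟨i, hi⟩ := Function.ne_iff.1 hI
    by_cases hi' : (i : ℕ) + 1 = m
    · have hp : pairIdx (pI hm (!ε)) = i := Fin.ext (by have := pairIdx_pI hm (!ε); omega)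
      refine apply_eq_zero_of_cliff h' ?_
      rw [decide_le_pI, Bool.not_not, hp]
      exact fun h => hi (h.trans (by rw [← hp, vacI_pI]))
    · have hlt := i.isLt
      let a : Fin (2 * m) := ⟨i, by omega⟩
      have hp : pairIdx a = i := Fin.ext (if_pos hlt)
      have ha : (a : ℕ) + 1 < m := by change (i : ℕ) + 1 < m; omega
      refine apply_eq_zero_of_cliff (h a ha) ?_
      rw [← vacI_pairIdx_of_lt ha ε, hp]
      exact hi

/-- The parity operator on spinors. -/
def parity (m : ℕ) : Module.End ℂ (Spinor m) where
  toFun s I := (∏ i, if I i = true then -1 else 1) * s I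
  map_add' s t := by funext I; simp only [Pi.add_apply]; ring
  map_smul' c s := by funext I; simp only [Pi.smul_apply, smul_eq_mul, RingHom.id_apply]; ring

theorem parity_apply (s : Spinor m) (I : Fin m → Bool) :
    parity m s I = (∏ i, if I i = true then -1 else 1) * s I := rfl

theorem prod_sign_tog (j : Fin m) (I : Fin m → Bool) :
    (∏ i, if tog j I i = true then -1 else 1 : ℂ) = - ∏ i, if I i = true then -1 else 1 := by
  have h : (∏ l, if l = j then -1 else 1 : ℂ) = -1 := by simp
  have h' : (∏ i, if tog j I i = true then -1 else 1 : ℂ) =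
      (∏ l, if l = j then -1 else 1) * ∏ i, if I i = true then -1 else 1 := by
    rw [← Finset.prod_mul_distrib]
    refine Finset.prod_congr rfl fun l _ => ?_
    rcases eq_or_ne l j with rfl | hl
    · rw [tog_self]
      cases h2 : I l <;> simp
    · simp [tog_of_ne hl, hl]
  rw [h', h, neg_one_mul]

theorem parity_cliff (a : Fin (2 * m)) (s : Spinor m) :
    parity m (cliff ℂ a s) = - cliff ℂ a (parity m s) := by
  funext I
  rw [parity_apply, Pi.neg_apply, cliff, fer_apply, fer_apply, parity_apply, prod_sign_tog]
  split_ifs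
  · simp only [smul_eq_mul]; ring
  · ring

/-- The sign of a parity. -/
def sg (ε : Bool) : ℂ := if ε then -1 else 1

theorem sg_not (ε : Bool) : sg (!ε) = - sg ε := by cases ε <;> simp [sg]

theorem parity_vac (hm : 1 ≤ m) (ε : Bool) : parity m (vac m ε) = sg ε • vac m ε := by
  have h0 : parity m (vac m false) = vac m false := by
    funext I
    rw [parity_apply]
    by_cases hI : I = vacI m false
    · rw [hI, Finset.prod_eq_one, one_mul]
      intro i _
      rw [if_neg]
      simp [vacI]
    · rw [vac, Pi.single_eq_of_ne hI, mul_zero]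
  cases ε
  · rw [h0, sg, if_neg (by simp), one_smul]
  · rw [show vac m true = vac m (!false) from rfl, ← cliff_pI_vac hm, parity_cliff, h0, sg,
      if_pos rfl, neg_one_smul]

theorem cliff_cliff (a b : Fin (2 * m)) (s : Spinor m) :
    cliff ℂ a (cliff ℂ b s) = - cliff ℂ b (cliff ℂ a s) + if b = a.rev then s else 0 := by
  have := LinearMap.congr_fun (cliff_mul (R := ℂ) a b) s
  rw [Module.End.mul_apply] at this
  rw [this]
  split_ifs <;> rfl

theorem cliff_cliff_of_ne {a b : Fin (2 * m)} (h : b ≠ a.rev) (s : Spinor m) :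
    cliff ℂ a (cliff ℂ b s) = - cliff ℂ b (cliff ℂ a s) := by
  rw [cliff_cliff, if_neg h, add_zero]

/-- The product of the Clifford generators in a list, applied to a spinor. -/
def act (l : List (Fin (2 * m))) (s : Spinor m) : Spinor m := l.foldr (fun a t => cliff ℂ a t) s

theorem parity_act (l : List (Fin (2 * m))) (s : Spinor m) :
    parity m (act l s) = (-1 : ℂ) ^ l.length • act l (parity m s) := by
  induction l with
  | nil => simp [act]
  | cons a l ih =>
    change parity m (cliff ℂ a (act l s)) = (-1 : ℂ) ^ (l.length + 1) • cliff ℂ a (act l _)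
    rw [parity_cliff, ih, map_smul, pow_succ, mul_neg_one, neg_smul]

theorem act_smul (l : List (Fin (2 * m))) (c : ℂ) (s : Spinor m) :
    act l (c • s) = c • act l s := by
  induction l with
  | nil => rfl
  | cons a l ih =>
    change cliff ℂ a (act l (c • s)) = c • cliff ℂ a (act l s)
    rw [ih, map_smul]

end Spinors

/-! ### Half spin modules of the middle block -/

section HalfSpin

variable {n k : ℕ}

/-- The indices of the middle block. -/
def mid (n k : ℕ) : Finset (Fin (2 * (n + k))) :=
  Finset.univ.filter fun a => k ≤ (a : ℕ) ∧ (a : ℕ) < k + 2 * n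

theorem mem_mid {a : Fin (2 * (n + k))} : a ∈ mid n k ↔ k ≤ (a : ℕ) ∧ (a : ℕ) < k + 2 * n := by
  simp [mid]

theorem rev_mem_mid {a : Fin (2 * (n + k))} : a.rev ∈ mid n k ↔ a ∈ mid n k := by
  have := a.isLt
  rw [mem_mid, mem_mid, Fin.val_rev]
  omega

theorem card_mid : (mid n k).card = 2 * n := by
  have h : (mid n k).map Fin.valEmbedding = Finset.Ico k (k + 2 * n) := by
    ext i
    simp only [Finset.mem_map, mem_mid, Fin.valEmbedding_apply, Finset.mem_Ico]
    constructor
    · rintro ⟨a, ha, rfl⟩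
      exact ha
    · intro hi
      exact ⟨⟨i, by omega⟩, hi, rfl⟩
  rw [← Finset.card_map Fin.valEmbedding, h, Nat.card_Ico]
  omega

/-- The spinors for the middle block. -/
def midSpinor (n k : ℕ) : Submodule ℂ (Spinor (n + k)) :=
  ⨅ a : {a : Fin (2 * (n + k)) // (a : ℕ) < k}, LinearMap.ker (cliff ℂ a.1)

theorem mem_midSpinor {s : Spinor (n + k)} :
    s ∈ midSpinor n k ↔ ∀ a : Fin (2 * (n + k)), (a : ℕ) < k → cliff ℂ a s = 0 := by
  simp [midSpinor, Submodule.mem_iInf, Subtype.forall]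

theorem vac_mem_midSpinor (hn : 2 ≤ n) (ε : Bool) : vac (n + k) ε ∈ midSpinor n k :=
  mem_midSpinor.2 fun _ ha => cliff_vac_of_lt (by omega) ε

theorem cliff_mem_midSpinor {a : Fin (2 * (n + k))} (ha : a ∈ mid n k) {s : Spinor (n + k)}
    (hs : s ∈ midSpinor n k) : cliff ℂ a s ∈ midSpinor n k := by
  rw [mem_midSpinor] at *
  rw [mem_mid] at ha
  intro b hb
  rw [cliff_cliff_of_ne, hs b hb, map_zero, neg_zero]
  intro h
  rw [h, Fin.val_rev] at ha
  omega

/-- Annihilators are applied as long as one acts nontrivially. By anticommutation, an annihilator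
that kills `s` kills `γ_a s` too, and `γ_a` joins them since `γ_a² = 0`; so the number of those
acting nontrivially drops at each step, and at zero only the vacuum is left. -/
theorem exists_act_eq (hm : 1 ≤ n + k) (N : ℕ) : ∀ s ∈ midSpinor n k, s ≠ 0 →
    (Finset.univ.filter fun a : Fin (2 * (n + k)) =>
      (a : ℕ) < n + k ∧ cliff ℂ a s ≠ 0).card ≤ N →
    ∃ l : List (Fin (2 * (n + k))), (∀ a ∈ l, a ∈ mid n k) ∧ ∃ c : ℂ, c ≠ 0 ∧
      act l s = c • vac (n + k) false := by
  induction N with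
  | zero =>
    intro s _ hs0 hN
    rw [Nat.le_zero, Finset.card_eq_zero, Finset.filter_eq_empty_iff] at hN
    have h : ∀ a : Fin (2 * (n + k)), (a : ℕ) < n + k → cliff ℂ a s = 0 := fun a ha => by
      by_contra h
      exact hN (Finset.mem_univ a) ⟨ha, h⟩
    have hv := eq_smul_vac hm false (fun a ha => h a (by omega)) (h (pI hm (!false)) (by
      simp [pI]; omega))
    refine ⟨[], by simp, _, ?_, hv⟩
    intro hc
    rw [hc, zero_smul] at hv
    exact hs0 hv
  | succ N ih =>
    intro s hs hs0 hN
    by_cases h : ∃ a : Fin (2 * (n + k)), (a : ℕ) < n + k ∧ cliff ℂ a s ≠ 0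
    · obtain ⟨a, ha, has⟩ := h
      have hak : k ≤ (a : ℕ) := by
        by_contra h
        exact has (mem_midSpinor.1 hs a (by omega))
      have hamid : a ∈ mid n k := mem_mid.2 ⟨hak, by omega⟩
      have hanti : ∀ b : Fin (2 * (n + k)), (b : ℕ) < n + k →
          cliff ℂ b (cliff ℂ a s) = - cliff ℂ a (cliff ℂ b s) := by
        intro b hb
        refine cliff_cliff_of_ne (fun h => ?_) s
        rw [Fin.ext_iff, Fin.val_rev] at h
        omega
      obtain ⟨l, hl, c, hc, hlc⟩ := ih (cliff ℂ a s) (cliff_mem_midSpinor hamid hs) has (by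
        refine Nat.le_of_lt_succ (lt_of_lt_of_le (Finset.card_lt_card ?_) hN)
        refine (Finset.ssubset_iff_of_subset ?_).2 ⟨a, by simp [ha, has], ?_⟩
        · intro b hb
          rw [Finset.mem_filter] at hb ⊢
          refine ⟨hb.1, hb.2.1, fun h => hb.2.2 ?_⟩
          rw [hanti b hb.2.1, h, map_zero, neg_zero]
        · intro h
          rw [Finset.mem_filter] at h
          refine h.2.2 ?_
          have h2 := hanti a ha
          exact self_eq_neg.1 h2)
      refine ⟨l ++ [a], ?_, c, hc, ?_⟩
      · intro b hb
        rcases List.mem_append.1 hb with h | h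
        · exact hl b h
        · rw [List.mem_singleton.1 h]; exact hamid
      · rw [act, List.foldr_append]
        exact hlc
    · refine ih s hs hs0 ?_
      rw [Finset.filter_eq_empty_iff.2, Finset.card_empty]
      · exact Nat.zero_le _
      · intro a _ ha
        exact h ⟨a, ha⟩

/-- Irreducibility of the half spin modules. The word of `exists_act_eq` that leads to the vacuum
has length of the parity of `s`; even words preserve `T`. -/
theorem vac_mem_of_stable (hn : 2 ≤ n) (ε : Bool) (T : Submodule ℂ (Spinor (n + k)))
    (hT : ∀ a ∈ mid n k, ∀ b ∈ mid n k, ∀ s ∈ T, cliff ℂ a (cliff ℂ b s) ∈ T)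
    {s : Spinor (n + k)} (hs : s ∈ T) (hs0 : s ≠ 0) (hsm : s ∈ midSpinor n k)
    (hpar : parity _ s = sg ε • s) : vac (n + k) ε ∈ T := by
  have hm : 1 ≤ n + k := by omega
  have heven : ∀ N : ℕ, ∀ l : List (Fin (2 * (n + k))), l.length = 2 * N →
      (∀ a ∈ l, a ∈ mid n k) → act l s ∈ T := by
    intro N
    induction N with
    | zero =>
      intro l hl _
      rw [List.length_eq_zero_iff.1 hl]
      exact hs
    | succ N ih =>
      intro l hl hmid
      match l, hl with
      | a :: b :: l, hl =>
        exact hT a (hmid a (by simp)) b (hmid b (by simp)) _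
          (ih l (by simp only [List.length_cons] at hl; omega)
            fun c hc => hmid c (by simp [hc]))
  obtain ⟨l, hl, c, hc, hlc⟩ := exists_act_eq hm _ s hsm hs0 le_rfl
  have h1 := parity_act l s
  rw [hlc, hpar, act_smul, hlc, map_smul, parity_vac hm, sg, if_neg (by simp), one_smul,
    smul_smul, smul_smul] at h1
  have h2 : c = (-1) ^ l.length * (sg ε * c) := by
    have := congrFun h1 (vacI (n + k) false)
    simpa [vac, mul_assoc] using this
  have h3 : (-1) ^ l.length * sg ε = 1 := by
    apply mul_right_cancel₀ hc
    rw [one_mul]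
    linear_combination -h2
  cases ε
  · have hev : Even l.length := by
      by_contra h
      rw [(Nat.not_even_iff_odd.1 h).neg_one_pow] at h3
      norm_num [sg] at h3
    obtain ⟨N, hN⟩ := hev
    have h4 := heven N l (by omega) hl
    rw [hlc] at h4
    exact (T.smul_mem_iff hc).1 h4
  · have hodd : Odd l.length := by
      by_contra h
      rw [(Nat.not_odd_iff_even.1 h).neg_one_pow] at h3
      norm_num [sg] at h3
    obtain ⟨N, hN⟩ := hodd
    -- For odd parity a creation operator at the last place makes the word even and turns the vacuum
    -- into `vac true`.
    have h4 := heven (N + 1) (pI hm false :: l) (by simp [hN]; omega) (by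
      intro a ha
      rcases List.mem_cons.1 ha with rfl | h
      · rw [mem_mid]; simp [pI]; omega
      · exact hl a h)
    have h5 : act (pI hm false :: l) s = c • vac (n + k) true := by
      change cliff ℂ _ (act l s) = _
      rw [hlc, map_smul, cliff_pI_vac, Bool.not_false]
    rw [h5] at h4
    exact (T.smul_mem_iff hc).1 h4

/-- Adding the sum to its reindexing by `a ↦ a'` gives `γ_a γ_{a'} + γ_{a'} γ_a = 1` for each of the
`2n` indices. -/
theorem sum_cliff_cliff (s : Spinor (n + k)) :
    ∑ a ∈ mid n k, cliff ℂ a (cliff ℂ a.rev s) = (n : ℂ) • s := by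
  have h1 : ∑ a ∈ mid n k, cliff ℂ a (cliff ℂ a.rev s) =
      ∑ a ∈ mid n k, cliff ℂ a.rev (cliff ℂ a s) := by
    refine Finset.sum_nbij' Fin.rev Fin.rev (fun a ha => rev_mem_mid.2 ha)
      (fun a ha => rev_mem_mid.2 ha) ?_ ?_ ?_ <;> simp
  have h2 : ∑ a ∈ mid n k, cliff ℂ a (cliff ℂ a.rev s) +
      ∑ a ∈ mid n k, cliff ℂ a.rev (cliff ℂ a s) = (2 * n : ℂ) • s := by
    rw [← Finset.sum_add_distrib]
    have : ∀ a ∈ mid n k, cliff ℂ a (cliff ℂ a.rev s) + cliff ℂ a.rev (cliff ℂ a s) = s := by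
      intro a _
      rw [cliff_cliff a, if_pos rfl]
      abel
    rw [Finset.sum_congr rfl this, Finset.sum_const, card_mid, ← Nat.cast_smul_eq_nsmul ℂ]
    push_cast
    rfl
  rw [← h1, ← two_smul ℂ, mul_smul] at h2
  exact smul_right_injective _ (two_ne_zero (α := ℂ)) h2

end HalfSpin

/-! ### The action of the orthogonal Lie algebra on spinors -/

section SpinAction

variable {m : ℕ}

/-- The Clifford generators, without bosons. -/
def spinOsc (m : ℕ) : Oscillators m Empty (Module.End ℂ (Spinor m)) where
  q _ l := l.elim
  p _ l := l.elim
  γ a := cliff ℂ a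
  q_mul_q _ _ l := l.elim
  p_mul_p _ _ l := l.elim
  p_mul_q _ _ l := l.elim
  γ_mul_q _ _ l := l.elim
  γ_mul_p _ _ l := l.elim
  γ_mul_γ := cliff_mul

theorem spin_T (a b : Fin (2 * m)) (s : Spinor m) :
    (spinOsc m).T a b s = (1 / 2 : ℂ) • cliff ℂ a (cliff ℂ b.rev s) := by
  simp [Oscillators.T, spinOsc]

theorem spin_rho (X : so m) (s : Spinor m) : (spinOsc m).rho X s =
    ∑ a, ∑ b, X.1 a b • (1 / 2 : ℂ) • cliff ℂ a (cliff ℂ b.rev s) := by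
  simp [Oscillators.rho, spin_T]

theorem spin_rho_cliff (X : so m) (c : Fin (2 * m)) (s : Spinor m) :
    (spinOsc m).rho X (cliff ℂ c s) =
      cliff ℂ c ((spinOsc m).rho X s) + ∑ a, X.1 a c • cliff ℂ a s := by
  have h := LinearMap.congr_fun ((spinOsc m).rho_lie_γ X c) s
  simp only [LinearMap.sub_apply, Module.End.mul_apply, LinearMap.sum_apply,
    LinearMap.smul_apply] at h
  exact sub_eq_iff_eq_add'.1 h

theorem spin_rho_G (a b : Fin (2 * m)) (s : Spinor m) : (spinOsc m).rho (G a b) s =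
    cliff ℂ a (cliff ℂ b.rev s) - if a = b then (1 / 2 : ℂ) • s else 0 := by
  rw [Oscillators.rho_G, LinearMap.sub_apply, spin_T, spin_T, Fin.rev_rev,
    cliff_cliff b.rev a, Fin.rev_rev]
  split_ifs <;> module

theorem parity_spin_rho (X : so m) (s : Spinor m) :
    parity m ((spinOsc m).rho X s) = (spinOsc m).rho X (parity m s) := by
  simp only [spin_rho, map_sum, map_smul, parity_cliff, map_neg, neg_neg]

end SpinAction

/-! ### Vectors of the oscillator representation -/

section OscVectors

variable {n k : ℕ}

/-- The indices of the first block. -/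
def fstBlk (n k : ℕ) : Finset (Fin (2 * (n + k))) := Finset.univ.filter fun a => (a : ℕ) < k

theorem mem_fstBlk {a : Fin (2 * (n + k))} : a ∈ fstBlk n k ↔ (a : ℕ) < k := by
  simp [fstBlk]

/-- The sum of the first `k` diagonal entries. -/
def trk (n k : ℕ) (X : so (n + k)) : ℂ := ∑ a ∈ fstBlk n k, X.1 a a

/-- The action of `so(2(n+k), ℂ)` on polynomials. -/
def boson (X : so (n + k)) (x : MvPolynomial (Fin (2 * (n + k)) × Fin n) ℂ) :
    MvPolynomial (Fin (2 * (n + k)) × Fin n) ℂ :=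
  ∑ a, ∑ b, X.1 a b • ∑ l, bosQ k a l (bosP k b l x)

theorem emb_sum {ι : Type*} (t : Finset ι)
    (f : ι → MvPolynomial (Fin (2 * (n + k)) × Fin n) ℂ) (s : Spinor (n + k)) :
    emb n k (∑ i ∈ t, f i) s = ∑ i ∈ t, emb n k (f i) s := by
  funext I
  simp only [emb_apply, Finset.sum_apply, Finset.smul_sum]

theorem emb_smul (c : ℂ) (x : MvPolynomial (Fin (2 * (n + k)) × Fin n) ℂ)
    (s : Spinor (n + k)) : emb n k (c • x) s = c • emb n k x s := by
  funext I
  rw [emb_apply, Pi.smul_apply, emb_apply, smul_comm]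

theorem emb_zero (s : Spinor (n + k)) : emb n k 0 s = 0 := by
  funext I
  simp [emb_apply]

theorem emb_neg (x : MvPolynomial (Fin (2 * (n + k)) × Fin n) ℂ) (s : Spinor (n + k)) :
    emb n k (-x) s = - emb n k x s := by
  funext I
  simp [emb_apply]

theorem osc_T_emb (a b : Fin (2 * (n + k)))
    (x : MvPolynomial (Fin (2 * (n + k)) × Fin n) ℂ) (s : Spinor (n + k)) :
    (osc n k).T a b (emb n k x s) =
      emb n k (∑ l, bosQ k a l (bosP k b l x)) s + emb n k x ((spinOsc _).T a b s) := by
  rw [Oscillators.T, spin_T, emb_sum, LinearMap.add_apply, LinearMap.smul_apply,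
    LinearMap.sum_apply]
  simp only [Module.End.mul_apply, osc_p_emb, osc_q_emb, osc_γ_emb, map_smul]

theorem osc_rho_emb (X : so (n + k)) (x : MvPolynomial (Fin (2 * (n + k)) × Fin n) ℂ)
    (s : Spinor (n + k)) :
    (osc n k).rho X (emb n k x s) = emb n k (boson X x) s + emb n k x ((spinOsc _).rho X s) := by
  simp only [Oscillators.rho, boson, emb_sum, emb_smul, LinearMap.sum_apply, LinearMap.smul_apply,
    osc_T_emb, smul_add, Finset.sum_add_distrib, map_sum, map_smul]

theorem bosP_one (b : Fin (2 * (n + k))) (l : Fin n) :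
    bosP k b l 1 = if (b : ℕ) < k then MvPolynomial.X (b, l) else 0 := by
  unfold bosP
  split_ifs <;> simp

theorem bosQ_X (a b : Fin (2 * (n + k))) (l : Fin n) (ha : (a : ℕ) < k) :
    bosQ k a l (MvPolynomial.X (b, l)) = if a = b then -1 else 0 := by
  rw [bosQ, if_pos ha, LinearMap.neg_apply]
  change - MvPolynomial.pderiv _ _ = _
  rw [MvPolynomial.pderiv_X, Pi.single_apply]
  by_cases h : a = b
  · simp [h]
  · rw [if_neg h, if_neg, neg_zero]
    exact fun h' => h (Prod.mk.inj h').1.symm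

theorem bosQ_of_not_lt (a : Fin (2 * (n + k))) (l : Fin n) (ha : ¬ (a : ℕ) < k)
    (f : MvPolynomial (Fin (2 * (n + k)) × Fin n) ℂ) :
    bosQ k a l f = MvPolynomial.X (a, l) * f := by
  rw [bosQ, if_neg ha]
  rfl

/-- For `b` outside the first block `p_{b,l}` kills `1`. For `b` in it, only `q_{b,l} X_{b,l} = -1`
survives, as `X` has no entries below the first diagonal block; summing over the `n` copies gives
`-n tr_k`. -/
theorem boson_one_of_mem_par {X : so (n + k)} (hX : X ∈ par n k) :
    boson X 1 = (-(n * trk n k X)) • (1 : MvPolynomial (Fin (2 * (n + k)) × Fin n) ℂ) := by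
  have h : ∀ a b : Fin (2 * (n + k)), X.1 a b • ∑ l, bosQ k a l (bosP k b l 1) =
      if b = a then (if (a : ℕ) < k then -((n : ℂ) * X.1 a a) else 0) •
        (1 : MvPolynomial (Fin (2 * (n + k)) × Fin n) ℂ) else 0 := by
    intro a b
    simp only [bosP_one]
    by_cases hb : (b : ℕ) < k
    · by_cases ha : (a : ℕ) < k
      · simp only [hb, if_true, bosQ_X _ _ _ ha, ha]
        by_cases hab : a = b
        · subst hab
          simp only [if_true, Finset.sum_const, Finset.card_univ, Fintype.card_fin]
          rw [← Nat.cast_smul_eq_nsmul ℂ, smul_smul, smul_neg, neg_smul, mul_comm (n : ℂ)]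
        · simp [hab, Ne.symm hab]
      · have hab : b ≠ a := fun h => ha (h ▸ hb)
        rw [if_neg hab, hX a b, zero_smul]
        unfold blk
        rw [if_pos hb, if_neg ha]
        split_ifs <;> omega
    · simp only [hb, if_false, map_zero, Finset.sum_const_zero, smul_zero]
      by_cases hab : b = a
      · rw [if_pos hab, if_neg (hab ▸ hb), zero_smul]
      · rw [if_neg hab]
  rw [boson]
  simp only [h, Finset.sum_ite_eq', Finset.mem_univ, if_true]
  rw [← Finset.sum_smul]
  congr 1
  rw [trk, Finset.mul_sum, ← Finset.sum_neg_distrib, fstBlk, Finset.sum_filter]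

theorem osc_rho_emb_one {X : so (n + k)} (hX : X ∈ par n k) (s : Spinor (n + k)) :
    (osc n k).rho X (emb n k 1 s) =
      emb n k 1 ((spinOsc _).rho X s) - (n * trk n k X) • emb n k 1 s := by
  rw [osc_rho_emb, boson_one_of_mem_par hX, emb_smul, neg_smul]
  abel

theorem boson_G_one {a b : Fin (2 * (n + k))} (ha : a ∈ mid n k) (hb : (b : ℕ) < k) :
    boson (G a b) 1 = ∑ l, MvPolynomial.X (a, l) * MvPolynomial.X (b, l) := by
  rw [mem_mid] at ha
  have h : ∀ c d : Fin (2 * (n + k)), (G a b).1 c d • ∑ l, bosQ k c l (bosP k d l 1) =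
      if c = a then (if d = b then
        ∑ l, (MvPolynomial.X (a, l) * MvPolynomial.X (b, l) :
          MvPolynomial (Fin (2 * (n + k)) × Fin n) ℂ) else 0) else 0 := by
    intro c d
    rw [G_apply, sub_smul]
    have h2 : (if c = b.rev ∧ d = a.rev then (1 : ℂ) else 0) •
        ∑ l : Fin n, bosQ k c l (bosP k d l 1) = 0 := by
      split_ifs with h
      · have hd : ¬ (d : ℕ) < k := by rw [h.2, Fin.val_rev]; omega
        simp only [bosP_one, hd, if_false, map_zero, Finset.sum_const_zero, smul_zero]
      · rw [zero_smul]
    rw [h2, sub_zero]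
    by_cases hc : c = a <;> by_cases hd : d = b <;> simp only [hc, hd, and_self, and_true,
      true_and, if_true, if_false, zero_smul, one_smul, and_false, false_and]
    exact Finset.sum_congr rfl fun l _ => by
      rw [bosP_one, if_pos hb, bosQ_of_not_lt _ _ (by omega)]
  rw [boson]
  simp only [h, Finset.sum_ite_irrel, Finset.sum_ite_eq', Finset.sum_const_zero, Finset.mem_univ,
    if_true]

theorem osc_rho_G_emb {a b : Fin (2 * (n + k))} (ha : a ∈ mid n k) (hb : (b : ℕ) < k)
    (s : Spinor (n + k)) :
    (osc n k).rho (G a b) (emb n k 1 s) =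
      emb n k (∑ l, MvPolynomial.X (a, l) * MvPolynomial.X (b, l)) s +
        emb n k 1 (cliff ℂ a (cliff ℂ b.rev s)) := by
  have hab : a ≠ b := by
    rintro rfl
    rw [mem_mid] at ha
    omega
  rw [osc_rho_emb, boson_G_one ha hb, spin_rho_G, if_neg hab, sub_zero]

/-- The image of `b ⊗ s` under the symbol of the Dirac operators. -/
def wv (n k : ℕ) (b : Fin (2 * (n + k))) : Spinor (n + k) →ₗ[ℂ] Osc n k :=
  ∑ a ∈ mid n k, (osc n k).rho (G a b) ∘ₗ emb n k 1 ∘ₗ cliff ℂ a.rev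

theorem wv_apply (b : Fin (2 * (n + k))) (s : Spinor (n + k)) :
    wv n k b s = ∑ a ∈ mid n k, (osc n k).rho (G a b) (emb n k 1 (cliff ℂ a.rev s)) := by
  simp [wv, LinearMap.sum_apply]

/-- The fermionic terms `γ_a γ_{b'} γ_{a'} s` sum to `-n γ_{b'} s`: move `γ_{b'}` to the left and
apply `sum_cliff_cliff`. -/
theorem wv_eq {b : Fin (2 * (n + k))} (hb : (b : ℕ) < k) (s : Spinor (n + k)) :
    wv n k b s = ∑ a ∈ mid n k,
      emb n k (∑ l, MvPolynomial.X (a, l) * MvPolynomial.X (b, l)) (cliff ℂ a.rev s) -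
      (n : ℂ) • emb n k 1 (cliff ℂ b.rev s) := by
  rw [wv_apply, Finset.sum_congr rfl fun a ha => osc_rho_G_emb ha hb _, Finset.sum_add_distrib,
    sub_eq_add_neg]
  congr 1
  rw [← map_sum]
  have h : ∀ a ∈ mid n k, cliff ℂ a (cliff ℂ b.rev (cliff ℂ a.rev s)) =
      - cliff ℂ b.rev (cliff ℂ a (cliff ℂ a.rev s)) := by
    intro a ha
    refine cliff_cliff_of_ne (fun h => ?_) _
    rw [← Fin.rev_injective h] at ha
    rw [mem_mid] at ha
    omega
  rw [Finset.sum_congr rfl h, Finset.sum_neg_distrib, ← map_sum, sum_cliff_cliff, map_smul,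
    map_neg, map_smul]

/-- In `D_l (X_{b,l} ⊗ s)` the middle indices give the quadratic terms, `a = b` gives `-γ_{b'} s`,
and the last block gives nothing because `γ_{a'} s = 0` for `a' < k`. The `n` copies together
reproduce the constant `-n` of `wv_eq`; this fixes the number of copies. -/
theorem wv_eq_dirac {b : Fin (2 * (n + k))} (hb : (b : ℕ) < k) {s : Spinor (n + k)}
    (hs : s ∈ midSpinor n k) :
    wv n k b s = ∑ l, (osc n k).dirac l ((osc n k).p b l (emb n k 1 s)) := by
  have h1 : ∀ l, (osc n k).dirac l ((osc n k).p b l (emb n k 1 s)) =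
      ∑ a ∈ mid n k, emb n k (MvPolynomial.X (a, l) * MvPolynomial.X (b, l)) (cliff ℂ a.rev s) -
        emb n k 1 (cliff ℂ b.rev s) := by
    intro l
    rw [osc_p_emb, bosP_one, if_pos hb, Oscillators.dirac, LinearMap.sum_apply]
    simp only [Module.End.mul_apply, osc_γ_emb, osc_q_emb]
    have h2 : ∀ a : Fin (2 * (n + k)),
        emb n k (bosQ k a l (MvPolynomial.X (b, l))) (cliff ℂ a.rev s) =
        (if a ∈ mid n k then
          emb n k (MvPolynomial.X (a, l) * MvPolynomial.X (b, l)) (cliff ℂ a.rev s) else 0) +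
        if a = b then - emb n k 1 (cliff ℂ b.rev s) else 0 := by
      intro a
      by_cases ha : (a : ℕ) < k
      · have hm : a ∉ mid n k := by rw [mem_mid]; omega
        rw [bosQ_X _ _ _ ha, if_neg hm, zero_add]
        split_ifs with hab
        · rw [emb_neg, hab]
        · rw [emb_zero]
      · have hab : a ≠ b := fun h => ha (h ▸ hb)
        rw [bosQ_of_not_lt _ _ ha, if_neg hab, add_zero]
        split_ifs with hm
        · rfl
        · rw [mem_midSpinor.1 hs, map_zero]
          have := a.isLt
          rw [mem_mid] at hm
          rw [Fin.val_rev]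
          omega
    simp only [h2, Finset.sum_add_distrib, Finset.sum_ite_eq', Finset.mem_univ, if_true,
      Finset.sum_ite_mem, Finset.univ_inter]
    rw [sub_eq_add_neg]
  rw [wv_eq hb, Finset.sum_congr rfl fun l _ => h1 l, Finset.sum_sub_distrib, Finset.sum_comm,
    Finset.sum_const, Finset.card_univ, Fintype.card_fin, Nat.cast_smul_eq_nsmul]
  simp only [emb_sum]

theorem spin_rho_mem_midSpinor {X : so (n + k)} (hX : X ∈ par n k) {s : Spinor (n + k)}
    (hs : s ∈ midSpinor n k) : (spinOsc _).rho X s ∈ midSpinor n k := by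
  rw [mem_midSpinor] at *
  intro c hc
  have h := spin_rho_cliff X c s
  rw [hs c hc, map_zero, Finset.sum_eq_zero, add_zero] at h
  · exact h.symm
  · intro a _
    by_cases ha : (a : ℕ) < k
    · rw [hs a ha, smul_zero]
    · rw [hX a c, zero_smul]
      unfold blk
      rw [if_pos hc, if_neg ha]
      split_ifs <;> omega

/-- Since the Dirac operators commute with `X`, the action is the one on `p_{b,l} (1 ⊗ s)`: the spin
action on `s`, the covector action on `b`, and the character `-n tr_k`. -/
theorem osc_rho_wv {X : so (n + k)} (hX : X ∈ par n k) {b : Fin (2 * (n + k))} (hb : (b : ℕ) < k)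
    {s : Spinor (n + k)} (hs : s ∈ midSpinor n k) :
    (osc n k).rho X (wv n k b s) = wv n k b ((spinOsc _).rho X s) -
      ∑ c ∈ fstBlk n k, X.1 b c • wv n k c s - (n * trk n k X) • wv n k b s := by
  have h1 : ∀ l, (osc n k).rho X ((osc n k).dirac l ((osc n k).p b l (emb n k 1 s))) =
      (osc n k).dirac l ((osc n k).p b l (emb n k 1 ((spinOsc _).rho X s))) -
      ∑ c ∈ fstBlk n k, X.1 b c • (osc n k).dirac l ((osc n k).p c l (emb n k 1 s)) -
      (n * trk n k X) • (osc n k).dirac l ((osc n k).p b l (emb n k 1 s)) := by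
    intro l
    have h2 := LinearMap.congr_fun ((osc n k).rho_mul_dirac X l)
      ((osc n k).p b l (emb n k 1 s))
    have h3 := LinearMap.congr_fun ((osc n k).rho_lie_p X b l) (emb n k 1 s)
    simp only [LinearMap.sub_apply, Module.End.mul_apply, LinearMap.neg_apply,
      LinearMap.sum_apply, LinearMap.smul_apply] at h2 h3
    rw [h2, sub_eq_iff_eq_add.1 h3, osc_rho_emb_one hX]
    simp only [map_add, map_neg, map_sub, map_smul, map_sum]
    -- Outside the first block `p_{c,l}` is a derivation and kills the polynomial `1`.
    have h4 : ∑ c, X.1 b c • (osc n k).dirac l ((osc n k).p c l (emb n k 1 s)) =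
        ∑ c ∈ fstBlk n k, X.1 b c •
          (osc n k).dirac l ((osc n k).p c l (emb n k 1 s)) := by
      refine (Finset.sum_subset (Finset.subset_univ _) fun c _ hc => ?_).symm
      rw [mem_fstBlk] at hc
      rw [osc_p_emb, bosP_one, if_neg hc, emb_zero, map_zero, smul_zero]
    rw [h4]
    abel
  rw [wv_eq_dirac hb hs, map_sum, Finset.sum_congr rfl fun l _ => h1 l,
    Finset.sum_sub_distrib, Finset.sum_sub_distrib, wv_eq_dirac hb (spin_rho_mem_midSpinor hX hs),
    Finset.smul_sum, Finset.sum_comm]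
  congr 2
  refine Finset.sum_congr rfl fun c hc => ?_
  rw [wv_eq_dirac (mem_fstBlk.1 hc) hs, Finset.smul_sum]

/-- The component of a vector of the oscillator space for a monomial. -/
def oscCoeff (n k : ℕ) (d : Fin (2 * (n + k)) × Fin n →₀ ℕ) :
    Osc n k →ₗ[ℂ] Spinor (n + k) :=
  (MvPolynomial.lcoeff ℂ d).compLeft _

theorem oscCoeff_emb (d : Fin (2 * (n + k)) × Fin n →₀ ℕ)
    (x : MvPolynomial (Fin (2 * (n + k)) × Fin n) ℂ) (s : Spinor (n + k)) :
    oscCoeff n k d (emb n k x s) = x.coeff d • s := by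
  funext I
  change MvPolynomial.lcoeff ℂ d (s I • x) = x.coeff d * s I
  rw [map_smul, smul_eq_mul, mul_comm]
  rfl

theorem emb_one_injective : Function.Injective (emb n k 1) := by
  intro s t h
  have := congrArg (oscCoeff n k 0) h
  rwa [oscCoeff_emb, oscCoeff_emb, MvPolynomial.coeff_zero_one, one_smul, one_smul] at this

theorem coeff_pair (l₀ : Fin n) {a b a' b' : Fin (2 * (n + k))} (ha : k ≤ (a : ℕ))
    (hb : (b : ℕ) < k) (ha' : k ≤ (a' : ℕ)) (hb' : (b' : ℕ) < k) :
    (∑ l, MvPolynomial.X (a', l) * MvPolynomial.X (b', l) :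
      MvPolynomial (Fin (2 * (n + k)) × Fin n) ℂ).coeff
      (Finsupp.single (a, l₀) 1 + Finsupp.single (b, l₀) 1) =
      if a' = a ∧ b' = b then 1 else 0 := by
  rw [MvPolynomial.coeff_sum]
  have h : ∀ l, (MvPolynomial.X (a', l) * MvPolynomial.X (b', l) :
      MvPolynomial (Fin (2 * (n + k)) × Fin n) ℂ).coeff
      (Finsupp.single (a, l₀) 1 + Finsupp.single (b, l₀) 1) =
      if l = l₀ then (if a' = a ∧ b' = b then 1 else 0) else 0 := by
    intro l
    rw [MvPolynomial.X, MvPolynomial.X, MvPolynomial.monomial_mul, MvPolynomial.coeff_monomial,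
      one_mul, ← ite_and]
    refine if_congr ?_ rfl rfl
    constructor
    · intro h
      have h1 := DFunLike.congr_fun h (a', l)
      have h2 := DFunLike.congr_fun h (b', l)
      have hab' : b' ≠ a' := fun h => by rw [h] at hb'; omega
      simp only [Finsupp.add_apply, Finsupp.single_apply, Prod.mk.injEq, and_true, if_true] at h1 h2
      have e1 : ¬ (b = a' ∧ l₀ = l) := fun h => by rw [← h.1] at ha'; omega
      have e2 : ¬ (a = b' ∧ l₀ = l) := fun h => by rw [← h.1] at hb'; omega
      rw [if_neg e1, if_neg hab'] at h1
      rw [if_neg e2, if_neg hab'.symm] at h2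
      have f1 : a = a' ∧ l₀ = l := by
        by_contra h
        rw [if_neg h] at h1
        omega
      have f2 : b = b' ∧ l₀ = l := by
        by_contra h
        rw [if_neg h] at h2
        omega
      exact ⟨f1.2.symm, f1.1.symm, f2.1.symm⟩
    · rintro ⟨rfl, rfl, rfl⟩
      rfl
  rw [Finset.sum_congr rfl fun l _ => h l, Finset.sum_ite_eq', if_pos (Finset.mem_univ _)]

/-- The source of injectivity in low degrees: the monomial `X_{a,l₀} X_{b,l₀}` occurs in no other
summand than that of `G a b`, and the terms `1 ⊗ t` do not contain it. Any copy `l₀` will do. -/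
theorem oscCoeff_sum (l₀ : Fin n) (z : Fin (2 * (n + k)) → Fin (2 * (n + k)) → Spinor (n + k))
    (s : Spinor (n + k)) {a b : Fin (2 * (n + k))} (ha : a ∈ mid n k) (hb : (b : ℕ) < k) :
    oscCoeff n k (Finsupp.single (a, l₀) 1 + Finsupp.single (b, l₀) 1)
      (emb n k 1 s + ∑ a ∈ mid n k, ∑ b ∈ fstBlk n k,
        (osc n k).rho (G a b) (emb n k 1 (z a b))) = z a b := by
  have h1 : ∀ t : Spinor (n + k),
      oscCoeff n k (Finsupp.single (a, l₀) 1 + Finsupp.single (b, l₀) 1) (emb n k 1 t) = 0 := by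
    intro t
    rw [oscCoeff_emb, MvPolynomial.coeff_one, if_neg, zero_smul]
    intro h
    have := DFunLike.congr_fun h (a, l₀)
    simp only [Finsupp.coe_zero, Pi.zero_apply, Finsupp.add_apply, Finsupp.single_eq_same] at this
    omega
  have h2 : ∀ a' ∈ mid n k, ∀ b' ∈ fstBlk n k,
      oscCoeff n k (Finsupp.single (a, l₀) 1 + Finsupp.single (b, l₀) 1)
        ((osc n k).rho (G a' b') (emb n k 1 (z a' b'))) =
      if b' = b then (if a' = a then z a b else 0) else 0 := by
    intro a' ha' b' hb'
    rw [mem_fstBlk] at hb'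
    rw [osc_rho_G_emb ha' hb', map_add, h1, add_zero, oscCoeff_emb,
      coeff_pair l₀ (mem_mid.1 ha).1 hb (mem_mid.1 ha').1 hb']
    by_cases hbb : b' = b <;> by_cases haa : a' = a <;> simp [haa, hbb]
  rw [map_add, h1, zero_add, map_sum]
  rw [Finset.sum_congr rfl fun a' ha' => by
    rw [map_sum, Finset.sum_congr rfl fun b' hb' => h2 a' ha' b' hb', Finset.sum_ite_eq',
      if_pos (mem_fstBlk.2 hb)], Finset.sum_ite_eq', if_pos ha]

end OscVectors

/-! ### Weights of spinors -/

section SpinWeights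

variable {m : ℕ}

theorem sum_fin_two_mul {A : Type*} [AddCommMonoid A] (f : Fin (2 * m) → A) :
    ∑ a, f a = ∑ i : Fin m, (f (Fin.castLE (by omega) i) + f (Fin.castLE (by omega) i).rev) := by
  rw [← Finset.sum_filter_add_sum_filter_not Finset.univ (fun a : Fin (2 * m) => (a : ℕ) < m),
    Finset.sum_add_distrib]
  congr 1
  · refine (Finset.sum_bij (fun i _ => Fin.castLE (by omega) i) ?_ ?_ ?_ ?_).symm
    · intro i _
      simp
    · intro i _ j _ h
      simpa using h
    · intro a ha
      exact ⟨⟨a, (Finset.mem_filter.1 ha).2⟩, Finset.mem_univ _, rfl⟩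
    · intro i _
      rfl
  · refine (Finset.sum_bij (fun i _ => (Fin.castLE (by omega) i).rev) ?_ ?_ ?_ ?_).symm
    · intro i _
      have := i.isLt
      simp [Fin.val_rev]
      omega
    · intro i _ j _ h
      simpa using h
    · intro a ha
      have h1 := (Finset.mem_filter.1 ha).2
      have h2 := a.isLt
      refine ⟨⟨2 * m - 1 - a, by omega⟩, Finset.mem_univ _, ?_⟩
      rw [Fin.ext_iff, Fin.val_rev]
      simp
      omega
    · intro i _
      rfl

/-- The weight of `vac m ε`. -/
def spinWt (ε : Bool) (H : so m) : ℂ :=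
  ∑ i : Fin m, 1 / 2 * (if (i : ℕ) + 1 = m then sg ε else 1) *
    H.1 (Fin.castLE (by omega) i) (Fin.castLE (by omega) i)

theorem castLE_eq_pI (hm : 1 ≤ m) {i : Fin m} (hi : (i : ℕ) + 1 = m) (h : m ≤ 2 * m) :
    Fin.castLE h i = pI hm true := by
  rw [Fin.ext_iff]
  simp [pI]
  omega

theorem cliff_pI_cliff_vac (hm : 1 ≤ m) (ε : Bool) :
    cliff ℂ (pI hm true) (cliff ℂ (pI hm false) (vac m ε)) -
      cliff ℂ (pI hm false) (cliff ℂ (pI hm true) (vac m ε)) = sg ε • vac m ε := by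
  cases ε
  · have h := cliff_pI_not_vac hm false
    rw [Bool.not_false] at h
    rw [h, map_zero, sub_zero, cliff_pI_vac, Bool.not_false, cliff_pI_vac, Bool.not_true, sg,
      if_neg (by simp), one_smul]
  · have h := cliff_pI_not_vac hm true
    rw [Bool.not_true] at h
    rw [h, map_zero, zero_sub, cliff_pI_vac, Bool.not_true, cliff_pI_vac, Bool.not_false, sg,
      if_pos rfl, neg_one_smul]

theorem spin_rho_isCartan {H : so m} (hH : IsCartan H) (s : Spinor m) :
    (spinOsc m).rho H s = ∑ a, H.1 a a • (1 / 2 : ℂ) • cliff ℂ a (cliff ℂ a.rev s) := by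
  rw [spin_rho]
  refine Finset.sum_congr rfl fun a _ => ?_
  rw [Finset.sum_eq_single a]
  · intro b _ hb
    rw [hH a b hb.symm, zero_smul]
  · simp

theorem spin_rho_vac_isCartan (hm : 1 ≤ m) {H : so m} (hH : IsCartan H) (ε : Bool) :
    (spinOsc m).rho H (vac m ε) = spinWt ε H • vac m ε := by
  rw [spin_rho_isCartan hH, sum_fin_two_mul, spinWt, Finset.sum_smul]
  refine Finset.sum_congr rfl fun i _ => ?_
  rw [so_apply_rev, Fin.rev_rev]
  by_cases hi : (i : ℕ) + 1 = m
  · rw [castLE_eq_pI hm hi, if_pos hi, pI_rev, Bool.not_true, mul_right_comm,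
      mul_smul, ← cliff_pI_cliff_vac hm]
    module
  · have h1 : cliff ℂ (Fin.castLE (by omega : m ≤ 2 * m) i) (vac m ε) = 0 :=
      cliff_vac_of_lt (by have := i.isLt; simp; omega) ε
    rw [if_neg hi, cliff_cliff, if_pos rfl, h1, map_zero]
    module

/-- For `a < b`, one of the anticommuting `γ_a`, `γ_{b'}` kills the vacuum. -/
theorem spin_rho_vac_isPos (hm : 1 ≤ m) {X : so m} (hX : IsPos X) (ε : Bool) :
    (spinOsc m).rho X (vac m ε) = 0 := by
  rw [spin_rho]
  refine Finset.sum_eq_zero fun a _ => Finset.sum_eq_zero fun b _ => ?_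
  by_cases hab : b ≤ a
  · rw [hX a b hab, zero_smul]
  have hlt : (a : ℕ) < b := not_le.1 hab
  have hab' : b.rev ≠ a.rev := fun h => hab (Fin.rev_injective h).le
  have hkey : ((b : ℕ) + 1 < m ∨ (b.rev : ℕ) + 1 < m) ∨
      b = pI hm (!ε) ∨ b.rev = pI hm (!ε) := by
    by_cases h1 : (b : ℕ) + 1 = m ∨ (b : ℕ) = m
    · right
      have h2 : b = pI hm true ∨ b = pI hm false := by
        rw [Fin.ext_iff, Fin.ext_iff]
        simp [pI]
        omega
      rcases h2 with rfl | rfl <;> rw [pI_rev] <;> cases ε <;> simp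
    · left
      have := b.isLt
      rw [Fin.val_rev]
      omega
  rcases hkey with (h | h) | (h | h)
  · rw [cliff_cliff_of_ne hab', cliff_vac_of_lt (a := a) (by omega), map_zero, neg_zero, smul_zero,
      smul_zero]
  · rw [cliff_vac_of_lt h, map_zero, smul_zero, smul_zero]
  -- Here `b'` may be the one middle index whose generator does not kill the vacuum; if `a = b'`,
  -- antisymmetry makes the entry of `X` zero.
  · by_cases ha : a = b.rev
    · rw [ha]
      have := so_apply_rev_self X b.rev
      rw [Fin.rev_rev] at this
      rw [this, zero_smul]
    · have hlt' : (a : ℕ) + 1 < m := by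
        have h2 : (b : ℕ) = m - 1 ∨ (b : ℕ) = m := by rw [h]; cases ε <;> simp [pI]
        rw [Fin.ext_iff, Fin.val_rev] at ha
        omega
      rw [cliff_cliff_of_ne hab', cliff_vac_of_lt hlt', map_zero, neg_zero, smul_zero,
        smul_zero]
  · rw [h, cliff_pI_not_vac, map_zero, smul_zero, smul_zero]

theorem isCartan_G (a : Fin (2 * m)) : IsCartan (G a a) := by
  intro i j hij
  rw [G_apply, if_neg, if_neg, sub_zero]
  · rintro ⟨rfl, rfl⟩
    exact hij rfl
  · rintro ⟨rfl, rfl⟩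
    exact hij rfl

theorem spinWt_G (ε : Bool) {a : Fin (2 * m)} (ha : (a : ℕ) < m) :
    spinWt ε (G a a) = 1 / 2 * (if (a : ℕ) + 1 = m then sg ε else 1) := by
  rw [spinWt, Finset.sum_eq_single ⟨a, ha⟩]
  · have h1 : Fin.castLE (by omega : m ≤ 2 * m) ⟨a, ha⟩ = a := rfl
    have h2 : a ≠ a.rev := fun h => by
      rw [Fin.ext_iff, Fin.val_rev] at h
      omega
    have h3 : (G a a).1 a a = 1 := by
      rw [G_apply, if_pos ⟨rfl, rfl⟩, if_neg (fun h => h2 h.1), sub_zero]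
    rw [h1, h3, mul_one]
  · intro i _ hi
    have h3 : (G a a).1 (Fin.castLE (by omega) i) (Fin.castLE (by omega) i) = 0 := by
      rw [G_apply, if_neg, if_neg, sub_zero]
      · rintro ⟨h, _⟩
        have h1 := i.isLt
        rw [Fin.ext_iff, Fin.val_rev, Fin.val_castLE] at h
        omega
      · rintro ⟨h, _⟩
        exact hi (Fin.ext (by have := congrArg Fin.val h; exact this))
    rw [h3, mul_zero]
  · simp

theorem cliff_cliff_self (a : Fin (2 * m)) (s : Spinor m) : cliff ℂ a (cliff ℂ a s) = 0 := by
  have h2 : a ≠ a.rev := fun h => by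
    rw [Fin.ext_iff, Fin.val_rev] at h
    omega
  exact self_eq_neg.1 (cliff_cliff_of_ne h2 s)

/-- `G a a` acts by `γ_a γ_{a'} - 1/2`, so weight `1/2` means `γ_a γ_{a'} s = s`, whence `γ_a s =
0`. These are the equations of `eq_smul_vac`. -/
theorem eq_smul_vac_of_weight (hm : 1 ≤ m) (ε : Bool) {s : Spinor m}
    (h : ∀ H : so m, IsCartan H → (spinOsc m).rho H s = spinWt ε H • s) :
    s = s (vacI m ε) • vac m ε := by
  have key : ∀ a : Fin (2 * m), (a : ℕ) < m → cliff ℂ a (cliff ℂ a.rev s) =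
      (1 / 2 * (1 + if (a : ℕ) + 1 = m then sg ε else 1) : ℂ) • s := by
    intro a ha
    have h1 := h _ (isCartan_G a)
    rw [spin_rho_G, if_pos rfl, spinWt_G ε ha, sub_eq_iff_eq_add] at h1
    rw [h1]
    module
  have kill : ∀ a : Fin (2 * m), cliff ℂ a (cliff ℂ a.rev s) = s → cliff ℂ a s = 0 := by
    intro a ha
    rw [← ha, cliff_cliff_self]
  refine eq_smul_vac hm ε (fun a ha => kill a ?_) (kill _ ?_)
  · rw [key a (by omega), if_neg (by omega)]
    norm_num
  · have h1 : (pI hm true : ℕ) = m - 1 := by simp [pI]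
    have h2 := key (pI hm true) (by omega)
    rw [if_pos (by omega), pI_rev] at h2
    rw [pI_rev, Bool.not_not]
    cases ε
    · rw [Bool.not_true] at h2
      rw [Bool.not_false, h2, sg]
      norm_num
    · rw [Bool.not_true] at *
      rw [cliff_cliff, if_pos (by rw [pI_rev, Bool.not_false]), h2, sg]
      norm_num

end SpinWeights

/-! ### The weights of the theorem -/

section Weights

variable {n k : ℕ}

theorem trk_eq (H : so (n + k)) : trk n k H = ∑ i : Fin (n + k),
    if (i : ℕ) < k then H.1 (Fin.castLE (by omega) i) (Fin.castLE (by omega) i) else 0 := by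
  rw [trk, fstBlk, Finset.sum_filter, sum_fin_two_mul]
  refine Finset.sum_congr rfl fun i _ => ?_
  have := i.isLt
  rw [if_neg (c := (((Fin.castLE _ i).rev : Fin (2 * (n + k))) : ℕ) < k), add_zero]
  · rfl
  · rw [Fin.val_rev, Fin.val_castLE]
    omega

/-- Removing `δ` leaves `1/2 - n` in the first `k` places, `1/2` in the next ones and `± 1/2` in the
last. -/
theorem wtEval_eq_of_oddWt (hn : 2 ≤ n) {lam : Fin (n + k) → ℂ} {ε : Bool}
    (h : lam + delta (n + k) = oddWt n k 1 (sg ε)) (H : so (n + k)) :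
    wtEval lam H = spinWt ε H - n * trk n k H := by
  rw [wtEval, spinWt, trk_eq, Finset.mul_sum, ← Finset.sum_sub_distrib]
  refine Finset.sum_congr rfl fun i _ => ?_
  have h1 := congrFun h i
  rw [Pi.add_apply, delta, oddWt] at h1
  have h2 := i.isLt
  have h3 : lam i = 1 / 2 * (if (i : ℕ) + 1 = n + k then sg ε else 1) -
      if (i : ℕ) < k then (n : ℂ) else 0 := by
    rw [eq_sub_of_add_eq h1]
    push_cast
    by_cases c1 : (i : ℕ) + 1 = k
    · have : (k : ℂ) = i + 1 := by exact_mod_cast c1.symm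
      rw [if_pos c1, if_neg (by omega), if_pos (by omega), this]
      ring
    · by_cases c2 : (i : ℕ) + 1 = n + k
      · have : (n : ℂ) = i + 1 - k := by
          have : (((i : ℕ) + 1 : ℕ) : ℂ) = ((n + k : ℕ) : ℂ) := by rw [c2]
          push_cast at this
          linear_combination -this
        rw [if_neg c1, if_pos c2, if_pos c2, if_neg (by omega), this]
        ring
      · rw [if_neg c1, if_neg c2, if_neg c2]
        split_ifs <;> ring
  rw [h3]
  split_ifs <;> ring

theorem wtEval_sub_of_oddWt (hn : 2 ≤ n) (hk : 1 ≤ k) (hm : 1 ≤ n + k)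
    {lam mu : Fin (n + k) → ℂ} {ε : Bool}
    (h : lam + delta (n + k) = oddWt n k 1 (sg ε))
    (h' : mu + delta (n + k) = oddWt n k (-1) (sg (!ε))) (H : so (n + k)) :
    wtEval mu H = wtEval lam H - H.1 ⟨k - 1, by omega⟩ ⟨k - 1, by omega⟩ -
      sg ε * H.1 (pI hm true) (pI hm true) := by
  let e1 : Fin (n + k) := ⟨k - 1, by omega⟩
  let e2 : Fin (n + k) := ⟨n + k - 1, by omega⟩
  have h3 : ∀ i, mu i = lam i - (if i = e1 then 1 else 0) - if i = e2 then sg ε else 0 := by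
    intro i
    have h1 := congrFun h i
    have h2 := congrFun h' i
    rw [Pi.add_apply, oddWt] at h1 h2
    have hi := i.isLt
    rw [eq_sub_of_add_eq h1, eq_sub_of_add_eq h2]
    have c1 : i = e1 ↔ (i : ℕ) + 1 = k := by
      rw [Fin.ext_iff]
      change (i : ℕ) = k - 1 ↔ _
      omega
    have c2 : i = e2 ↔ (i : ℕ) + 1 = n + k := by
      rw [Fin.ext_iff]
      change (i : ℕ) = n + k - 1 ↔ _
      omega
    simp only [c1, c2, sg_not]
    by_cases d1 : (i : ℕ) + 1 = k
    · rw [if_pos d1, if_pos d1, if_pos d1, if_neg (by omega)]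
      ring
    · rw [if_neg d1, if_neg d1, if_neg d1]
      split_ifs <;> ring
  rw [wtEval, wtEval]
  simp only [h3, sub_mul, ite_mul, one_mul, zero_mul, Finset.sum_sub_distrib, Finset.sum_ite_eq',
    Finset.mem_univ, if_true]
  congr 2

theorem spinWt_not (hm : 1 ≤ n + k) (ε : Bool) (H : so (n + k)) :
    spinWt (!ε) H = spinWt ε H - sg ε * H.1 (pI hm true) (pI hm true) := by
  let e2 : Fin (n + k) := ⟨n + k - 1, by omega⟩
  have h : ∀ i : Fin (n + k), 1 / 2 * (if (i : ℕ) + 1 = n + k then sg (!ε) else 1) *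
      H.1 (Fin.castLE (by omega) i) (Fin.castLE (by omega) i) =
      1 / 2 * (if (i : ℕ) + 1 = n + k then sg ε else 1) *
      H.1 (Fin.castLE (by omega) i) (Fin.castLE (by omega) i) -
      if i = e2 then sg ε * H.1 (pI hm true) (pI hm true) else 0 := by
    intro i
    have c2 : i = e2 ↔ (i : ℕ) + 1 = n + k := by
      rw [Fin.ext_iff]
      change (i : ℕ) = n + k - 1 ↔ _
      omega
    simp only [c2, sg_not]
    split_ifs with hi
    · rw [castLE_eq_pI hm hi]
      ring
    · ring
  rw [spinWt, Finset.sum_congr rfl fun i _ => h i, Finset.sum_sub_distrib, Finset.sum_ite_eq',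
    if_pos (Finset.mem_univ _), spinWt]

end Weights

/-! ### The oscillator module -/

section OscModule

/-- The oscillator space as a module over `U(𝔤)` and `U(𝔭)`. -/
def OscM (n k : ℕ) : Type := Osc n k

variable {n k : ℕ}

instance : AddCommGroup (OscM n k) := inferInstanceAs (AddCommGroup (Osc n k))

instance : Module ℂ (OscM n k) := inferInstanceAs (Module ℂ (Osc n k))

/-- The action of `U(𝔤)` on the oscillator space. -/
def oscHom (n k : ℕ) : Ug n k →ₐ[ℂ] Module.End ℂ (Osc n k) :=
  UniversalEnvelopingAlgebra.lift ℂ (osc n k).rep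

instance : Module (Ug n k) (OscM n k) :=
  (Module.compHom (Osc n k) (oscHom n k).toRingHom : Module (Ug n k) (Osc n k))

instance : Module (Up n k) (OscM n k) := Module.compHom (OscM n k) (incl n k).toRingHom

theorem Ug_smul_def (u : Ug n k) (x : OscM n k) : u • x = oscHom n k u x := rfl

theorem Up_smul_def (u : Up n k) (x : OscM n k) : u • x = incl n k u • x := rfl

instance : IsScalarTower ℂ (Ug n k) (OscM n k) :=
  ⟨fun c u x => by rw [Ug_smul_def, map_smul]; rfl⟩

instance : IsScalarTower ℂ (Up n k) (OscM n k) :=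
  ⟨fun c u x => by rw [Up_smul_def, map_smul, smul_assoc, ← Up_smul_def]⟩

theorem ιg_smul (X : so (n + k)) (x : OscM n k) : ιg n k X • x = (osc n k).rho X x := by
  have h : oscHom n k (ιg n k X) = (osc n k).rep X :=
    UniversalEnvelopingAlgebra.lift_ι_apply ℂ _ X
  rw [Ug_smul_def, h, Oscillators.rep_apply]

theorem incl_ιp (X : par n k) : incl n k (ιp n k X) = ιg n k X.1 := by
  rw [incl, ιp, UniversalEnvelopingAlgebra.lift_ι_apply]
  rfl

theorem ιp_smul (X : par n k) (x : OscM n k) : ιp n k X • x = (osc n k).rho X.1 x := by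
  rw [Up_smul_def, incl_ιp, ιg_smul]

/-- The half spinors for the middle block. -/
def halfSpin (n k : ℕ) (ε : Bool) : Submodule ℂ (Spinor (n + k)) :=
  midSpinor n k ⊓ LinearMap.ker (parity (n + k) - sg ε • LinearMap.id)

theorem mem_halfSpin {ε : Bool} {s : Spinor (n + k)} :
    s ∈ halfSpin n k ε ↔ s ∈ midSpinor n k ∧ parity _ s = sg ε • s := by
  rw [halfSpin, Submodule.mem_inf, LinearMap.mem_ker, LinearMap.sub_apply, LinearMap.smul_apply,
    LinearMap.id_apply, sub_eq_zero]

theorem vac_mem_halfSpin (hn : 2 ≤ n) (ε : Bool) : vac (n + k) ε ∈ halfSpin n k ε :=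
  mem_halfSpin.2 ⟨vac_mem_midSpinor hn ε, parity_vac (by omega) ε⟩

theorem spin_rho_mem_halfSpin {ε : Bool} {X : so (n + k)} (hX : X ∈ par n k)
    {s : Spinor (n + k)} (hs : s ∈ halfSpin n k ε) : (spinOsc _).rho X s ∈ halfSpin n k ε := by
  rw [mem_halfSpin] at *
  exact ⟨spin_rho_mem_midSpinor hX hs.1, by rw [parity_spin_rho, hs.2, map_smul]⟩

/-- The vector `1 ⊗ s` of the oscillator module. -/
def ket (n k : ℕ) : Spinor (n + k) →ₗ[ℂ] OscM n k := emb n k 1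

/-- The vector `wv n k b s` of the oscillator module. -/
def wvM (n k : ℕ) (b : Fin (2 * (n + k))) : Spinor (n + k) →ₗ[ℂ] OscM n k := wv n k b

theorem ket_injective : Function.Injective (ket n k) := emb_one_injective

theorem ιp_smul_ket (X : par n k) (s : Spinor (n + k)) :
    ιp n k X • ket n k s = ket n k ((spinOsc _).rho X.1 s) - (n * trk n k X.1) • ket n k s :=
  (ιp_smul X _).trans (osc_rho_emb_one X.2 s)

theorem ιp_smul_wvM (X : par n k) {b : Fin (2 * (n + k))} (hb : (b : ℕ) < k)
    {s : Spinor (n + k)} (hs : s ∈ midSpinor n k) :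
    ιp n k X • wvM n k b s = wvM n k b ((spinOsc _).rho X.1 s) -
      ∑ c ∈ fstBlk n k, X.1.1 b c • wvM n k c s - (n * trk n k X.1) • wvM n k b s :=
  (ιp_smul X _).trans (osc_rho_wv X.2 hb hs)

theorem trk_of_isPos {X : so (n + k)} (hX : IsPos X) : trk n k X = 0 :=
  Finset.sum_eq_zero fun a _ => hX a a le_rfl

theorem blk_of_mem_mid {a : Fin (2 * (n + k))} (ha : a ∈ mid n k) : blk n k a = 1 := by
  rw [mem_mid] at ha
  rw [blk, if_neg (by omega), if_pos ha.2]

theorem blk_of_lt {a : Fin (2 * (n + k))} (ha : (a : ℕ) < k) : blk n k a = 0 := if_pos ha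

theorem G_apply_of_mem_mid {a b c d : Fin (2 * (n + k))} (ha : a ∈ mid n k) (hb : b ∈ mid n k)
    (hc : (c : ℕ) < k) : (G a b).1 c d = 0 := by
  rw [mem_mid] at ha hb
  rw [G_apply, if_neg, if_neg, sub_zero]
  · rintro ⟨rfl, _⟩
    rw [Fin.val_rev] at hc
    omega
  · rintro ⟨rfl, _⟩
    omega

theorem trk_G_of_mem_mid {a b : Fin (2 * (n + k))} (ha : a ∈ mid n k) (hb : b ∈ mid n k) :
    trk n k (G a b) = 0 :=
  Finset.sum_eq_zero fun _ hc => G_apply_of_mem_mid ha hb (mem_fstBlk.1 hc)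

/-- The elements of `𝔭` for a pair of indices of the middle block. -/
def midG (n k : ℕ) {a b : Fin (2 * (n + k))} (ha : a ∈ mid n k) (hb : b ∈ mid n k) : par n k :=
  ⟨G a b, G_mem_par (by rw [blk_of_mem_mid ha, blk_of_mem_mid hb])⟩

theorem midG_smul_ket {a b : Fin (2 * (n + k))} (ha : a ∈ mid n k) (hb : b ∈ mid n k)
    (s : Spinor (n + k)) : ιp n k (midG n k ha hb) • ket n k s =
      ket n k (cliff ℂ a (cliff ℂ b.rev s) - if a = b then (1 / 2 : ℂ) • s else 0) := by
  rw [ιp_smul_ket]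
  change ket n k ((spinOsc _).rho (G a b) s) - (n * trk n k (G a b)) • _ = _
  rw [trk_G_of_mem_mid ha hb, mul_zero, zero_smul, sub_zero, spin_rho_G]

theorem midG_smul_wvM {a b c : Fin (2 * (n + k))} (ha : a ∈ mid n k) (hb : b ∈ mid n k)
    (hc : (c : ℕ) < k) {s : Spinor (n + k)} (hs : s ∈ midSpinor n k) :
    ιp n k (midG n k ha hb) • wvM n k c s =
      wvM n k c (cliff ℂ a (cliff ℂ b.rev s) - if a = b then (1 / 2 : ℂ) • s else 0) := by
  rw [ιp_smul_wvM _ hc hs]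
  change wvM n k c ((spinOsc _).rho (G a b) s) - ∑ d ∈ fstBlk n k, (G a b).1 c d • _ -
    (n * trk n k (G a b)) • _ = _
  rw [trk_G_of_mem_mid ha hb, mul_zero, zero_smul, sub_zero, spin_rho_G, Finset.sum_eq_zero,
    sub_zero]
  intro d _
  rw [G_apply_of_mem_mid ha hb hc, zero_smul]

/-- Up to a scalar, `γ_a γ_b` is the action of an element of the middle block, so
`vac_mem_of_stable` applies to the preimage of `U(𝔭) f s`. A general `f` covers both `ket` and
`wvM`. -/
theorem vac_mem_of_smul (hn : 2 ≤ n) (ε : Bool) (f : Spinor (n + k) →ₗ[ℂ] OscM n k)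
    (hf : ∀ a b : Fin (2 * (n + k)), ∀ (ha : a ∈ mid n k) (hb : b ∈ mid n k), ∀ s ∈ midSpinor n k,
      ιp n k (midG n k ha hb) • f s =
        f (cliff ℂ a (cliff ℂ b.rev s) - if a = b then (1 / 2 : ℂ) • s else 0))
    {s : Spinor (n + k)} (hs : s ∈ halfSpin n k ε) (hs0 : s ≠ 0) :
    ∃ u : Up n k, u • f s = f (vac (n + k) ε) := by
  let R : Submodule ℂ (OscM n k) :=
    LinearMap.range ((LinearMap.toSpanSingleton (Up n k) (OscM n k) (f s)).restrictScalars ℂ)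
  have hsm := mem_halfSpin.1 hs
  have h : vac (n + k) ε ∈ midSpinor n k ⊓ R.comap f := by
    refine vac_mem_of_stable hn ε _ ?_ (s := s) ⟨hsm.1, 1, one_smul (Up n k) (f s)⟩ hs0 hsm.1 hsm.2
    rintro a ha b hb t ⟨ht, u, hu⟩
    refine ⟨cliff_mem_midSpinor ha (cliff_mem_midSpinor hb ht), ?_⟩
    have hb' : b.rev ∈ mid n k := rev_mem_mid.2 hb
    have hu' : u • f s = f t := hu
    -- The added constant cancels the `-1/2` in the spin action of a diagonal `G`.
    refine ⟨(ιp n k (midG n k ha hb') +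
      algebraMap ℂ (Up n k) (if a = b.rev then (1 / 2 : ℂ) else 0)) * u, ?_⟩
    change ((ιp n k (midG n k ha hb') +
      algebraMap ℂ (Up n k) (if a = b.rev then (1 / 2 : ℂ) else 0)) * u) • f s = _
    rw [mul_smul, hu', add_smul, hf a _ ha hb' t ht, Fin.rev_rev, map_sub, algebraMap_smul]
    split_ifs
    · rw [map_smul, sub_add_cancel]
    · rw [map_zero, sub_zero, zero_smul, add_zero]
  obtain ⟨u, hu⟩ := h.2
  exact ⟨u, hu⟩

theorem smul_ket_mem {ε : Bool} (u : Up n k) {s : Spinor (n + k)} (hs : s ∈ halfSpin n k ε) :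
    ∃ t ∈ halfSpin n k ε, u • ket n k s = ket n k t := by
  have h : u • ket n k s ∈ (halfSpin n k ε).map (ket n k) := by
    refine smul_mem_of_ι (L := par n k) ?_ u ⟨s, hs, rfl⟩
    rintro X _ ⟨t, ht, rfl⟩
    refine ⟨(spinOsc _).rho X.1 t - (n * trk n k X.1) • t,
      Submodule.sub_mem _ (spin_rho_mem_halfSpin X.2 ht) (Submodule.smul_mem _ _ ht), ?_⟩
    rw [map_sub, map_smul]
    exact (ιp_smul_ket X t).symm
  obtain ⟨t, ht, h⟩ := h
  exact ⟨t, ht, h.symm⟩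

theorem isHW_ket (hn : 2 ≤ n) {lam : Fin (n + k) → ℂ} {ε : Bool}
    (h : lam + delta (n + k) = oddWt n k 1 (sg ε)) : IsHW lam (ket n k (vac (n + k) ε)) := by
  have hm : 1 ≤ n + k := by omega
  refine ⟨fun X hX => ?_, fun H hH => ?_⟩
  · rw [ιp_smul_ket, spin_rho_vac_isPos hm hX, trk_of_isPos hX, map_zero, mul_zero, zero_smul,
      sub_zero]
  · rw [ιp_smul_ket, spin_rho_vac_isCartan hm hH, wtEval_eq_of_oddWt hn h, map_smul, sub_smul]

theorem mem_maxIdeal_lam (hn : 2 ≤ n) {lam : Fin (n + k) → ℂ} {ε : Bool}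
    (h : lam + delta (n + k) = oddWt n k 1 (sg ε)) {u : Up n k} :
    u ∈ maxIdeal n k lam ↔ u • ket n k (vac (n + k) ε) = 0 := by
  refine (isHW_ket hn h).mem_maxIdeal_iff ?_ ?_
  · rw [Ne, map_eq_zero_iff _ ket_injective]
    exact vac_ne_zero ε
  · intro a ha
    obtain ⟨t, ht, h1⟩ := smul_ket_mem a (vac_mem_halfSpin (k := k) hn ε)
    rw [h1] at ha ⊢
    exact vac_mem_of_smul hn ε (ket n k) (fun a b ha hb s _ => midG_smul_ket ha hb s) ht
      fun h => ha (by rw [h, map_zero])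

theorem smul_wvM_mem {ε : Bool} (u : Up n k) {b : Fin (2 * (n + k))} (hb : (b : ℕ) < k)
    {s : Spinor (n + k)} (hs : s ∈ halfSpin n k ε) :
    ∃ t : Fin (2 * (n + k)) → Spinor (n + k), (∀ c, t c ∈ halfSpin n k ε) ∧
      u • wvM n k b s = ∑ c ∈ fstBlk n k, wvM n k c (t c) := by
  let W : Submodule ℂ (OscM n k) :=
    { carrier := {x | ∃ t : Fin (2 * (n + k)) → Spinor (n + k), (∀ c, t c ∈ halfSpin n k ε) ∧
        x = ∑ c ∈ fstBlk n k, wvM n k c (t c)}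
      add_mem' := by
        rintro _ _ ⟨t, ht, rfl⟩ ⟨t', ht', rfl⟩
        refine ⟨t + t', fun c => Submodule.add_mem _ (ht c) (ht' c), ?_⟩
        simp only [Pi.add_apply, map_add, Finset.sum_add_distrib]
      zero_mem' := ⟨0, fun c => Submodule.zero_mem _, by simp⟩
      smul_mem' := by
        rintro a _ ⟨t, ht, rfl⟩
        refine ⟨a • t, fun c => Submodule.smul_mem _ _ (ht c), ?_⟩
        simp only [Pi.smul_apply, map_smul, Finset.smul_sum] }
  have hW : ∀ c : Fin (2 * (n + k)), (c : ℕ) < k → ∀ t ∈ halfSpin n k ε, wvM n k c t ∈ W := by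
    intro c hc t ht
    refine ⟨Pi.single c t, fun d => ?_, ?_⟩
    · rcases eq_or_ne d c with rfl | h
      · rwa [Pi.single_eq_same]
      · rw [Pi.single_eq_of_ne h]
        exact Submodule.zero_mem _
    · rw [Finset.sum_eq_single c, Pi.single_eq_same]
      · intro d _ h
        rw [Pi.single_eq_of_ne h, map_zero]
      · intro h
        exact absurd (mem_fstBlk.2 hc) h
  refine smul_mem_of_ι (L := par n k) (C := W) ?_ u (hW b hb s hs)
  rintro X _ ⟨t, ht, rfl⟩
  rw [Finset.smul_sum]
  refine Submodule.sum_mem _ fun c hc => ?_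
  have hc' := mem_fstBlk.1 hc
  have h1 := ιp_smul_wvM X hc' (mem_halfSpin.1 (ht c)).1
  rw [ιp] at h1
  rw [h1]
  refine W.sub_mem (W.sub_mem (hW c hc' _ (spin_rho_mem_halfSpin X.2 (ht c)))
    (Submodule.sum_mem _ fun d hd => W.smul_mem _ (hW d (mem_fstBlk.1 hd) _ (ht c))))
    (W.smul_mem _ (hW c hc' _ (ht c)))

/-- Only the covector action on `d` remains: the spin part contains `γ_b s = 0`, and the trace of `G
b c` vanishes. -/
theorem G_smul_wvM {b c d : Fin (2 * (n + k))} (hb : (b : ℕ) < k) (hc : (c : ℕ) < k)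
    (hd : (d : ℕ) < k) (hbc : b ≠ c) {s : Spinor (n + k)} (hs : s ∈ midSpinor n k) :
    ιp n k ⟨G b c, G_mem_par (by rw [blk_of_lt hb, blk_of_lt hc])⟩ • wvM n k d s =
      if d = b then - wvM n k c s else 0 := by
  have hG : ∀ i j : Fin (2 * (n + k)), (i : ℕ) < k →
      (G b c).1 i j = if i = b ∧ j = c then 1 else 0 := by
    intro i j hi
    rw [G_apply, if_neg (c := i = c.rev ∧ j = b.rev), sub_zero]
    rintro ⟨rfl, _⟩
    rw [Fin.val_rev] at hi
    omega
  have htr : trk n k (G b c) = 0 := Finset.sum_eq_zero fun a ha => by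
    rw [hG a a (mem_fstBlk.1 ha), if_neg]
    rintro ⟨rfl, h⟩
    exact hbc h
  rw [ιp_smul_wvM _ hd hs]
  change wvM n k d ((spinOsc _).rho (G b c) s) - ∑ a ∈ fstBlk n k, (G b c).1 d a • _ -
    (n * trk n k (G b c)) • _ = _
  have hrev : c.rev ≠ b.rev := fun h => hbc (Fin.rev_injective h).symm
  rw [htr, mul_zero, zero_smul, sub_zero, spin_rho_G, if_neg hbc, sub_zero,
    cliff_cliff_of_ne hrev, mem_midSpinor.1 hs b hb, map_zero, neg_zero, map_zero, zero_sub,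
    Finset.sum_eq_single c]
  · rw [hG d c hd]
    split_ifs with h1 h2 h2
    · rw [one_smul]
    · exact absurd h1.1 h2
    · exact absurd ⟨h2, rfl⟩ h1
    · rw [zero_smul, neg_zero]
  · intro a _ ha
    rw [hG d a hd, if_neg fun h => ha h.2, zero_smul]
  · intro h
    exact absurd (mem_fstBlk.2 hc) h

theorem isHW_wvM (hn : 2 ≤ n) (hk : 1 ≤ k) {lam mu : Fin (n + k) → ℂ} {ε : Bool}
    (h : lam + delta (n + k) = oddWt n k 1 (sg ε))
    (h' : mu + delta (n + k) = oddWt n k (-1) (sg (!ε))) :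
    IsHW mu (wvM n k ⟨k - 1, by omega⟩ (vac (n + k) (!ε))) := by
  have hm : 1 ≤ n + k := by omega
  have hlt : ((⟨k - 1, by omega⟩ : Fin (2 * (n + k))) : ℕ) < k := by
    change k - 1 < k
    omega
  refine ⟨fun X hX => ?_, fun H hH => ?_⟩
  · rw [ιp_smul_wvM _ hlt (vac_mem_midSpinor hn _), spin_rho_vac_isPos hm hX, trk_of_isPos hX,
      map_zero, mul_zero, zero_smul, sub_zero, zero_sub, neg_eq_zero]
    refine Finset.sum_eq_zero fun c hc => ?_
    rw [hX, zero_smul]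
    have h1 := mem_fstBlk.1 hc
    rw [Fin.le_def]
    change (c : ℕ) ≤ k - 1
    omega
  · rw [ιp_smul_wvM _ hlt (vac_mem_midSpinor hn _), spin_rho_vac_isCartan hm hH,
      wtEval_sub_of_oddWt hn hk hm h h', wtEval_eq_of_oddWt hn h, map_smul, spinWt_not hm,
      Finset.sum_eq_single ⟨k - 1, by omega⟩]
    · module
    · intro c _ hc
      rw [hH _ _ hc.symm, zero_smul]
    · intro h1
      exact absurd (mem_fstBlk.2 hlt) h1

theorem wvM_ne_zero (hn : 2 ≤ n) {b : Fin (2 * (n + k))} (hb : (b : ℕ) < k) (ε : Bool) :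
    wvM n k b (vac (n + k) (!ε)) ≠ 0 := by
  intro h
  have hm : 1 ≤ n + k := by omega
  have hp : pI hm ε ∈ mid n k := by
    rw [mem_mid]
    cases ε <;> simp [pI] <;> omega
  have h1 := oscCoeff_sum (n := n) (k := k) ⟨0, by omega⟩
    (fun a c => if c = b then cliff ℂ a.rev (vac (n + k) (!ε)) else 0) 0 hp hb
  have h2 : (∑ a ∈ mid n k, ∑ c ∈ fstBlk n k, (osc n k).rho (G a c) (emb n k 1
      (if c = b then cliff ℂ a.rev (vac (n + k) (!ε)) else 0)) : Osc n k) = 0 := by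
    refine Eq.trans ?_ h
    refine Eq.trans ?_ (wv_apply b _).symm
    refine Finset.sum_congr rfl fun a _ => ?_
    rw [Finset.sum_eq_single b, if_pos rfl]
    · intro c _ hc
      rw [if_neg hc, map_zero, map_zero]
    · intro h
      exact absurd (mem_fstBlk.2 hb) h
  rw [h2, map_zero, zero_add, map_zero, if_pos rfl, pI_rev, cliff_pI_vac, Bool.not_not] at h1
  exact vac_ne_zero ε h1.symm

/-- Irreducibility of the model of `V_μ`: if a component `t b` with `b` other than row `k` is
nonzero, the matrix unit from `b` to row `k` isolates it in one step; otherwise only the component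
at row `k` is present. The half spin case finishes. -/
theorem mem_maxIdeal_mu (hn : 2 ≤ n) (hk : 1 ≤ k) {lam mu : Fin (n + k) → ℂ} {ε : Bool}
    (h : lam + delta (n + k) = oddWt n k 1 (sg ε))
    (h' : mu + delta (n + k) = oddWt n k (-1) (sg (!ε))) {u : Up n k} :
    u ∈ maxIdeal n k mu ↔ u • wvM n k ⟨k - 1, by omega⟩ (vac (n + k) (!ε)) = 0 := by
  have hlt : ((⟨k - 1, by omega⟩ : Fin (2 * (n + k))) : ℕ) < k := by
    change k - 1 < k
    omega
  refine (isHW_wvM hn hk h h').mem_maxIdeal_iff (wvM_ne_zero hn hlt ε) ?_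
  intro a ha
  obtain ⟨t, ht, h1⟩ := smul_wvM_mem a hlt (vac_mem_halfSpin (k := k) hn (!ε))
  rw [h1] at ha ⊢
  have key : ∃ (v : Up n k) (s : Spinor (n + k)), s ∈ halfSpin n k (!ε) ∧ s ≠ 0 ∧
      v • ∑ c ∈ fstBlk n k, wvM n k c (t c) = wvM n k ⟨k - 1, by omega⟩ s := by
    by_cases hb : ∃ b ∈ fstBlk n k, b ≠ ⟨k - 1, by omega⟩ ∧ t b ≠ 0
    · obtain ⟨b, hb, hne, hb0⟩ := hb
      refine ⟨ιp n k ⟨G b ⟨k - 1, by omega⟩,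
          G_mem_par (by rw [blk_of_lt (mem_fstBlk.1 hb), blk_of_lt hlt])⟩,
        - t b, Submodule.neg_mem _ (ht b), neg_ne_zero.2 hb0, ?_⟩
      rw [Finset.smul_sum, Finset.sum_congr rfl fun c hc =>
        G_smul_wvM (mem_fstBlk.1 hb) hlt (mem_fstBlk.1 hc) hne (mem_halfSpin.1 (ht c)).1,
        Finset.sum_ite_eq', if_pos hb, map_neg]
    · push Not at hb
      have h2 : ∑ c ∈ fstBlk n k, wvM n k c (t c) =
          wvM n k ⟨k - 1, by omega⟩ (t ⟨k - 1, by omega⟩) := by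
        rw [Finset.sum_eq_single ⟨k - 1, by omega⟩]
        · intro b hb1 hb2
          rw [hb b hb1 hb2, map_zero]
        · intro h1
          exact absurd (mem_fstBlk.2 hlt) h1
      refine ⟨1, t ⟨k - 1, by omega⟩, ht _, ?_, by rw [one_smul, h2]⟩
      intro h3
      rw [h2, h3, map_zero] at ha
      exact ha rfl
  obtain ⟨v, s, hs, hs0, hv⟩ := key
  obtain ⟨u, hu⟩ := vac_mem_of_smul hn (!ε) (wvM n k ⟨k - 1, by omega⟩)
    (fun a b ha hb s hs => midG_smul_wvM ha hb hlt hs) hs hs0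
  exact ⟨u * v, by rw [mul_smul, hv, hu]⟩

end OscModule

/-! ### Vectors of degrees `0` and `-1` -/

section LowDegree

variable {n k : ℕ} {M V : Type*} [AddCommGroup M] [Module ℂ M] [Module (Ug n k) M]
  [IsScalarTower ℂ (Ug n k) M] [AddCommGroup V] [Module ℂ V] {θ : V →ₗ[ℂ] M}

/-- The sum of the elements `y_{a,b} ⊗ z_{a,b}`. -/
def degOne (n k : ℕ) {M V : Type*} [AddCommGroup M] [Module ℂ M] [Module (Ug n k) M]
    [AddCommGroup V] [Module ℂ V] (θ : V →ₗ[ℂ] M) (z : Fin (2 * (n + k)) → Fin (2 * (n + k)) → V) : M :=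
  ∑ a ∈ mid n k, ∑ b ∈ fstBlk n k, ιg n k (G a b) • θ (z a b)

/-- The part of the generalized Verma module of degrees `0` and `-1`. -/
def lowDeg (n k : ℕ) {M V : Type*} [AddCommGroup M] [Module ℂ M] [Module (Ug n k) M]
    [IsScalarTower ℂ (Ug n k) M] [AddCommGroup V] [Module ℂ V] (θ : V →ₗ[ℂ] M) : Submodule ℂ M where
  carrier := {x | ∃ v z, x = θ v + degOne n k θ z}
  add_mem' := by
    rintro _ _ ⟨v, z, rfl⟩ ⟨v', z', rfl⟩
    refine ⟨v + v', z + z', ?_⟩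
    simp only [degOne, Pi.add_apply, map_add, smul_add, Finset.sum_add_distrib]
    abel
  zero_mem' := ⟨0, 0, by simp [degOne]⟩
  smul_mem' := by
    rintro c _ ⟨v, z, rfl⟩
    refine ⟨c • v, c • z, ?_⟩
    simp only [degOne, Pi.smul_apply, map_smul, smul_add, Finset.smul_sum]
    congr 1
    refine Finset.sum_congr rfl fun a _ => Finset.sum_congr rfl fun b _ => ?_
    rw [smul_algebra_smul_comm]

theorem mem_lowDeg (v : V) : θ v ∈ lowDeg n k θ :=
  ⟨v, 0, by simp [degOne]⟩

theorem degOne_mem_lowDeg (z : Fin (2 * (n + k)) → Fin (2 * (n + k)) → V) :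
    degOne n k θ z ∈ lowDeg n k θ := ⟨0, z, by rw [map_zero, zero_add]⟩

theorem G_smul_mem_lowDeg {a b : Fin (2 * (n + k))} (ha : a ∈ mid n k) (hb : (b : ℕ) < k)
    (v : V) : ιg n k (G a b) • θ v ∈ lowDeg n k θ := by
  have h : ιg n k (G a b) • θ v =
      degOne n k θ fun c d => if c = a ∧ d = b then v else 0 := by
    rw [degOne, Finset.sum_eq_single a, Finset.sum_eq_single b]
    · simp
    · intro d _ hd
      rw [if_neg fun h => hd h.2, map_zero, smul_zero]
    · intro h
      exact absurd (mem_fstBlk.2 hb) h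
    · intro c _ hc
      refine Finset.sum_eq_zero fun d _ => ?_
      rw [if_neg fun h => hc h.1, map_zero, smul_zero]
    · intro h
      exact absurd ha h
  rw [h]
  exact degOne_mem_lowDeg _

theorem G_rev {m : ℕ} (a b : Fin (2 * m)) : G b.rev a.rev = - G a b := by
  apply Subtype.ext
  ext i j
  change (G b.rev a.rev).1 i j = - (G a b).1 i j
  rw [G_apply, G_apply, Fin.rev_rev, Fin.rev_rev]
  ring

theorem mem_mid_iff_blk {a : Fin (2 * (n + k))} : a ∈ mid n k ↔ blk n k a = 1 := by
  refine ⟨blk_of_mem_mid, fun h => ?_⟩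
  rw [mem_mid]
  unfold blk at h
  split_ifs at h <;> omega

theorem lt_iff_blk {a : Fin (2 * (n + k))} : (a : ℕ) < k ↔ blk n k a = 0 := by
  refine ⟨blk_of_lt, fun h => ?_⟩
  unfold blk at h
  split_ifs at h
  assumption

/-- Only the block position `(2, 0)` has degree `-2`. A position `(2, 1)` is moved to `(1, 0)` by `G
a b = - G b' a'`. -/
theorem G_smul_mem_lowDeg' (hθ : ∀ X ∈ par n k, ∀ v, ∃ v', ιg n k X • θ v = θ v')
    {a b : Fin (2 * (n + k))} (hab : ¬ (blk n k a = 2 ∧ blk n k b = 0))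
    (v : V) : ιg n k (G a b) • θ v ∈ lowDeg n k θ := by
  by_cases h : blk n k a ≤ blk n k b
  · obtain ⟨v', hv'⟩ := hθ _ (G_mem_par h) v
    rw [hv']
    exact mem_lowDeg _
  · have h1 := blk_le_two (n := n) a
    by_cases h2 : blk n k a = 1
    · exact G_smul_mem_lowDeg (mem_mid_iff_blk.2 h2) (lt_iff_blk.2 (by omega)) v
    · have h3 : G a b = - G b.rev a.rev := by rw [G_rev, neg_neg]
      rw [h3, map_neg, neg_smul]
      refine Submodule.neg_mem _ (G_smul_mem_lowDeg (rev_mem_mid.2 (mem_mid_iff_blk.2 ?_))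
        (lt_iff_blk.2 ?_) v)
      · omega
      · rw [blk_rev]
        omega

theorem smul_mem_lowDeg (hθ : ∀ X ∈ par n k, ∀ v, ∃ v', ιg n k X • θ v = θ v')
    {Z : so (n + k)} (hZ : ∀ i j, blk n k i = 2 → blk n k j = 0 → Z.1 i j = 0)
    (v : V) : ιg n k Z • θ v ∈ lowDeg n k θ := by
  rw [so_eq_sum Z]
  simp only [map_smul, map_sum, smul_assoc, Finset.sum_smul]
  refine Submodule.smul_mem _ _ (Submodule.sum_mem _ fun a _ => Submodule.sum_mem _ fun b _ => ?_)
  by_cases h : blk n k a = 2 ∧ blk n k b = 0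
  · rw [hZ a b h.1 h.2, zero_smul]
    exact Submodule.zero_mem _
  · exact Submodule.smul_mem _ _ (G_smul_mem_lowDeg' hθ h v)

theorem ιg_mul_smul {M : Type*} [AddCommGroup M] [Module (Ug n k) M] (X Y : so (n + k)) (x : M) :
    ιg n k X • ιg n k Y • x = ιg n k Y • ιg n k X • x + ιg n k ⁅X, Y⁆ • x := by
  rw [← mul_smul, ιg, ι_mul, add_smul, mul_smul]

theorem lie_G_apply_eq_zero {X : so (n + k)} (hX : X ∈ par n k) {a b : Fin (2 * (n + k))}
    (ha : a ∈ mid n k) {i j : Fin (2 * (n + k))} (hi : blk n k i = 2)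
    (hj : blk n k j = 0) : (⁅X, G a b⁆ : so (n + k)).1 i j = 0 := by
  have hG : ∀ i j : Fin (2 * (n + k)), blk n k i = 2 → blk n k j = 0 → (G a b).1 i j = 0 := by
    intro i j hi hj
    have ha' := mem_mid_iff_blk.1 ha
    rw [G_apply, if_neg, if_neg, sub_zero]
    · rintro ⟨_, rfl⟩
      rw [blk_rev, ha'] at hj
      omega
    · rintro ⟨rfl, _⟩
      omega
  rw [LieSubalgebra.coe_bracket, Ring.lie_def, Matrix.sub_apply, Matrix.mul_apply,
    Matrix.mul_apply, Finset.sum_eq_zero, Finset.sum_eq_zero, sub_zero]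
  · intro c _
    by_cases hc : blk n k c = 0
    · rw [hG i c hi hc, zero_mul]
    · rw [hX c j (by omega), mul_zero]
  · intro c _
    by_cases hc : blk n k c = 2
    · rw [hG c j hc hj, mul_zero]
    · have := blk_le_two (n := n) c
      rw [hX i c (by omega), zero_mul]

theorem ιg_smul_mem_lowDeg (hθ : ∀ X ∈ par n k, ∀ v, ∃ v', ιg n k X • θ v = θ v')
    {X : so (n + k)} (hX : X ∈ par n k) {x : M}
    (hx : x ∈ lowDeg n k θ) : ιg n k X • x ∈ lowDeg n k θ := by
  have hpar : ∀ v, ιg n k X • θ v ∈ lowDeg n k θ := fun v => by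
    obtain ⟨v', hv'⟩ := hθ X hX v
    rw [hv']
    exact mem_lowDeg v'
  obtain ⟨v, z, rfl⟩ := hx
  rw [smul_add, degOne, Finset.smul_sum]
  refine Submodule.add_mem _ (hpar v) (Submodule.sum_mem _ fun a ha => ?_)
  rw [Finset.smul_sum]
  refine Submodule.sum_mem _ fun b hb => ?_
  rw [mem_fstBlk] at hb
  obtain ⟨v', hv'⟩ := hθ X hX (z a b)
  rw [ιg_mul_smul, hv']
  exact Submodule.add_mem _ (G_smul_mem_lowDeg ha hb _)
    (smul_mem_lowDeg hθ (fun i j hi hj => lie_G_apply_eq_zero hX ha hi hj) _)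

theorem incl_smul_mem_lowDeg (hθ : ∀ X ∈ par n k, ∀ v, ∃ v', ιg n k X • θ v = θ v')
    (a : Up n k) {x : M} (hx : x ∈ lowDeg n k θ) :
    incl n k a • x ∈ lowDeg n k θ := by
  let _ : Module (Up n k) M := Module.compHom _ (incl n k).toRingHom
  have hdef : ∀ (a : Up n k) (x : M), a • x = incl n k a • x := fun _ _ => rfl
  have _ : IsScalarTower ℂ (Up n k) M :=
    ⟨fun c a x => by rw [hdef, hdef, map_smul, smul_assoc]⟩
  rw [← hdef]
  refine smul_mem_of_ι (L := par n k) (fun X y hy => ?_) a hx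
  rw [hdef]
  change incl n k (ιp n k X) • y ∈ _
  rw [incl_ιp]
  exact ιg_smul_mem_lowDeg hθ X.2 hy

end LowDegree

/-! ### Comparison with the oscillator module in degrees `0` and `-1` -/

section Realization

/-- A realization in the oscillator module of the vectors `θ v` that generate a `U(𝔤)`-module. -/
structure OscRealization (n k : ℕ) {M V : Type*} [AddCommGroup M] [Module ℂ M]
    [Module (Ug n k) M] [AddCommGroup V] [Module ℂ V] (ε : Bool) (θ : V →ₗ[ℂ] M) where
  par_smul : ∀ X ∈ par n k, ∀ v, ∃ v', ιg n k X • θ v = θ v'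
  gen : ∀ C : Submodule ℂ M, (∀ (u : Ug n k) v, u • θ v ∈ C) → ∀ x, x ∈ C
  toFun : M →ₗ[Ug n k] OscM n k
  toFun_θ : ∀ v, ∃ s ∈ halfSpin n k ε, toFun (θ v) = ket n k s
  eq_zero : ∀ v, toFun (θ v) = 0 → θ v = 0

variable {n k : ℕ} {M V : Type*} [AddCommGroup M] [Module ℂ M] [Module (Ug n k) M]
  [AddCommGroup V] [Module ℂ V] {θ : V →ₗ[ℂ] M}

theorem ιg_G_smul_ket (a b : Fin (2 * (n + k))) (s : Spinor (n + k)) :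
    ιg n k (G a b) • ket n k s = (osc n k).rho (G a b) (emb n k 1 s) := ιg_smul _ _

theorem OscRealization.toFun_degOne {ε : Bool} (F : OscRealization n k ε θ)
    (z : Fin (2 * (n + k)) → Fin (2 * (n + k)) → V) :
    ∃ s : Fin (2 * (n + k)) → Fin (2 * (n + k)) → Spinor (n + k),
      (∀ a b, s a b ∈ halfSpin n k ε ∧ F.toFun (θ (z a b)) = ket n k (s a b)) ∧
      F.toFun (degOne n k θ z) = ∑ a ∈ mid n k, ∑ b ∈ fstBlk n k, ιg n k (G a b) • ket n k (s a b) := by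
  choose t ht ht' using F.toFun_θ
  refine ⟨fun a b => t (z a b), fun a b => ⟨ht _, ht' _⟩, ?_⟩
  rw [degOne, map_sum]
  refine Finset.sum_congr rfl fun a _ => ?_
  rw [map_sum]
  refine Finset.sum_congr rfl fun b _ => ?_
  rw [map_smul, ht']

theorem OscRealization.ext {ε : Bool} (F : OscRealization n k ε θ) {v v' : V}
    (h : F.toFun (θ v) = F.toFun (θ v')) : θ v = θ v' := by
  rw [← sub_eq_zero, ← map_sub]
  apply F.eq_zero
  rw [map_sub, map_sub, h, sub_self]

variable [IsScalarTower ℂ (Ug n k) M]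

/-- By `oscCoeff_sum` the image of each `θ (z a b)` is zero, so these vectors vanish, and then `θ v`
does. Injectivity beyond degree `-1` is never needed. -/
theorem OscRealization.eq_zero_of_mem_lowDeg (hn : 2 ≤ n) {ε : Bool} (F : OscRealization n k ε θ)
    {x : M} (hx : x ∈ lowDeg n k θ) (h0 : F.toFun x = 0) : x = 0 := by
  obtain ⟨v, z, rfl⟩ := hx
  obtain ⟨s, hs, hsum⟩ := F.toFun_degOne z
  obtain ⟨t, _, ht⟩ := F.toFun_θ v
  rw [map_add, ht, hsum] at h0
  have h2 : ∀ a ∈ mid n k, ∀ b ∈ fstBlk n k, θ (z a b) = 0 := by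
    intro a ha b hb
    have h3 := oscCoeff_sum (n := n) (k := k) ⟨0, by omega⟩ s t ha (mem_fstBlk.1 hb)
    have h4 : (emb n k 1 t + ∑ a ∈ mid n k, ∑ b ∈ fstBlk n k,
        (osc n k).rho (G a b) (emb n k 1 (s a b)) : Osc n k) = 0 := by
      simp only [ιg_G_smul_ket] at h0
      exact h0
    rw [h4, map_zero] at h3
    apply F.eq_zero
    rw [(hs a b).2, ← h3, map_zero]
  have h3 : degOne n k θ z = 0 := Finset.sum_eq_zero fun a ha => Finset.sum_eq_zero fun b hb => by
    rw [h2 a ha b hb, smul_zero]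
  have h5 : F.toFun (θ v) = 0 := by
    rw [ht, ← h0, ← hsum, h3, map_zero, add_zero]
  rw [F.eq_zero v h5, h3, add_zero]

end Realization

/-! ### The grading element -/

section Euler

variable {n k : ℕ}

theorem one_sub_blk_rev (i : Fin (2 * (n + k))) :
    (1 - (blk n k i.rev : ℂ)) = - (1 - (blk n k i : ℂ)) := by
  rw [blk_rev, Nat.cast_sub (blk_le_two i)]
  push_cast
  ring

/-- The diagonal matrix that defines the grading. -/
def euler (n k : ℕ) : so (n + k) := dg (fun i => 1 - (blk n k i : ℂ)) one_sub_blk_rev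

theorem isCartan_euler : IsCartan (euler n k) := isCartan_dg _ _

theorem euler_apply (a : Fin (2 * (n + k))) : (euler n k).1 a a = 1 - (blk n k a : ℂ) :=
  Matrix.diagonal_apply_eq _ a

theorem euler_lie_G (a b : Fin (2 * (n + k))) :
    ⁅euler n k, G a b⁆ = ((blk n k b : ℂ) - blk n k a) • G a b := by
  rw [euler, dg_lie_G]
  congr 1
  ring

theorem spin_rho_euler {s : Spinor (n + k)} (hs : s ∈ midSpinor n k) :
    (spinOsc _).rho (euler n k) s =
      (∑ a : Fin (2 * (n + k)), if (a : ℕ) < k then (1 / 2 : ℂ) else 0) • s := by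
  rw [spin_rho_isCartan isCartan_euler, Finset.sum_smul]
  refine Finset.sum_congr rfl fun a _ => ?_
  rw [euler_apply]
  split_ifs with h1
  · rw [cliff_cliff, mem_midSpinor.1 hs a h1, if_pos rfl, map_zero, neg_zero, zero_add,
      blk_of_lt h1, Nat.cast_zero, sub_zero, one_smul]
  · by_cases h2 : a ∈ mid n k
    · rw [blk_of_mem_mid h2, Nat.cast_one, sub_self, zero_smul, zero_smul]
    · rw [mem_mid] at h2
      have h3 := a.isLt
      rw [mem_midSpinor.1 hs a.rev (by rw [Fin.val_rev]; omega), map_zero, smul_zero, smul_zero,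
        zero_smul]

theorem euler_mem_par : euler n k ∈ par n k := mem_par_of_isCartan isCartan_euler

/-- The grading element acts on all middle spinors by one scalar, which the highest weight vector
identifies. -/
theorem euler_smul_ket (hn : 2 ≤ n) {lam : Fin (n + k) → ℂ} {ε : Bool}
    (h : lam + delta (n + k) = oddWt n k 1 (sg ε)) {s : Spinor (n + k)} (hs : s ∈ midSpinor n k) :
    ιg n k (euler n k) • ket n k s = wtEval lam (euler n k) • ket n k s := by
  have key : ∃ c : ℂ, ∀ s ∈ midSpinor n k, ιg n k (euler n k) • ket n k s = c • ket n k s := by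
    refine ⟨(∑ a : Fin (2 * (n + k)), if (a : ℕ) < k then (1 / 2 : ℂ) else 0) -
      n * trk n k (euler n k), fun s hs => ?_⟩
    have h1 := ιp_smul_ket ⟨euler n k, euler_mem_par⟩ s
    rw [Up_smul_def, incl_ιp] at h1
    rw [h1, spin_rho_euler hs, map_smul, ← sub_smul]
  obtain ⟨c, hc⟩ := key
  have h1 := (isHW_ket hn h).2 ⟨euler n k, euler_mem_par⟩ isCartan_euler
  rw [Up_smul_def, incl_ιp, hc _ (vac_mem_midSpinor hn ε)] at h1
  rw [hc s hs]
  refine congrArg (· • ket n k s) (smul_left_injective ℂ ?_ h1)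
  rw [Ne, map_eq_zero_iff _ ket_injective]
  exact vac_ne_zero ε

theorem wtEval_euler (hn : 2 ≤ n) (hk : 1 ≤ k) {lam mu : Fin (n + k) → ℂ} {ε : Bool}
    (h : lam + delta (n + k) = oddWt n k 1 (sg ε))
    (h' : mu + delta (n + k) = oddWt n k (-1) (sg (!ε))) :
    wtEval mu (euler n k) = wtEval lam (euler n k) - 1 := by
  have hm : 1 ≤ n + k := by omega
  have h1 : pI hm true ∈ mid n k := by
    rw [mem_mid]
    simp [pI]
    omega
  rw [wtEval_sub_of_oddWt hn hk hm h h', euler_apply, euler_apply, blk_of_mem_mid h1,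
    blk_of_lt (a := ⟨k - 1, by omega⟩) (by change k - 1 < k; omega)]
  simp

theorem span_G_par : Submodule.span ℂ
    ({X | ∃ a b, blk n k b < blk n k a ∧ X = G a b} ∪ {X | X ∈ par n k}) = ⊤ := by
  refine eq_top_iff.2 fun X _ => ?_
  rw [so_eq_sum X]
  refine Submodule.smul_mem _ _ (Submodule.sum_mem _ fun a _ => Submodule.sum_mem _ fun b _ =>
    Submodule.smul_mem _ _ (Submodule.subset_span ?_))
  rcases lt_or_ge (blk n k b) (blk n k a) with h | h
  · exact Or.inl ⟨a, b, h, rfl⟩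
  · exact Or.inr (G_mem_par h)

variable {M V : Type*} [AddCommGroup M] [Module ℂ M] [Module (Ug n k) M]
  [IsScalarTower ℂ (Ug n k) M] [AddCommGroup V] [Module ℂ V] {θ : V →ₗ[ℂ] M}

theorem OscRealization.toFun_smul {ε : Bool} (F : OscRealization n k ε θ) (c : ℂ) (x : M) :
    F.toFun (c • x) = c • F.toFun x := by
  rw [← algebraMap_smul (Ug n k) c x, map_smul, algebraMap_smul]

theorem OscRealization.euler_smul (hn : 2 ≤ n) {lam : Fin (n + k) → ℂ} {ε : Bool}
    (h : lam + delta (n + k) = oddWt n k 1 (sg ε)) (F : OscRealization n k ε θ) (v : V) :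
    θ v ∈ wtSpace M (euler n k) (wtEval lam (euler n k)) := by
  rw [mem_wtSpace]
  change ιg n k (euler n k) • θ v = _
  obtain ⟨v', hv'⟩ := F.par_smul _ euler_mem_par v
  obtain ⟨s, hs, hsv⟩ := F.toFun_θ v
  rw [hv', ← map_smul]
  apply F.ext
  rw [← hv', map_smul, hsv, map_smul θ, F.toFun_smul, hsv,
    euler_smul_ket hn h (mem_halfSpin.1 hs).1]

theorem G_smul_mem_wtSpace {a b : Fin (2 * (n + k))} {c : ℂ} {x : M}
    (hx : x ∈ wtSpace M (euler n k) c) {d : ℕ} (hd : blk n k a = blk n k b + d) :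
    ιg n k (G a b) • x ∈ wtSpace M (euler n k) (c - d) := by
  have h := ι_smul_mem_wtSpace (euler_lie_G a b) hx
  rw [hd, Nat.cast_add, sub_add_cancel_left, ← sub_eq_add_neg] at h
  exact h

theorem OscRealization.degOne_mem_wtSpace (hn : 2 ≤ n) {lam : Fin (n + k) → ℂ} {ε : Bool}
    (h : lam + delta (n + k) = oddWt n k 1 (sg ε)) (F : OscRealization n k ε θ)
    (z : Fin (2 * (n + k)) → Fin (2 * (n + k)) → V) :
    degOne n k θ z ∈ wtSpace M (euler n k) (wtEval lam (euler n k) - (1 : ℕ)) :=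
  Submodule.sum_mem _ fun a ha => Submodule.sum_mem _ fun b hb =>
    G_smul_mem_wtSpace (F.euler_smul hn h _)
      (by rw [blk_of_mem_mid ha, blk_of_lt (mem_fstBlk.1 hb)])

/-- By `smul_mem_of_span` only stability under the lower block root vectors matters: these have
degree `-1` or `-2`, so they send degree `0` into degrees `-1` and `-2`, and everything else into
degrees at most `-2`. -/
theorem OscRealization.mem_sup (hn : 2 ≤ n) {lam : Fin (n + k) → ℂ} {ε : Bool}
    (h : lam + delta (n + k) = oddWt n k 1 (sg ε)) (F : OscRealization n k ε θ) (x : M) :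
    x ∈ lowDeg n k θ ⊔ ⨆ j : ℕ, wtSpace M (euler n k) (wtEval lam (euler n k) - (j + 2 : ℕ)) := by
  set e := wtEval lam (euler n k)
  set D : Submodule ℂ M := ⨆ j : ℕ, wtSpace M (euler n k) (e - (j + 2 : ℕ)) with hD
  have hjD : ∀ (j : ℕ), 2 ≤ j → ∀ x ∈ wtSpace M (euler n k) (e - j), x ∈ D := by
    intro j hj x hx
    obtain ⟨j, rfl⟩ := Nat.exists_eq_add_of_le' hj
    exact Submodule.mem_iSup_of_mem j hx
  have hstep : ∀ (a b : Fin (2 * (n + k))) (j d : ℕ) (x : M),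
      x ∈ wtSpace M (euler n k) (e - j) → blk n k a = blk n k b + d → 2 ≤ j + d →
      ιg n k (G a b) • x ∈ D := by
    intro a b j d x hx hd hjd
    refine hjD (j + d) hjd _ ?_
    have := G_smul_mem_wtSpace hx hd
    rwa [sub_sub, ← Nat.cast_add] at this
  refine F.gen (lowDeg n k θ ⊔ D) (fun u v => ?_) x
  refine smul_mem_of_span (L := so (n + k)) _ _ span_G_par (LinearMap.range θ) _ ?_ ?_ ?_ u ⟨v, rfl⟩
  · rintro _ ⟨v, rfl⟩
    exact Submodule.mem_sup_left (mem_lowDeg v)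
  · rintro _ ⟨a, b, hab, rfl⟩ x hx
    obtain ⟨d, hd⟩ := Nat.exists_eq_add_of_lt hab
    rw [add_assoc] at hd
    obtain ⟨y, ⟨v, z, rfl⟩, r, hr, rfl⟩ := Submodule.mem_sup.1 hx
    change ιg n k (G a b) • _ ∈ _
    rw [smul_add, smul_add]
    refine Submodule.add_mem _ (Submodule.add_mem _ ?_ (Submodule.mem_sup_right ?_))
      (Submodule.mem_sup_right ?_)
    · by_cases hab' : blk n k a = 2 ∧ blk n k b = 0
      · refine Submodule.mem_sup_right (hstep a b 0 (d + 1) _ ?_ hd (by omega))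
        rw [Nat.cast_zero, sub_zero]
        exact F.euler_smul hn h v
      · exact Submodule.mem_sup_left (G_smul_mem_lowDeg' F.par_smul hab' v)
    · exact hstep a b 1 (d + 1) _ (F.degOne_mem_wtSpace hn h z) hd (by omega)
    · clear hx
      induction hr using Submodule.iSup_induction' with
      | mem j y hy => exact hstep a b _ (d + 1) _ hy hd (by omega)
      | zero => rw [smul_zero]; exact Submodule.zero_mem _
      | add y y' _ _ hy hy' => rw [smul_add]; exact Submodule.add_mem _ hy hy'
  · rintro X hX _ ⟨v, rfl⟩
    obtain ⟨v', hv'⟩ := F.par_smul X hX v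
    exact ⟨v', hv'.symm⟩

theorem OscRealization.exists_eq_degOne (hn : 2 ≤ n) {lam : Fin (n + k) → ℂ} {ε : Bool}
    (h : lam + delta (n + k) = oddWt n k 1 (sg ε)) (F : OscRealization n k ε θ) {x : M}
    (hx : ιg n k (euler n k) • x = (wtEval lam (euler n k) - 1) • x) :
    ∃ z, x = degOne n k θ z := by
  obtain ⟨y, ⟨v, z, rfl⟩, r, hr, hxr⟩ := Submodule.mem_sup.1 (F.mem_sup hn h x)
  refine ⟨z, sub_eq_zero.1 ?_⟩
  have hz := F.degOne_mem_wtSpace hn h z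
  rw [Nat.cast_one] at hz
  refine eq_zero_of_mem_wtSpace (h := euler n k) (c := wtEval lam (euler n k) - 1)
    -- This family lists the degrees `0, -2, -3, …`, leaving out `-1`.
    (fun j : ℕ => wtEval lam (euler n k) - (if j = 0 then 0 else j + 1 : ℕ)) (fun j hj => ?_)
    (Submodule.sub_mem _ hx hz) ?_
  · have h1 := sub_right_injective hj
    norm_cast at h1
    split_ifs at h1
    omega
  · have h2 : x - degOne n k θ z = θ v + r := by
      rw [← hxr]
      abel
    rw [h2]
    refine Submodule.add_mem _ (Submodule.mem_iSup_of_mem 0 ?_) ?_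
    · rw [if_pos rfl, Nat.cast_zero, sub_zero]
      exact F.euler_smul hn h v
    · have hle : ⨆ j : ℕ, wtSpace M (euler n k) (wtEval lam (euler n k) - (j + 2 : ℕ)) ≤
          ⨆ j : ℕ, wtSpace M (euler n k)
            (wtEval lam (euler n k) - (if j = 0 then 0 else j + 1 : ℕ)) :=
        iSup_le fun j => le_iSup_of_le (j + 1) (by rw [if_neg (Nat.succ_ne_zero j)])
      exact hle hr

end Euler

/-! ### Uniqueness of the extremal vectors of degree `-1` -/

section Uniqueness

variable {n k : ℕ}

theorem coe_G {m : ℕ} (a b : Fin (2 * m)) :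
    (G a b).1 = Matrix.single a b 1 - Matrix.single b.rev a.rev 1 := by
  ext i j
  rw [G_apply, Matrix.sub_apply, Matrix.single_apply, Matrix.single_apply]
  simp only [eq_comm]

theorem G_lie_G {a b c d : Fin (2 * (n + k))} (ha : a ∈ mid n k) (hb : (b : ℕ) < k)
    (hc : (c : ℕ) < k) (hd : d ∈ mid n k) :
    ⁅G c d, G a b⁆ = (if d = a then G c b else 0) - if b = c then G a d else 0 := by
  rw [mem_mid] at ha hd
  have h1 : d ≠ b.rev := fun h => by
    rw [Fin.ext_iff, Fin.val_rev] at h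
    omega
  have h2 : a.rev ≠ c := fun h => by
    rw [Fin.ext_iff, Fin.val_rev] at h
    omega
  have h3 : c.rev ≠ a := fun h => h2 (by rw [← h, Fin.rev_rev])
  have h4 : b ≠ d.rev := fun h => h1 (by rw [h, Fin.rev_rev])
  apply Subtype.ext
  rw [LieSubalgebra.coe_bracket, Ring.lie_def, coe_G, coe_G]
  by_cases hda : d = a
  · by_cases hbc : b = c
    · subst hda hbc
      simp [sub_mul, mul_sub, h1, h2, h3, h4, coe_G]
      abel
    · have hbc' : c.rev ≠ b.rev := fun h => hbc (Fin.rev_injective h).symm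
      subst hda
      simp [sub_mul, mul_sub, h1, h2, h3, h4, hbc, hbc', coe_G]
  · have hda' : a.rev ≠ d.rev := fun h => hda (Fin.rev_injective h).symm
    by_cases hbc : b = c
    · subst hbc
      simp [sub_mul, mul_sub, h1, h2, h3, h4, hda, hda', coe_G]
    · have hbc' : c.rev ≠ b.rev := fun h => hbc (Fin.rev_injective h).symm
      simp [sub_mul, mul_sub, h1, h2, h3, h4, hda, hda', hbc, hbc']

theorem ιg_smul_ket {X : so (n + k)} (hX : X ∈ par n k) (s : Spinor (n + k)) :
    ιg n k X • ket n k s = ket n k ((spinOsc _).rho X s) - (n * trk n k X) • ket n k s := by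
  rw [← ιp_smul_ket ⟨X, hX⟩, Up_smul_def, incl_ιp]

theorem trk_G_eq_zero {a b : Fin (2 * (n + k))} (hab : a ≠ b) : trk n k (G a b) = 0 :=
  Finset.sum_eq_zero fun c _ => by
    rw [G_apply, if_neg, if_neg, sub_zero]
    · rintro ⟨h, h'⟩
      exact hab (Fin.rev_injective (h'.symm.trans h))
    · rintro ⟨h, h'⟩
      exact hab (h.symm.trans h')

theorem trk_G_self {b : Fin (2 * (n + k))} (hb : (b : ℕ) < k) : trk n k (G b b) = 1 := by
  have hbr : ∀ a : Fin (2 * (n + k)), (a : ℕ) < k → a ≠ b.rev := by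
    intro a ha h
    rw [h, Fin.val_rev] at ha
    omega
  rw [trk, Finset.sum_eq_single b]
  · rw [G_apply, if_pos ⟨rfl, rfl⟩, if_neg fun h => hbr b hb h.1, sub_zero]
  · intro a ha h
    rw [G_apply, if_neg fun h' => h h'.1, if_neg fun h' => hbr a (mem_fstBlk.1 ha) h'.1, sub_zero]
  · intro h
    exact absurd (mem_fstBlk.2 hb) h

theorem spin_rho_G_of_lt {b c : Fin (2 * (n + k))} (hc : (c : ℕ) < k) {s : Spinor (n + k)}
    (hs : s ∈ midSpinor n k) :
    (spinOsc _).rho (G c b) s = if c = b then (1 / 2 : ℂ) • s else 0 := by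
  rw [spin_rho_G, cliff_cliff, mem_midSpinor.1 hs c hc, map_zero, neg_zero, zero_add]
  by_cases h : c = b
  · rw [if_pos (by rw [h]), if_pos h]
    module
  · rw [if_neg fun h' => h (Fin.rev_injective h').symm, if_neg h, sub_zero]

theorem G_smul_ket_of_lt {b c : Fin (2 * (n + k))} (hb : (b : ℕ) < k) (hc : (c : ℕ) < k)
    {s : Spinor (n + k)} (hs : s ∈ midSpinor n k) :
    ιg n k (G c b) • ket n k s = if b = c then (1 / 2 - n : ℂ) • ket n k s else 0 := by
  rw [ιg_smul_ket (G_mem_par (by rw [blk_of_lt hb, blk_of_lt hc])), spin_rho_G_of_lt hc hs]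
  by_cases h : b = c
  · rw [if_pos h, if_pos h.symm, h, trk_G_self hc, map_smul]
    module
  · rw [if_neg h, if_neg (Ne.symm h), trk_G_eq_zero (Ne.symm h), map_zero, mul_zero, zero_smul,
      sub_zero]

/-- `G c d` has positive degree and kills `1 ⊗ s`, so only the commutator `G_lie_G` contributes. The
constant `1 - n` is `1/2 - n` from `G c b` with `b = c` plus `1/2` from the spin action of `G a d`
with `a = d`. -/
theorem G_smul_G_smul_ket {a b c d : Fin (2 * (n + k))} (ha : a ∈ mid n k) (hb : (b : ℕ) < k)
    (hc : (c : ℕ) < k) (hd : d ∈ mid n k) {s : Spinor (n + k)} (hs : s ∈ midSpinor n k) :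
    ιg n k (G c d) • ιg n k (G a b) • ket n k s =
      if b = c then ket n k ((if a = d then (1 - n : ℂ) • s else 0) - cliff ℂ a (cliff ℂ d.rev s))
      else 0 := by
  have hcd : c ≠ d := fun h => by
    rw [mem_mid, ← h] at hd
    omega
  rw [ιg_mul_smul, ιg_smul_ket (G_mem_par (by rw [blk_of_lt hc, blk_of_mem_mid hd]; omega)),
    spin_rho_G_of_lt hc hs, if_neg hcd, trk_G_eq_zero hcd, map_zero, mul_zero, zero_smul, sub_zero,
    smul_zero, zero_add, G_lie_G ha hb hc hd, map_sub, sub_smul]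
  have h1 : ιg n k (if d = a then G c b else 0) • ket n k s =
      if b = c then ket n k (if a = d then (1 / 2 - n : ℂ) • s else 0) else 0 := by
    by_cases h : d = a
    · rw [if_pos h, if_pos h.symm, G_smul_ket_of_lt hb hc hs, map_smul]
    · rw [if_neg h, if_neg (Ne.symm h), map_zero, map_zero, zero_smul, ite_self]
  have h2 : ιg n k (if b = c then G a d else 0) • ket n k s =
      if b = c then ket n k (cliff ℂ a (cliff ℂ d.rev s) - if a = d then (1 / 2 : ℂ) • s else 0)
        else 0 := by
    by_cases h : b = c
    · rw [if_pos h, if_pos h, ← midG_smul_ket ha hd, Up_smul_def, incl_ιp]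
      rfl
    · rw [if_neg h, if_neg h, map_zero, zero_smul]
  rw [h1, h2]
  by_cases h : b = c
  · rw [if_pos h, if_pos h, if_pos h, ← map_sub]
    congr 1
    split_ifs <;> module
  · rw [if_neg h, if_neg h, if_neg h, sub_zero]

/-- Annihilation by `G c d` reads `(1 - n) s_{dc} = ∑_a γ_a γ_{d'} s_{ac}`; moving `γ_{d'}` to the
left costs one term `s_{dc}`, which cancels the `1`. -/
theorem cliff_of_extremal {s : Fin (2 * (n + k)) → Fin (2 * (n + k)) → Spinor (n + k)}
    (hs : ∀ a b, s a b ∈ midSpinor n k)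
    (h : ∀ X : so (n + k), IsPos X →
      ιg n k X • ∑ a ∈ mid n k, ∑ b ∈ fstBlk n k, ιg n k (G a b) • ket n k (s a b) = 0)
    {c d : Fin (2 * (n + k))} (hc : (c : ℕ) < k) (hd : d ∈ mid n k) :
    (n : ℂ) • s d c = cliff ℂ d.rev (∑ a ∈ mid n k, cliff ℂ a (s a c)) := by
  have hpos : IsPos (G c d) := by
    rw [mem_mid] at hd
    intro i j hij
    rw [Fin.le_def] at hij
    rw [G_apply, if_neg, if_neg, sub_zero]
    · rintro ⟨rfl, rfl⟩
      rw [Fin.val_rev, Fin.val_rev] at hij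
      omega
    · rintro ⟨rfl, rfl⟩
      omega
  have h1 := h _ hpos
  simp only [Finset.smul_sum] at h1
  rw [Finset.sum_congr rfl fun a ha => by
    rw [Finset.sum_congr rfl fun b hb => G_smul_G_smul_ket ha (mem_fstBlk.1 hb) hc hd (hs a b),
      Finset.sum_ite_eq', if_pos (mem_fstBlk.2 hc)], ← map_sum, map_eq_zero_iff _ ket_injective,
    Finset.sum_sub_distrib, Finset.sum_ite_eq', if_pos hd] at h1
  have hrev : ∀ a : Fin (2 * (n + k)),
      (if d.rev = a.rev then s a c else 0) = if d = a then s a c else 0 := fun a =>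
    if_congr Fin.rev_injective.eq_iff rfl rfl
  have h2 : ∑ a ∈ mid n k, cliff ℂ a (cliff ℂ d.rev (s a c)) =
      s d c - cliff ℂ d.rev (∑ a ∈ mid n k, cliff ℂ a (s a c)) := by
    rw [map_sum, Finset.sum_congr rfl fun a _ => by
      rw [cliff_cliff a d.rev, neg_add_eq_sub, hrev],
      Finset.sum_sub_distrib, Finset.sum_ite_eq, if_pos hd]
  rw [h2] at h1
  have h3 : (n : ℂ) • s d c = cliff ℂ d.rev (∑ a ∈ mid n k, cliff ℂ a (s a c)) -
      ((1 - n : ℂ) • s d c - (s d c - cliff ℂ d.rev (∑ a ∈ mid n k, cliff ℂ a (s a c)))) := by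
    module
  rw [h3, h1, sub_zero]

theorem wvM_apply (b : Fin (2 * (n + k))) (s : Spinor (n + k)) :
    wvM n k b s = ∑ a ∈ mid n k, ιg n k (G a b) • ket n k (cliff ℂ a.rev s) := by
  simp only [ιg_G_smul_ket]
  exact wv_apply b s

/-- The coefficients `γ_{a'} t_b` all vanish, and `∑ γ_a γ_{a'} t_b = n t_b`. -/
theorem eq_zero_of_sum_wvM (hn : 2 ≤ n) {t : Fin (2 * (n + k)) → Spinor (n + k)}
    (h : ∑ b ∈ fstBlk n k, wvM n k b (t b) = 0) {b : Fin (2 * (n + k))} (hb : (b : ℕ) < k) :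
    t b = 0 := by
  have h1 : ∀ a ∈ mid n k, cliff ℂ a.rev (t b) = 0 := by
    intro a ha
    have h2 := oscCoeff_sum (n := n) (k := k) ⟨0, by omega⟩
      (fun a c => cliff ℂ a.rev (t c)) 0 ha hb
    have h3 : (∑ a ∈ mid n k, ∑ c ∈ fstBlk n k,
        (osc n k).rho (G a c) (emb n k 1 (cliff ℂ a.rev (t c))) : Osc n k) = 0 := by
      rw [Finset.sum_comm]
      refine Eq.trans ?_ h
      exact Finset.sum_congr rfl fun c _ => (wv_apply c _).symm
    rw [h3, map_zero, zero_add, map_zero] at h2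
    exact h2.symm
  have h2 := sum_cliff_cliff (n := n) (t b)
  rw [Finset.sum_eq_zero fun a ha => by rw [h1 a ha, map_zero]] at h2
  exact (smul_eq_zero.1 h2.symm).resolve_left (Nat.cast_ne_zero.2 (by omega))

theorem eq_smul_wvM_of_extremal (hn : 2 ≤ n) (hk : 1 ≤ k) {lam mu : Fin (n + k) → ℂ} {ε : Bool}
    (h : lam + delta (n + k) = oddWt n k 1 (sg ε))
    (h' : mu + delta (n + k) = oddWt n k (-1) (sg (!ε)))
    {s : Fin (2 * (n + k)) → Fin (2 * (n + k)) → Spinor (n + k)}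
    (hs : ∀ a b, s a b ∈ midSpinor n k) {x : OscM n k}
    (hx : x = ∑ a ∈ mid n k, ∑ b ∈ fstBlk n k, ιg n k (G a b) • ket n k (s a b))
    (hpos : ∀ X : so (n + k), IsPos X → ιg n k X • x = 0)
    (hH : ∀ H : so (n + k), IsCartan H → ιg n k H • x = wtEval mu H • x) :
    ∃ c : ℂ, x = c • wvM n k ⟨k - 1, by omega⟩ (vac (n + k) (!ε)) := by
  have hm : 1 ≤ n + k := by omega
  have hn0 : (n : ℂ) ≠ 0 := Nat.cast_ne_zero.2 (by omega)
  have hlt : ((⟨k - 1, by omega⟩ : Fin (2 * (n + k))) : ℕ) < k := by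
    change k - 1 < k
    omega
  set e : Fin (2 * (n + k)) := ⟨k - 1, by omega⟩ with he
  -- With this choice `cliff_of_extremal` says `s a b = γ_{a'} (q b)`, which turns `x` into `∑ wvM b
  -- (q b)`.
  let q : Fin (2 * (n + k)) → Spinor (n + k) := fun b =>
    (n : ℂ)⁻¹ • ∑ a ∈ mid n k, cliff ℂ a (s a b)
  have hq : ∀ b, q b ∈ midSpinor n k := fun b =>
    Submodule.smul_mem _ _ (Submodule.sum_mem _ fun a ha => cliff_mem_midSpinor ha (hs a b))
  have hsq : ∀ a ∈ mid n k, ∀ b : Fin (2 * (n + k)), (b : ℕ) < k → s a b = cliff ℂ a.rev (q b) := by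
    intro a ha b hb
    rw [map_smul, ← cliff_of_extremal hs (hx ▸ hpos) hb ha, smul_smul, inv_mul_cancel₀ hn0,
      one_smul]
  clear_value q
  have hxq : x = ∑ b ∈ fstBlk n k, wvM n k b (q b) := by
    rw [hx, Finset.sum_comm]
    refine Finset.sum_congr rfl fun b hb => ?_
    rw [wvM_apply]
    exact Finset.sum_congr rfl fun a ha => by rw [hsq a ha b (mem_fstBlk.1 hb)]
  have hwt : ∀ H : so (n + k), IsCartan H → ∀ b : Fin (2 * (n + k)), (b : ℕ) < k →
      (spinOsc _).rho H (q b) = (spinWt (!ε) H + H.1 b b - H.1 e e) • q b := by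
    intro H hHc b hb
    have h1 : ∀ b ∈ fstBlk n k, ιg n k H • wvM n k b (q b) = wvM n k b
        ((spinOsc _).rho H (q b) - (H.1 b b + n * trk n k H) • q b) := by
      intro b hb
      have h2 := ιp_smul_wvM ⟨H, mem_par_of_isCartan hHc⟩ (mem_fstBlk.1 hb) (hq b)
      rw [Up_smul_def, incl_ιp] at h2
      dsimp only at h2
      rw [h2, Finset.sum_eq_single b, map_sub, map_smul]
      · module
      · intro c _ hc
        rw [hHc _ _ hc.symm, zero_smul]
      · intro h1
        exact absurd hb h1
    have h2 := hH H hHc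
    rw [hxq, Finset.smul_sum, Finset.smul_sum, Finset.sum_congr rfl h1, ← sub_eq_zero,
      ← Finset.sum_sub_distrib, Finset.sum_congr rfl fun b _ => by rw [← map_smul, ← map_sub]] at h2
    have h3 := eq_zero_of_sum_wvM hn h2 hb
    rw [wtEval_sub_of_oddWt hn hk hm h h', wtEval_eq_of_oddWt hn h] at h3
    rw [← sub_eq_zero, spinWt_not hm, ← h3]
    module
  -- `G b b` acts on middle spinors by `1/2`, while the weight `μ` would require `1/2 + 1` if `b` is
  -- not row `k`.
  have hb0 : ∀ b : Fin (2 * (n + k)), (b : ℕ) < k → b ≠ e → q b = 0 := by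
    intro b hb hbe
    have hbk : (b : ℕ) + 1 < k := by
      rw [Ne, Fin.ext_iff, he] at hbe
      change ¬ (b : ℕ) = k - 1 at hbe
      omega
    have h1 := hwt _ (isCartan_G b) b hb
    have h2 : ∀ a : Fin (2 * (n + k)), (a : ℕ) < k → a ≠ b.rev := by
      intro a ha h
      rw [h, Fin.val_rev] at ha
      omega
    rw [spin_rho_G_of_lt hb (hq b), if_pos rfl, spinWt_G _ (by omega), if_neg (by omega), G_apply,
      if_pos ⟨rfl, rfl⟩, if_neg fun h => h2 b hb h.1, G_apply, if_neg fun h => hbe h.1.symm,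
      if_neg fun h => h2 e hlt h.1] at h1
    have h3 : q b = ((1 / 2 * 1 + (1 - 0) - (0 - 0) : ℂ)) • q b - (1 / 2 : ℂ) • q b := by
      module
    rw [h3, ← h1, sub_self]
  have hqe : ∀ H : so (n + k), IsCartan H → (spinOsc _).rho H (q e) = spinWt (!ε) H • q e := by
    intro H hHc
    rw [hwt H hHc e hlt, add_sub_cancel_right]
  refine ⟨q e (vacI (n + k) (!ε)), ?_⟩
  rw [← map_smul, ← eq_smul_vac_of_weight hm (!ε) hqe, hxq]
  refine Finset.sum_eq_single e (fun b hb hbe => ?_) fun h1 => absurd (mem_fstBlk.2 hlt) h1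
  rw [hb0 b (mem_fstBlk.1 hb) hbe, map_zero]

end Uniqueness

/-! ### Transfer of extremal vectors to the generalized Verma module -/

section Extremal

variable {n k : ℕ} {M V : Type*} [AddCommGroup M] [Module ℂ M] [Module (Ug n k) M]
  [IsScalarTower ℂ (Ug n k) M] [AddCommGroup V] [Module ℂ V] {θ : V →ₗ[ℂ] M}

theorem OscRealization.eq_smul_of_extremal (hn : 2 ≤ n) (hk : 1 ≤ k) {lam mu : Fin (n + k) → ℂ}
    {ε : Bool} (h : lam + delta (n + k) = oddWt n k 1 (sg ε))
    (h' : mu + delta (n + k) = oddWt n k (-1) (sg (!ε))) (F : OscRealization n k ε θ) {w : M}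
    (hw : w ∈ lowDeg n k θ)
    (hFw : F.toFun w = wvM n k ⟨k - 1, by omega⟩ (vac (n + k) (!ε))) {x : M}
    (hpos : ∀ X : so (n + k), IsPos X → ιg n k X • x = 0)
    (hH : ∀ H : so (n + k), IsCartan H → ιg n k H • x = wtEval mu H • x) :
    ∃ c : ℂ, x = c • w := by
  have hE := hH _ isCartan_euler
  rw [wtEval_euler hn hk h h'] at hE
  obtain ⟨z, rfl⟩ := F.exists_eq_degOne hn h hE
  obtain ⟨s, hs, hsum⟩ := F.toFun_degOne z
  obtain ⟨c, hc⟩ := eq_smul_wvM_of_extremal hn hk h h' (fun a b => (mem_halfSpin.1 (hs a b).1).1)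
    hsum (fun X hX => by rw [← map_smul, hpos X hX, map_zero])
    (fun H hHc => by rw [← map_smul, hH H hHc, F.toFun_smul])
  refine ⟨c, sub_eq_zero.1 (F.eq_zero_of_mem_lowDeg hn
    (Submodule.sub_mem _ (degOne_mem_lowDeg z) (Submodule.smul_mem _ _ hw)) ?_)⟩
  rw [map_sub, F.toFun_smul, hFw, hc, sub_self]

/-- Degrees `0` and `-1` together are stable under `𝔭`, so the identities may be checked on images
in the oscillator module. -/
theorem OscRealization.extremal (hn : 2 ≤ n) (hk : 1 ≤ k) {lam mu : Fin (n + k) → ℂ}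
    {ε : Bool} (h : lam + delta (n + k) = oddWt n k 1 (sg ε))
    (h' : mu + delta (n + k) = oddWt n k (-1) (sg (!ε))) (F : OscRealization n k ε θ) {w : M}
    (hw : w ∈ lowDeg n k θ)
    (hFw : F.toFun w = wvM n k ⟨k - 1, by omega⟩ (vac (n + k) (!ε))) :
    (∀ X : so (n + k), IsPos X → ιg n k X • w = 0) ∧
      ∀ H : so (n + k), IsCartan H → ιg n k H • w = wtEval mu H • w := by
  have hHW := isHW_wvM hn hk h h'
  refine ⟨fun X hX => ?_, fun H hH => ?_⟩
  · have hXp := mem_par_of_isPos (n := n) (k := k) hX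
    refine F.eq_zero_of_mem_lowDeg hn (ιg_smul_mem_lowDeg F.par_smul hXp hw) ?_
    rw [map_smul, hFw, ← hHW.1 ⟨X, hXp⟩ hX, Up_smul_def, incl_ιp]
  · have hHp := mem_par_of_isCartan (n := n) (k := k) hH
    refine sub_eq_zero.1 (F.eq_zero_of_mem_lowDeg hn (Submodule.sub_mem _
      (ιg_smul_mem_lowDeg F.par_smul hHp hw) (Submodule.smul_mem _ _ hw)) ?_)
    rw [map_sub, map_smul, F.toFun_smul, hFw, ← hHW.2 ⟨H, hHp⟩ hH, Up_smul_def, incl_ιp, sub_self]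

/-- Extremality alone would only give a map from the ordinary Verma module; that `w` satisfies all
relations of `v_μ` gives the map from `M_𝔭(μ)`. -/
theorem OscRealization.maxIdeal_smul (hn : 2 ≤ n) (hk : 1 ≤ k) {lam mu : Fin (n + k) → ℂ}
    {ε : Bool} (h : lam + delta (n + k) = oddWt n k 1 (sg ε))
    (h' : mu + delta (n + k) = oddWt n k (-1) (sg (!ε))) (F : OscRealization n k ε θ) {w : M}
    (hw : w ∈ lowDeg n k θ)
    (hFw : F.toFun w = wvM n k ⟨k - 1, by omega⟩ (vac (n + k) (!ε)))
    {a : Up n k} (ha : a ∈ maxIdeal n k mu) : incl n k a • w = 0 := by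
  refine F.eq_zero_of_mem_lowDeg hn (incl_smul_mem_lowDeg F.par_smul a hw) ?_
  rw [map_smul, hFw, ← Up_smul_def]
  exact (mem_maxIdeal_mu hn hk h h').1 ha

end Extremal

/-! ### Generalized Verma modules -/

section GeneralizedVerma

variable {n k : ℕ} {lam : Fin (n + k) → ℂ}

theorem smul_tens (u u' : Ug n k) (v : VV n k lam) :
    u • tens n k lam u' v = tens n k lam (u * u') v := rfl

theorem tens_mul_incl (u : Ug n k) (a : Up n k) (v : VV n k lam) :
    tens n k lam (u * incl n k a) v = tens n k lam u (a • v) :=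
  (Submodule.Quotient.eq _).2 (Submodule.subset_span ⟨u, a, v, rfl⟩)

/-- The map `v ↦ 1 ⊗ v`. -/
def one_tens (n k : ℕ) (lam : Fin (n + k) → ℂ) : VV n k lam →ₗ[ℂ] MM n k lam where
  toFun v := tens n k lam 1 v
  map_add' v w := by
    rw [tens, TensorProduct.tmul_add]
    rfl
  map_smul' c v := by
    rw [tens, TensorProduct.tmul_smul]
    rfl

theorem tens_eq_smul (u : Ug n k) (v : VV n k lam) :
    tens n k lam u v = u • one_tens n k lam v := by
  change _ = u • tens n k lam 1 v
  rw [smul_tens, mul_one]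

theorem incl_smul_one_tens (a : Up n k) (v : VV n k lam) :
    incl n k a • one_tens n k lam v = one_tens n k lam (a • v) := by
  rw [← tens_eq_smul, ← one_mul (incl n k a), tens_mul_incl]
  rfl

theorem ιg_smul_one_tens (X : par n k) (v : VV n k lam) :
    ιg n k X.1 • one_tens n k lam v = one_tens n k lam (ιp n k X • v) := by
  rw [← incl_ιp, incl_smul_one_tens]

theorem exists_eq_smul_hwVec (v : VV n k lam) : ∃ a : Up n k, v = a • hwVec n k lam := by
  obtain ⟨a, rfl⟩ := Submodule.Quotient.mk_surjective _ v
  refine ⟨a, ?_⟩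
  rw [hwVec, ← Submodule.Quotient.mk_smul, smul_eq_mul, mul_one]

theorem mm_induction {P : MM n k lam → Prop} (hadd : ∀ x y, P x → P y → P (x + y)) (h0 : P 0)
    (h : ∀ (u : Ug n k) (v : VV n k lam), P (u • one_tens n k lam v)) (x : MM n k lam) : P x := by
  obtain ⟨x, rfl⟩ := Submodule.Quotient.mk_surjective _ x
  induction x using TensorProduct.induction_on with
  | zero => exact h0
  | tmul u v =>
    have := h u v
    rwa [← tens_eq_smul] at this
  | add x y hx hy => exact hadd _ _ hx hy

theorem hom_ext_hwVec {M : Type*} [AddCommGroup M] [Module (Ug n k) M]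
    {f g : MM n k lam →ₗ[Ug n k] M}
    (h : f (tens n k lam 1 (hwVec n k lam)) = g (tens n k lam 1 (hwVec n k lam))) : f = g := by
  have key : ∀ (f : MM n k lam →ₗ[Ug n k] M) (u : Ug n k) (a : Up n k),
      f (u • one_tens n k lam (a • hwVec n k lam)) =
        u • incl n k a • f (tens n k lam 1 (hwVec n k lam)) := by
    intro f u a
    rw [← incl_smul_one_tens]
    exact (f.map_smul u _).trans (congrArg (u • ·) (f.map_smul (incl n k a) _))
  refine LinearMap.ext fun x => mm_induction (P := fun x => f x = g x) (fun x y hx hy => ?_)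
    ((f.map_zero).trans g.map_zero.symm) (fun u v => ?_) x
  · exact (f.map_add x y).trans ((congrArg₂ (· + ·) hx hy).trans (g.map_add x y).symm)
  · obtain ⟨a, rfl⟩ := exists_eq_smul_hwVec v
    exact (key f u a).trans ((congrArg (fun t => u • incl n k a • t) h).trans (key g u a).symm)

/-- Frobenius reciprocity: `w` defines a `U(𝔭)`-map on `V_λ`, which extends to the tensor product
and respects the balancing relations. -/
theorem exists_hom {M : Type*} [AddCommGroup M] [Module ℂ M] [Module (Ug n k) M]
    [IsScalarTower ℂ (Ug n k) M] {w : M} (hw : ∀ a ∈ maxIdeal n k lam, incl n k a • w = 0) :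
    ∃ f : MM n k lam →ₗ[Ug n k] M, f (tens n k lam 1 (hwVec n k lam)) = w := by
  let _ : Module (Up n k) M := Module.compHom M (incl n k).toRingHom
  have hdef : ∀ (a : Up n k) (x : M), a • x = incl n k a • x := fun _ _ => rfl
  have _ : IsScalarTower ℂ (Up n k) M :=
    ⟨fun c a x => by rw [hdef, hdef, map_smul, smul_assoc]⟩
  let g₀ : VV n k lam →ₗ[Up n k] M :=
    Submodule.liftQ (maxIdeal n k lam) (LinearMap.toSpanSingleton (Up n k) M w) hw
  let g : VV n k lam →ₗ[ℂ] M :=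
    { toFun := g₀
      map_add' := map_add g₀
      map_smul' := fun c v => by
        rw [RingHom.id_apply, ← algebraMap_smul (Up n k) c v, map_smul, algebraMap_smul] }
  have hg : ∀ (a : Up n k) (v : VV n k lam), g (a • v) = incl n k a • g v :=
    fun a v => map_smul g₀ a v
  let F : Ug n k ⊗[ℂ] VV n k lam →ₗ[Ug n k] M :=
    TensorProduct.AlgebraTensorModule.lift (LinearMap.toSpanSingleton (Ug n k) _ g)
  have hF : ∀ (u : Ug n k) (v : VV n k lam), F (u ⊗ₜ v) = u • g v := fun u v => rfl
  refine ⟨Submodule.liftQ (balanced n k lam) F (Submodule.span_le.2 ?_), ?_⟩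
  · rintro _ ⟨u, a, v, rfl⟩
    change F _ = 0
    rw [map_sub, hF, hF, hg, mul_smul, sub_self]
  · change F (1 ⊗ₜ hwVec n k lam) = w
    rw [hF, one_smul]
    change (1 : Up n k) • w = w
    exact one_smul _ _

end GeneralizedVerma

/-! ### The extremal vector -/

section ExtremalVector

variable {n k : ℕ} {lam mu : Fin (n + k) → ℂ} {ε : Bool}

theorem exists_hom_oscM (hn : 2 ≤ n) (h : lam + delta (n + k) = oddWt n k 1 (sg ε)) :
    ∃ f : MM n k lam →ₗ[Ug n k] OscM n k, ∀ a : Up n k,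
      f (one_tens n k lam (a • hwVec n k lam)) = a • ket n k (vac (n + k) ε) := by
  obtain ⟨f, hf⟩ := exists_hom (lam := lam) (w := ket n k (vac (n + k) ε))
    fun a ha => (mem_maxIdeal_lam hn h).1 ha
  refine ⟨f, fun a => ?_⟩
  rw [← incl_smul_one_tens]
  exact (f.map_smul (incl n k a) _).trans (congrArg (incl n k a • ·) hf)

/-- The map from the generalized Verma module to the oscillator module. -/
def oscRealization (hn : 2 ≤ n) (h : lam + delta (n + k) = oddWt n k 1 (sg ε)) :
    OscRealization n k ε (one_tens n k lam) where
  par_smul X hX v := ⟨_, ιg_smul_one_tens ⟨X, hX⟩ v⟩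
  gen C hC x := mm_induction (P := fun x => x ∈ C) (fun _ _ => C.add_mem) C.zero_mem hC x
  toFun := (exists_hom_oscM hn h).choose
  toFun_θ v := by
    obtain ⟨a, rfl⟩ := exists_eq_smul_hwVec v
    rw [(exists_hom_oscM hn h).choose_spec]
    exact smul_ket_mem a (vac_mem_halfSpin hn ε)
  eq_zero v h0 := by
    obtain ⟨a, rfl⟩ := exists_eq_smul_hwVec v
    rw [(exists_hom_oscM hn h).choose_spec] at h0
    have h1 : a • hwVec n k lam = 0 := by
      rw [hwVec, ← Submodule.Quotient.mk_smul, Submodule.Quotient.mk_eq_zero, smul_eq_mul, mul_one]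
      exact (mem_maxIdeal_lam hn h).2 h0
    exact (congrArg (one_tens n k lam) h1).trans (one_tens n k lam).map_zero

theorem oscRealization_smul (hn : 2 ≤ n) (h : lam + delta (n + k) = oddWt n k 1 (sg ε))
    (a : Up n k) : (oscRealization hn h).toFun (one_tens n k lam (a • hwVec n k lam)) =
      a • ket n k (vac (n + k) ε) := (exists_hom_oscM hn h).choose_spec a

theorem one_smul_hwVec : (1 : Up n k) • hwVec n k lam = hwVec n k lam := by
  rw [hwVec, ← Submodule.Quotient.mk_smul, smul_eq_mul, mul_one]

theorem pI_mem_mid (hn : 2 ≤ n) (hm : 1 ≤ n + k) (ε : Bool) : pI hm ε ∈ mid n k := by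
  rw [mem_mid]
  cases ε <;> simp [pI] <;> omega

/-- In `∑_a G(a,e) (1 ⊗ γ_{a'} vac(!ε))` most terms vanish. The index `a = pI ε` gives `vac ε`, and
the first `n - 1` rows of the middle block survive because `γ_{a'}` is then a creation operator; all
other `γ_{a'}` kill `vac (!ε)`. -/
theorem wvM_vac_not (hn : 2 ≤ n) (hm : 1 ≤ n + k) (e : Fin (2 * (n + k))) :
    wvM n k e (vac (n + k) (!ε)) = ιg n k (G (pI hm ε) e) • ket n k (vac (n + k) ε) -
      ∑ j : Fin (n - 1), ιg n k (G ⟨k + j, by omega⟩ e) •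
        ket n k (cliff ℂ (pI hm ε) (cliff ℂ (⟨k + j, by omega⟩ : Fin (2 * (n + k))).rev
          (vac (n + k) ε))) := by
  let i : Fin (n - 1) ↪ Fin (2 * (n + k)) := ⟨fun j => ⟨k + j, by omega⟩, fun j j' h => by
    have h1 : k + (j : ℕ) = k + j' := Fin.ext_iff.1 h
    exact Fin.ext (by omega)⟩
  have hi : ∀ j, ((i j : Fin (2 * (n + k))) : ℕ) + 1 < n + k := fun j => by
    change k + (j : ℕ) + 1 < n + k
    omega
  have hp : n + k ≤ (pI hm ε : ℕ) + 1 := by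
    cases ε <;> simp [pI]
    omega
  have hne : ∀ j, pI hm ε ≠ i j := fun j hj => by
    have := hi j
    rw [← hj] at this
    omega
  rw [wvM_apply, ← Finset.sum_subset (s₁ := insert (pI hm ε) (Finset.univ.map i)),
    Finset.sum_insert, Finset.sum_map, pI_rev, cliff_pI_vac, Bool.not_not, sub_eq_add_neg,
    ← Finset.sum_neg_distrib]
  · congr 1
    refine Finset.sum_congr rfl fun j _ => ?_
    change ιg n k (G (i j) e) • _ = - (ιg n k (G (i j) e) • _)
    -- Writing `vac (!ε)` as `γ_{pI ε} vac ε` and anticommuting produces the minus sign in the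
    -- formula for `w`.
    rw [← smul_neg, ← map_neg, ← cliff_pI_vac hm ε, cliff_cliff_of_ne]
    · rfl
    · rw [Fin.rev_rev]
      exact hne j
  · intro h1
    obtain ⟨j, _, hj⟩ := Finset.mem_map.1 h1
    exact hne j hj.symm
  · intro a ha
    rcases Finset.mem_insert.1 ha with rfl | ha
    · exact pI_mem_mid hn hm ε
    · obtain ⟨j, _, rfl⟩ := Finset.mem_map.1 ha
      rw [mem_mid]
      change k ≤ k + (j : ℕ) ∧ k + (j : ℕ) < k + 2 * n
      omega
  · intro a ha ha'
    have h0 : cliff ℂ a.rev (vac (n + k) (!ε)) = 0 := by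
      rw [mem_mid] at ha
      rw [Finset.mem_insert, not_or] at ha'
      by_cases h1 : a = pI hm (!ε)
      · rw [h1, pI_rev, Bool.not_not]
        have := cliff_pI_not_vac hm (!ε)
        rwa [Bool.not_not] at this
      · refine cliff_vac_of_lt ?_ _
        have h2 : ¬ (a : ℕ) + 1 < n + k := fun h => ha'.2 (Finset.mem_map.2
          ⟨⟨a - k, by omega⟩, Finset.mem_univ _, Fin.ext (by
            change k + ((a : ℕ) - k) = a
            omega)⟩)
        have h3 : (a : ℕ) ≠ n + k := fun h => by
          cases ε
          · exact ha'.1 (Fin.ext (by simp [pI, h]))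
          · exact h1 (Fin.ext (by simp [pI, h]))
        have h4 : (a : ℕ) + 1 ≠ n + k := fun h => by
          cases ε
          · exact h1 (Fin.ext (by simp [pI]; omega))
          · exact ha'.1 (Fin.ext (by simp [pI]; omega))
        have := a.isLt
        rw [Fin.val_rev]
        omega
    rw [h0, map_zero, smul_zero]

theorem extVec_eq (hn : 2 ≤ n) (hk : 1 ≤ k) (hm : 1 ≤ n + k) {p : ℕ} (hp : k < p ∧ p ≤ k + 2 * n)
    (hpe : p = pI hm ε + 1) : extVec n k lam p hp =
      ιg n k (G (pI hm ε) ⟨k - 1, by omega⟩) • one_tens n k lam (hwVec n k lam) -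
      ∑ j : Fin (n - 1), ιg n k (G ⟨k + j, by omega⟩ ⟨k - 1, by omega⟩) •
        one_tens n k lam (ιp n k (genP n k p (k + (j + 1)) hp (by omega)) • hwVec n k lam) := by
  have hG := gen_eq_G (pI hm ε) ⟨k - 1, by omega⟩ p k hpe (by change k = k - 1 + 1; omega)
  have hG' : ∀ j : Fin (n - 1), gen (n + k) (k + (j + 1)) k =
      G ⟨k + j, by omega⟩ ⟨k - 1, by omega⟩ :=
    fun j => gen_eq_G ⟨k + j, by omega⟩ ⟨k - 1, by omega⟩ (k + (j + 1)) k
      (by change _ = k + (j : ℕ) + 1; omega) (by change k = k - 1 + 1; omega)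
  have key : ∀ X Y : so (n + k), X = Y → ∀ v : VV n k lam,
      tens n k lam (ιg n k X) v = ιg n k Y • one_tens n k lam v := by
    rintro X _ rfl v
    exact tens_eq_smul _ _
  exact congrArg₂ (· - ·) (key _ _ hG _) (Finset.sum_congr rfl fun j _ => key _ _ (hG' j) _)

theorem sub_sum_mem_lowDeg {M V : Type*} [AddCommGroup M] [Module ℂ M] [Module (Ug n k) M]
    [IsScalarTower ℂ (Ug n k) M] [AddCommGroup V] [Module ℂ V] (θ : V →ₗ[ℂ] M) (hn : 2 ≤ n)
    (hk : 1 ≤ k) (hm : 1 ≤ n + k) (v : V) (v' : Fin (n - 1) → V) :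
    ιg n k (G (pI hm ε) ⟨k - 1, by omega⟩) • θ v -
      ∑ j : Fin (n - 1), ιg n k (G ⟨k + j, by omega⟩ ⟨k - 1, by omega⟩) • θ (v' j) ∈
        lowDeg n k θ := by
  have hlt : ((⟨k - 1, by omega⟩ : Fin (2 * (n + k))) : ℕ) < k := by
    change k - 1 < k
    omega
  refine Submodule.sub_mem _ (G_smul_mem_lowDeg (pI_mem_mid hn hm ε) hlt _)
    (Submodule.sum_mem _ fun j _ => G_smul_mem_lowDeg ?_ hlt _)
  rw [mem_mid]
  change k ≤ k + (j : ℕ) ∧ k + (j : ℕ) < k + 2 * n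
  omega

theorem extVec_mem_lowDeg (hn : 2 ≤ n) (hk : 1 ≤ k) (hm : 1 ≤ n + k) {p : ℕ}
    (hp : k < p ∧ p ≤ k + 2 * n) (hpe : p = pI hm ε + 1) :
    extVec n k lam p hp ∈ lowDeg n k (one_tens n k lam) :=
  (congrArg (· ∈ lowDeg n k (one_tens n k lam)) (extVec_eq hn hk hm hp hpe)).mpr
    (sub_sum_mem_lowDeg _ hn hk hm _ _)

theorem map_sub_sum {M V : Type*} [AddCommGroup M] [Module ℂ M] [Module (Ug n k) M]
    [AddCommGroup V] [Module ℂ V] (θ : V →ₗ[ℂ] M) (hn : 2 ≤ n)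
    (hk : 1 ≤ k) (hm : 1 ≤ n + k) (f : M →ₗ[Ug n k] OscM n k) {v : V} {v' : Fin (n - 1) → V}
    (hv : f (θ v) = ket n k (vac (n + k) ε))
    (hv' : ∀ j, f (θ (v' j)) = ket n k (cliff ℂ (pI hm ε)
      (cliff ℂ (⟨k + j, by omega⟩ : Fin (2 * (n + k))).rev (vac (n + k) ε)))) :
    f (ιg n k (G (pI hm ε) ⟨k - 1, by omega⟩) • θ v -
      ∑ j : Fin (n - 1), ιg n k (G ⟨k + j, by omega⟩ ⟨k - 1, by omega⟩) • θ (v' j)) =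
        wvM n k ⟨k - 1, by omega⟩ (vac (n + k) (!ε)) := by
  rw [wvM_vac_not (ε := ε) hn hm, map_sub, map_smul, hv, map_sum]
  congr 1
  exact Finset.sum_congr rfl fun j _ => by rw [map_smul, hv']

theorem toFun_extVec (hn : 2 ≤ n) (hk : 1 ≤ k) (hm : 1 ≤ n + k) {p : ℕ}
    (hp : k < p ∧ p ≤ k + 2 * n) (hpe : p = pI hm ε + 1)
    (f : MM n k lam →ₗ[Ug n k] OscM n k) (hf : ∀ a : Up n k,
      f (one_tens n k lam (a • hwVec n k lam)) = a • ket n k (vac (n + k) ε)) :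
    f (extVec n k lam p hp) = wvM n k ⟨k - 1, by omega⟩ (vac (n + k) (!ε)) := by
  refine (congrArg f (extVec_eq hn hk hm hp hpe)).trans
    (map_sub_sum (one_tens n k lam) hn hk hm f
      (((congrArg (f <| one_tens n k lam ·) one_smul_hwVec).symm.trans (hf 1)).trans
        (one_smul _ _)) fun j => ?_)
  refine (hf _).trans ?_
  have hj : (⟨k + j, by omega⟩ : Fin (2 * (n + k))) ∈ mid n k := by
    rw [mem_mid]
    change k ≤ k + (j : ℕ) ∧ k + (j : ℕ) < k + 2 * n
    omega
  have hne : pI hm ε ≠ ⟨k + j, by omega⟩ := fun h => by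
    have h1 := Fin.ext_iff.1 h
    have h2 : n + k ≤ (pI hm ε : ℕ) + 1 := by
      cases ε <;> simp [pI]
      omega
    change (pI hm ε : ℕ) = k + j at h1
    omega
  have hG : genP n k p (k + (j + 1)) hp (by omega) = midG n k (pI_mem_mid hn hm ε) hj :=
    Subtype.ext (gen_eq_G (pI hm ε) ⟨k + j, by omega⟩ p (k + (j + 1)) hpe
      (by change _ = k + (j : ℕ) + 1; omega))
  rw [hG, midG_smul_ket, if_neg hne, sub_zero]

/-- That `maxIdeal` contains `hwIdeal` is not automatic for a sum of a possibly empty family of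
ideals; the model of `V_μ` supplies it. -/
theorem isExtremal_one_tens_hwVec (hn : 2 ≤ n) (hk : 1 ≤ k)
    (h : lam + delta (n + k) = oddWt n k 1 (sg ε))
    (h' : mu + delta (n + k) = oddWt n k (-1) (sg (!ε))) :
    IsExtremal n k mu mu (one_tens n k mu (hwVec n k mu)) := by
  have hHW : IsHW mu (hwVec n k mu) := isHW_mk fun a ha =>
    (mem_maxIdeal_mu hn hk h h').2 ((isHW_wvM hn hk h h').smul_eq_zero ha)
  refine ⟨fun X hX => ?_, fun H hH => ?_⟩
  · rw [ιg_smul_one_tens ⟨X, mem_par_of_isPos hX⟩, hHW.1 _ hX, map_zero]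
  · rw [ιg_smul_one_tens ⟨H, mem_par_of_isCartan hH⟩, hHW.2 _ hH, map_smul]

theorem exists_extremal_and_hom (hn : 2 ≤ n) (hk : 1 ≤ k) (hm : 1 ≤ n + k)
    (h : lam + delta (n + k) = oddWt n k 1 (sg ε))
    (h' : mu + delta (n + k) = oddWt n k (-1) (sg (!ε))) {p : ℕ}
    (hp : k < p ∧ p ≤ k + 2 * n) (hpe : p = pI hm ε + 1) :
    ∃ w : MM n k lam, w = extVec n k lam p hp ∧ w ≠ 0 ∧ IsExtremal n k lam mu w ∧
      (∀ w₁, IsExtremal n k lam mu w₁ → ∃ c : ℂ, w₁ = c • w) ∧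
      ∃ φ : MM n k mu →ₗ[Ug n k] MM n k lam, φ (tens n k mu 1 (hwVec n k mu)) = w ∧
        ∀ ψ : MM n k mu →ₗ[Ug n k] MM n k lam, ∃ c : ℂ, ψ = c • φ := by
  let F := oscRealization hn h
  have hw := extVec_mem_lowDeg (lam := lam) hn hk hm hp hpe
  have hFw := toFun_extVec hn hk hm hp hpe F.toFun (oscRealization_smul hn h)
  have huniq : ∀ w₁, IsExtremal n k lam mu w₁ → ∃ c : ℂ, w₁ = c • extVec n k lam p hp :=
    fun w₁ hw₁ => F.eq_smul_of_extremal hn hk h h' hw hFw hw₁.1 hw₁.2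
  have hex := exists_hom (lam := mu) fun a ha => F.maxIdeal_smul hn hk h h' hw hFw ha
  let φ := hex.choose
  have hφ : φ (tens n k mu 1 (hwVec n k mu)) = extVec n k lam p hp := hex.choose_spec
  have hne : extVec n k lam p hp ≠ 0 := fun h0 =>
    wvM_ne_zero hn (b := ⟨k - 1, by omega⟩) (by change k - 1 < k; omega) ε
      (hFw.symm.trans ((congrArg F.toFun h0).trans F.toFun.map_zero))
  have hext : IsExtremal n k lam mu (extVec n k lam p hp) := F.extremal hn hk h h' hw hFw
  have hψ : ∀ ψ : MM n k mu →ₗ[Ug n k] MM n k lam, ∃ c : ℂ, ψ = c • φ := by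
    intro ψ
    have hhw := isExtremal_one_tens_hwVec hn hk h h'
    -- A homomorphism carries `1 ⊗ v_μ` to an extremal vector of weight `μ`, hence to a multiple of
    -- `w`.
    have hψ : IsExtremal n k lam mu (ψ (one_tens n k mu (hwVec n k mu))) :=
      ⟨fun X hX => (ψ.map_smul _ _).symm.trans ((congrArg ψ (hhw.1 X hX)).trans ψ.map_zero),
        fun H hH => (ψ.map_smul _ _).symm.trans ((congrArg ψ (hhw.2 H hH)).trans
          (ψ.map_smul_of_tower _ _))⟩
    obtain ⟨c, hc⟩ := huniq _ hψ
    exact ⟨c, hom_ext_hwVec (hc.trans (congrArg (c • ·) hφ.symm))⟩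
  exact ⟨extVec n k lam p hp, rfl, hne, hext, huniq, φ, hφ, hψ⟩

end ExtremalVector

end GenVerma

end

/-- `ε` encodes the sign of the last coordinate of `λ + δ`. The two rows `k + n + 1` and `k + n` are
the middle indices `pI false` and `pI true`, counted from 1. -/
theorem mainTheorem3 (n k : ℕ) (hn : 2 ≤ n) (hk : 1 ≤ k)
    (lam mu lam' mu' : Fin (n + k) → ℂ)
    (hlam : lam + GenVerma.delta (n + k) = GenVerma.oddWt n k 1 1)
    (hmu : mu + GenVerma.delta (n + k) = GenVerma.oddWt n k (-1) (-1))
    (hlam' : lam' + GenVerma.delta (n + k) = GenVerma.oddWt n k 1 (-1))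
    (hmu' : mu' + GenVerma.delta (n + k) = GenVerma.oddWt n k (-1) 1) :
    (∃ w : GenVerma.MM n k lam,
      w = GenVerma.extVec n k lam (k + n + 1) ⟨by omega, by omega⟩ ∧
      w ≠ 0 ∧ GenVerma.IsExtremal n k lam mu w ∧
      (∀ w₁, GenVerma.IsExtremal n k lam mu w₁ → ∃ c : ℂ, w₁ = c • w) ∧
      ∃ φ : GenVerma.MM n k mu →ₗ[GenVerma.Ug n k] GenVerma.MM n k lam,
        φ (GenVerma.tens n k mu 1 (GenVerma.hwVec n k mu)) = w ∧
        ∀ ψ : GenVerma.MM n k mu →ₗ[GenVerma.Ug n k] GenVerma.MM n k lam,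
          ∃ c : ℂ, ψ = c • φ) ∧
    (∃ w : GenVerma.MM n k lam',
      w = GenVerma.extVec n k lam' (k + n) ⟨by omega, by omega⟩ ∧
      w ≠ 0 ∧ GenVerma.IsExtremal n k lam' mu' w ∧
      (∀ w₁, GenVerma.IsExtremal n k lam' mu' w₁ → ∃ c : ℂ, w₁ = c • w) ∧
      ∃ φ : GenVerma.MM n k mu' →ₗ[GenVerma.Ug n k] GenVerma.MM n k lam',
        φ (GenVerma.tens n k mu' 1 (GenVerma.hwVec n k mu')) = w ∧
        ∀ ψ : GenVerma.MM n k mu' →ₗ[GenVerma.Ug n k] GenVerma.MM n k lam',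
          ∃ c : ℂ, ψ = c • φ) := by
  have hm : 1 ≤ n + k := by omega
  have h1 : GenVerma.sg false = 1 := by simp [GenVerma.sg]
  have h2 : GenVerma.sg true = -1 := by simp [GenVerma.sg]
  exact ⟨GenVerma.exists_extremal_and_hom (ε := false) hn hk hm (by rw [h1]; exact hlam)
      (by rw [Bool.not_false, h2]; exact hmu) _ (by simp [GenVerma.pI]; omega),
    GenVerma.exists_extremal_and_hom (ε := true) hn hk hm (by rw [h2]; exact hlam')
      (by rw [Bool.not_true, h1]; exact hmu') _ (by simp [GenVerma.pI]; omega)⟩
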